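/- Let $F_3(z,p)=\sum_{n\ge 1}\sum_{\alpha\vdash n} h^3(\alpha)\,\frac{z^n}{n!}\,\frac{1}{\mu^3(\alpha)!}\,p_\alpha\in\mathbb{C}[[z,p_1,p_2,\dots]]$, where $p_\alpha=\prod_i p_{\alpha_i}$, where $\mu^3(\alpha)$ is the least $k\ge 0$ for which there are a permutation $\sigma\in S_n$ of type $\alpha$ and $3$-cycles $\delta_1,\dots,\delta_k\in S_n$ with $\delta_1\cdots\delta_k=\sigma$ that generate a transitive group on $\{1,\dots,n\}$, and where $h^3(\alpha)$ is the number of such tuples $(\delta_1,\dots,\delta_k,\sigma)$ with $k=\mu^3(\alpha)$ ($h^3(\alpha)=0$, and the term is absent, if there are none for any $k$). Let $W([3])=\frac13 :\!\operatorname{tr}(D^3)\!:$ with $D_{ab}=\sum_{c}X_{ac}\,\partial/\partial X_{bc}$, which on $\mathbb{C}[p_1,p_2,\dots]$, $p_k=\operatorname{tr}(X^k)$, is $$W([3])=\frac13\sum_{i,j,k\ge1}\Big(ijk\,p_{i+j+k}\tfrac{\partial^3}{\partial p_i\partial p_j\partial p_k}+i(j+k)p_{i+k}p_j\tfrac{\partial^2}{\partial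 p_i\partial p_{j+k}}+j(i+k)p_{i+j}p_k\tfrac{\partial^2}{\partial p_j\partial p_{i+k}}+k(i+j)p_{k+j}p_i\tfrac{\partial^2}{\partial p_k\partial p_{i+j}}+(i+j+k)p_ip_jp_k\tfrac{\partial}{\partial p_{i+j+k}}+(i+j+k)p_{i+j+k}\tfrac{\partial}{\partial p_{i+j+k}}\Big),$$ and let $\widetilde W([3])F$ be the expression obtained from $W([3])F$ by replacing each higher derivative of $F$ by the product of the corresponding first derivatives. Then $$\widetilde W([3])F_3-\frac13\sum_{i,j,k\ge1}(i+j+k)\,p_{i+j+k}\frac{\partial F_3}{\partial p_{i+j+k}}=\frac12\Big(z\frac{\partial F_3}{\partial z}+\sum_{i\ge1}p_i\frac{\partial F_3}{\partial p_i}-2F_3\Big).$$ Written out, this says $$\frac13\sum_{i,j,k\ge1}\Big((i+j+k)p_ip_jp_k\frac{\partial F_3}{\partial p_{i+j+k}}+ijk\,p_{i+j+k}\frac{\partial F_3}{\partial p_i}\frac{\partial F_3}{\partial p_j}\frac{\partial F_3}{\partial p_k}+3(i+j)k\,p_ip_{j+k}\frac{\partial F_3}{\partial p_{i+j}}\frac{\partial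 F_3}{\partial p_k}\Big)-\frac12\Big(z\frac{\partial F_3}{\partial z}+\sum_{i\ge1}p_i\frac{\partial F_3}{\partial p_i}-2F_3\Big)=0.$$ -/

import Mathlib

noncomputable section

namespace ThreeHurwitz

/-! ## Locally finite sums of formal power series -/

/-- The sum of a family of formal power series, formed coefficientwise.  In every use below each
coefficient receives only finitely many nonzero contributions. -/
def lsum {σ ι : Type*} (f : ι → MvPowerSeries σ ℂ) : MvPowerSeries σ ℂ :=
  fun m => ∑ᶠ i, MvPowerSeries.coeff m (f i)

/-! ## Differential operators in the variables `p₁, p₂, …` -/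

/-- The term `coef · p_{m₁} ⋯ p_{mᵣ} · ∂/∂p_{d₁} ⋯ ∂/∂p_{dₛ}` of a differential operator in the
variables `p₁, p₂, …`, where `mul = [m₁, …, mᵣ]` and `der = [d₁, …, dₛ]`. -/
structure PTerm where
  coef : ℂ
  mul : List ℕ+
  der : List ℕ+

/-- A term acting on the polynomial ring `ℂ[p₁, p₂, …]` as a differential operator. -/
def PTerm.apply (t : PTerm) (f : MvPolynomial ℕ+ ℂ) : MvPolynomial ℕ+ ℂ :=
  t.coef • ((t.mul.map MvPolynomial.X).prod *
    t.der.foldr (fun k g => MvPolynomial.pderiv k g) f)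

/-- The terms with index `(i, j, k)` of `3 W([3])`.  The theorem `aeval_W3` at the end identifies
the resulting operator `W3` with `(1/3) :tr (D ^ 3):` in matrix variables. -/
def W3Terms (i j k : ℕ+) : List PTerm :=
  [⟨(i : ℂ) * j * k, [i + j + k], [i, j, k]⟩,
   ⟨(i : ℂ) * (j + k), [i + k, j], [i, j + k]⟩,
   ⟨(j : ℂ) * (i + k), [i + j, k], [j, i + k]⟩,
   ⟨(k : ℂ) * (i + j), [k + j, i], [k, i + j]⟩,
   ⟨(i : ℂ) + j + k, [i, j, k], [i + j + k]⟩,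
   ⟨(i : ℂ) + j + k, [i + j + k], [i + j + k]⟩]

/-- The operator `W([3])` on `ℂ[p₁, p₂, …]`. -/
def W3 (f : MvPolynomial ℕ+ ℂ) : MvPolynomial ℕ+ ℂ :=
  (1 / 3 : ℂ) • ∑ᶠ t : ℕ+ × ℕ+ × ℕ+,
    ((W3Terms t.1 t.2.1 t.2.2).map (fun s => s.apply f)).sum

/-- The ring `ℂ[[z, p₁, p₂, …]]`: the variable `none` is `z`, and `some k` is `p_k`. -/
abbrev Series : Type := MvPowerSeries (Option ℕ+) ℂ

/-- The variable `z`. -/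
def z : Series := MvPowerSeries.X none

/-- The variable `p_k`. -/
def p (k : ℕ+) : Series := MvPowerSeries.X (some k)

/-- `∂F/∂z`. -/
def dz (F : Series) : Series := MvPowerSeries.pderiv ℂ none F

/-- `∂F/∂p_k`. -/
def dp (k : ℕ+) (F : Series) : Series := MvPowerSeries.pderiv ℂ (some k) F

/-- A term in which the higher derivative of `F` is replaced by the product of the first
derivatives of `F`. -/
def PTerm.applyTilde (t : PTerm) (F : Series) : Series :=
  t.coef • ((t.mul.map p).prod * (t.der.map (fun k => dp k F)).prod)

/-- The nonlinear operator obtained from `W([3])` by replacing each higher derivative by the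
product of the first derivatives. -/
def Wtilde3 (F : Series) : Series :=
  (1 / 3 : ℂ) • lsum fun t : ℕ+ × ℕ+ × ℕ+ =>
    ((W3Terms t.1 t.2.1 t.2.2).map (fun s => s.applyTilde F)).sum

/-! ## Minimal transitive factorizations into 3-cycles -/

/-- `σ = δ₁ ⋯ δ_k` is a product of 3-cycles generating a transitive group. -/
def IsTransFact {n k : ℕ} (δ : Fin k → Equiv.Perm (Fin n)) (σ : Equiv.Perm (Fin n)) : Prop :=
  (∀ i, (δ i).IsThreeCycle) ∧ (List.ofFn δ).prod = σ ∧
    MulAction.IsPretransitive (Subgroup.closure (Set.range δ)) (Fin n)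

/-- The permutation `σ` is of type `α` (fixed points count as parts equal to `1`). -/
def IsOfType {n : ℕ} (σ : Equiv.Perm (Fin n)) (α : n.Partition) : Prop :=
  σ.partition.parts = α.parts

/-- The number of tuples `(δ₁, …, δ_k, σ)` with `σ = δ₁ ⋯ δ_k` a transitive factorization into
3-cycles of a permutation `σ` of type `α`. -/
def hurwitz3 {n : ℕ} (k : ℕ) (α : n.Partition) : ℕ :=
  Nat.card {t : (Fin k → Equiv.Perm (Fin n)) × Equiv.Perm (Fin n) //
    IsOfType t.2 α ∧ IsTransFact t.1 t.2}

/-- The minimal number of 3-cycles in a transitive factorization of a permutation of type `α`.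
If there is no such factorization, this is `0`, and then `minHurwitz3 α = 0`. -/
def mu3 {n : ℕ} (α : n.Partition) : ℕ :=
  sInf {k | ∃ (δ : Fin k → Equiv.Perm (Fin n)) (σ : Equiv.Perm (Fin n)),
    IsOfType σ α ∧ IsTransFact δ σ}

/-- The number of minimal transitive ordered factorizations into 3-cycles of the permutations of
type `α`. -/
def minHurwitz3 {n : ℕ} (α : n.Partition) : ℕ := hurwitz3 (mu3 α) α

/-- `p_α`, the product of the `p_{αᵢ}` over the parts `αᵢ` of `α`. -/
def pPart {n : ℕ} (α : n.Partition) : Series := (α.parts.map fun i => p i.toPNat').prod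

/-- The generating function `F₃(z, p)`. -/
def F3 : Series :=
  lsum fun t : (n : ℕ+) × (n : ℕ).Partition =>
    ((minHurwitz3 t.2 : ℂ) / ((t.1 : ℕ).factorial * (mu3 t.2).factorial)) •
      (z ^ (t.1 : ℕ) * pPart t.2)

/-! ## The W-operators in matrix variables -/

/-- Entry `(a, b)` of `X ^ n`, for the infinite matrix `X = (X_{ab})` of variables. -/
def matPow : ℕ → ℕ → ℕ → MvPowerSeries (ℕ × ℕ) ℂ
  | 0, a, b => if a = b then 1 else 0
  | n + 1, a, b => lsum fun c => matPow n a c * MvPowerSeries.X (c, b)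

/-- `p_k = tr (X ^ k)`. -/
def traceX (k : ℕ+) : MvPowerSeries (ℕ × ℕ) ℂ := lsum fun a => matPow k a a

/-- The operator `W([d]) = (1/d) :tr (D ^ d):` on `ℂ[[X_{ab}]]`, with
`D_{ab} = ∑_e X_{ae} ∂/∂X_{be}`: the sum over `a₁, …, a_d` and `e₁, …, e_d` of
`∏ X_{aᵢ eᵢ} · ∏ ∂/∂X_{aᵢ₊₁ eᵢ}`, with `a_{d+1} = a₁`. -/
def matW (d : ℕ) (F : MvPowerSeries (ℕ × ℕ) ℂ) : MvPowerSeries (ℕ × ℕ) ℂ :=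
  (1 / d : ℂ) • lsum fun t : (Fin d → ℕ) × (Fin d → ℕ) =>
    (∏ i, MvPowerSeries.X (t.1 i, t.2 i)) *
      (List.finRange d).foldr
        (fun i G => MvPowerSeries.pderiv ℂ (t.1 (finRotate d i), t.2 i) G) F

namespace MatrixModel

set_option linter.unusedSectionVars false

section FiniteMatrix

variable {A : Type*} [CommRing A] [Algebra ℂ A] {N : ℕ} (x : Matrix (Fin N) (Fin N) A)
  (d : Fin N → Fin N → Derivation ℂ A A)

theorem d_pow (hx : ∀ i j k l, d i j (x k l) = if k = i ∧ l = j then 1 else 0)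
    (b e : Fin N) (n : ℕ) : ∀ i j, d b e ((x ^ n) i j) =
      ∑ u ∈ Finset.range n, (x ^ u) i b * (x ^ (n - 1 - u)) e j := by
  induction n with
  | zero =>
    intro i j
    by_cases h : i = j <;> simp [Matrix.one_apply, h]
  | succ n ih =>
    intro i j
    rw [pow_succ, Matrix.mul_apply, map_sum]
    simp only [Derivation.leibniz, smul_eq_mul, ih, hx]
    rw [Finset.sum_add_distrib, Finset.sum_range_succ, add_comm]
    congr 1
    · simp only [Finset.mul_sum]
      rw [Finset.sum_comm]
      refine Finset.sum_congr rfl fun u hu => ?_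
      have h1 : n + 1 - 1 - u = (n - 1 - u) + 1 := by
        have := Finset.mem_range.1 hu; omega
      rw [h1, pow_succ, Matrix.mul_apply, Finset.mul_sum]
      refine Finset.sum_congr rfl fun c _ => by ring
    · have : n + 1 - 1 - n = 0 := by omega
      rw [this, pow_zero, Finset.sum_eq_single b]
      · by_cases h : j = e
        · simp [Matrix.one_apply, h]
        · simp [h, Ne.symm h]
      · intro c _ hc; simp [hc]
      · simp

theorem d_trace (hx : ∀ i j k l, d i j (x k l) = if k = i ∧ l = j then 1 else 0)
    (b e : Fin N) (n : ℕ) : d b e ((x ^ n).trace) = n * (x ^ (n - 1)) e b := by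
  simp only [Matrix.trace, Matrix.diag_apply, map_sum, d_pow x d hx]
  rw [Finset.sum_comm]
  rw [Finset.sum_congr rfl (g := fun _ => (x ^ (n - 1)) e b)]
  · simp
  intro u hu
  have h1 : n - 1 = (n - 1 - u) + u := by
    have := Finset.mem_range.1 hu; omega
  conv_rhs => rw [h1, pow_add, Matrix.mul_apply]
  refine Finset.sum_congr rfl fun c _ => by ring

theorem contr (n : ℕ) (a b : Fin N) :
    ∑ e, x a e * (x ^ n) e b = (x ^ (n + 1)) a b := by
  rw [pow_succ', Matrix.mul_apply]

theorem dd_trace (hx : ∀ i j k l, d i j (x k l) = if k = i ∧ l = j then 1 else 0)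
    (b e b' e' : Fin N) (n : ℕ) : d b e (d b' e' ((x ^ n).trace)) =
      n * ∑ u ∈ Finset.range (n - 1), (x ^ u) e' b * (x ^ (n - 2 - u)) e b' := by
  rw [d_trace x d hx, Derivation.leibniz, d_pow x d hx]
  have : d b e (n : A) = 0 := by simp
  rw [this]
  simp [Nat.sub_sub]

theorem ddd_trace (hx : ∀ i j k l, d i j (x k l) = if k = i ∧ l = j then 1 else 0)
    (b e b' e' b'' e'' : Fin N) (n : ℕ) : d b e (d b' e' (d b'' e'' ((x ^ n).trace))) =
      n * ∑ u ∈ Finset.range (n - 1),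
        ((∑ v ∈ Finset.range u, (x ^ v) e'' b * (x ^ (u - 1 - v)) e b') *
            (x ^ (n - 2 - u)) e' b'' +
          (x ^ u) e'' b' * ∑ v ∈ Finset.range (n - 2 - u),
            (x ^ v) e' b * (x ^ (n - 3 - u - v)) e b'') := by
  rw [dd_trace x d hx, Derivation.leibniz]
  have : d b e (n : A) = 0 := by simp
  rw [this, map_sum, smul_zero, add_zero, smul_eq_mul]
  refine congrArg (fun t => (n : A) * t) (Finset.sum_congr rfl fun u _ => ?_)
  simp only [smul_eq_mul, Derivation.leibniz, d_pow x d hx]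
  have h : n - 2 - u - 1 = n - 3 - u := by omega
  rw [h]; ring


theorem c1 (hx : ∀ i j k l, d i j (x k l) = if k = i ∧ l = j then 1 else 0)
    (a b : Fin N) (n : ℕ) (hn : 0 < n) :
    ∑ e, x a e * d b e ((x ^ n).trace) = n * (x ^ n) a b := by
  simp only [d_trace x d hx]
  obtain ⟨m, rfl⟩ : ∃ m, n = m + 1 := ⟨n - 1, by omega⟩
  rw [← contr, Finset.mul_sum]
  exact Finset.sum_congr rfl fun e _ => by simp; ring

theorem c2 (hx : ∀ i j k l, d i j (x k l) = if k = i ∧ l = j then 1 else 0)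
    (a b a' b' : Fin N) (n : ℕ) :
    ∑ e, ∑ e', x a e * x a' e' * d b e (d b' e' ((x ^ n).trace)) =
      n * ∑ u ∈ Finset.range (n - 1), (x ^ (u + 1)) a' b * (x ^ (n - 1 - u)) a b' := by
  simp only [dd_trace x d hx, Finset.mul_sum]
  rw [Finset.sum_congr rfl fun e _ => Finset.sum_comm, Finset.sum_comm]
  refine Finset.sum_congr rfl fun u hu => ?_
  have h : n - 1 - u = n - 2 - u + 1 := by
    have := Finset.mem_range.1 hu; omega
  rw [h, ← contr, ← contr, Finset.sum_mul_sum, Finset.mul_sum, Finset.sum_comm]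
  refine Finset.sum_congr rfl fun e _ => ?_
  rw [Finset.mul_sum]
  exact Finset.sum_congr rfl fun e' _ => by ring

theorem sw3 (s : Finset ℕ) (g : ℕ → Fin N → Fin N → Fin N → A) :
    ∑ u ∈ s, ∑ e, ∑ e', ∑ e'', g u e e' e'' = ∑ e, ∑ e', ∑ e'', ∑ u ∈ s, g u e e' e'' := by
  rw [Finset.sum_comm]
  refine Finset.sum_congr rfl fun e _ => ?_
  rw [Finset.sum_comm]
  refine Finset.sum_congr rfl fun e' _ => ?_
  rw [Finset.sum_comm]

theorem c3 (hx : ∀ i j k l, d i j (x k l) = if k = i ∧ l = j then 1 else 0)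
    (a b a' b' a'' b'' : Fin N) (n : ℕ) :
    ∑ e, ∑ e', ∑ e'', x a e * x a' e' * x a'' e'' *
        d b e (d b' e' (d b'' e'' ((x ^ n).trace))) =
      n * ∑ u ∈ Finset.range (n - 1),
        ((∑ v ∈ Finset.range u, (x ^ (v + 1)) a'' b * (x ^ (u - v)) a b' *
            (x ^ (n - 1 - u)) a' b'') +
          ∑ v ∈ Finset.range (n - 2 - u),
            (x ^ (u + 1)) a'' b' * (x ^ (v + 1)) a' b * (x ^ (n - 2 - u - v)) a b'') := by
  have key : ∀ p q r : Fin N → A, ∑ e, ∑ e', ∑ e'', x a e * x a' e' * x a'' e'' *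
      (p e * q e' * r e'') = (∑ e, x a e * p e) * (∑ e, x a' e * q e) * (∑ e, x a'' e * r e) := by
    intro p q r
    rw [mul_assoc, Finset.sum_mul]
    refine Finset.sum_congr rfl fun e _ => ?_
    rw [Finset.sum_mul_sum, Finset.mul_sum]
    refine Finset.sum_congr rfl fun e' _ => ?_
    rw [Finset.mul_sum]
    exact Finset.sum_congr rfl fun e'' _ => by ring
  simp only [ddd_trace x d hx]
  have h1 : ∀ u ∈ Finset.range (n - 1), ∀ v ∈ Finset.range u,
      (x ^ (v + 1)) a'' b * (x ^ (u - v)) a b' * (x ^ (n - 1 - u)) a' b'' =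
      ∑ e, ∑ e', ∑ e'', x a e * x a' e' * x a'' e'' *
        ((x ^ (u - 1 - v)) e b' * (x ^ (n - 2 - u)) e' b'' * (x ^ v) e'' b) := by
    intro u hu v hv
    have hu := Finset.mem_range.1 hu
    have hv := Finset.mem_range.1 hv
    rw [key, contr, contr, contr, show u - 1 - v + 1 = u - v by omega,
      show n - 2 - u + 1 = n - 1 - u by omega]
    ring
  have h2 : ∀ u ∈ Finset.range (n - 1), ∀ v ∈ Finset.range (n - 2 - u),
      (x ^ (u + 1)) a'' b' * (x ^ (v + 1)) a' b * (x ^ (n - 2 - u - v)) a b'' =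
      ∑ e, ∑ e', ∑ e'', x a e * x a' e' * x a'' e'' *
        ((x ^ (n - 3 - u - v)) e b'' * (x ^ v) e' b * (x ^ u) e'' b') := by
    intro u hu v hv
    have hu := Finset.mem_range.1 hu
    have hv := Finset.mem_range.1 hv
    rw [key, contr, contr, contr, show n - 3 - u - v + 1 = n - 2 - u - v by omega]
    ring
  rw [Finset.sum_congr rfl fun u hu => congrArg₂ (· + ·)
    (Finset.sum_congr rfl (h1 u hu)) (Finset.sum_congr rfl (h2 u hu))]
  simp only [sw3, ← Finset.sum_add_distrib]
  rw [Finset.mul_sum]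
  refine Finset.sum_congr rfl fun e _ => ?_
  rw [Finset.mul_sum]
  refine Finset.sum_congr rfl fun e' _ => ?_
  rw [Finset.mul_sum]
  refine Finset.sum_congr rfl fun e'' _ => ?_
  simp only [Finset.mul_sum, Finset.sum_mul, mul_add]
  refine Finset.sum_congr rfl fun u _ => ?_
  congr 1 <;> exact Finset.sum_congr rfl fun v _ => by ring

theorem d_supported (S : Set ℕ+) (f : MvPolynomial ℕ+ ℂ) (hf : f ∈ MvPolynomial.supported ℂ S)
    (k : ℕ+) : MvPolynomial.pderiv k f ∈ MvPolynomial.supported ℂ S := by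
  classical
  rw [MvPolynomial.supported] at hf
  induction hf using Algebra.adjoin_induction with
  | mem y hy =>
    obtain ⟨i, _, rfl⟩ := hy
    rw [MvPolynomial.pderiv_X]
    by_cases h : i = k
    · subst h; simp
    · simp [h]
  | algebraMap r =>
    rw [MvPolynomial.algebraMap_eq, MvPolynomial.pderiv_C]; exact Subalgebra.zero_mem _
  | add p q _ _ hp hq => rw [map_add]; exact Subalgebra.add_mem _ hp hq
  | mul p q hp' hq' hp hq =>
    rw [MvPolynomial.pderiv_mul]
    exact Subalgebra.add_mem _ (Subalgebra.mul_mem _ hp hq') (Subalgebra.mul_mem _ hp' hq)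

theorem chain (S : Finset ℕ+) (P : ℕ+ → A) (D : Derivation ℂ A A) (f : MvPolynomial ℕ+ ℂ)
    (hf : f ∈ MvPolynomial.supported ℂ (S : Set ℕ+)) :
    D (MvPolynomial.aeval P f) =
      ∑ k ∈ S, MvPolynomial.aeval P (MvPolynomial.pderiv k f) * D (P k) := by
  classical
  rw [MvPolynomial.supported] at hf
  induction hf using Algebra.adjoin_induction with
  | mem y hy =>
    obtain ⟨i, hi, rfl⟩ := hy
    rw [Finset.sum_eq_single i]
    · simp
    · intro k _ hk; simp [MvPolynomial.pderiv_X_of_ne hk.symm]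
    · intro h; exact absurd hi h
  | algebraMap r => simp [MvPolynomial.algebraMap_eq]
  | add p q _ _ hp hq => simp only [map_add, hp, hq, add_mul, Finset.sum_add_distrib]
  | mul p q _ _ hp hq =>
    simp only [MvPolynomial.pderiv_mul]
    rw [map_mul, Derivation.leibniz, smul_eq_mul, smul_eq_mul, hp, hq, Finset.mul_sum,
      Finset.mul_sum, ← Finset.sum_add_distrib]
    refine Finset.sum_congr rfl fun k _ => ?_
    rw [map_add, map_mul, map_mul]
    ring


theorem pair_sum (n K : ℕ+) (hn : n ≤ K) (h : ℕ → ℕ → A) :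
    ∑ u ∈ Finset.range ((n : ℕ) - 1), h (u + 1) ((n : ℕ) - 1 - u) =
      ∑ j ∈ Finset.Icc 1 K, ∑ k ∈ Finset.Icc 1 K, if j + k = n then h j k else 0 := by
  have hn' : (n : ℕ) ≤ K := hn
  rw [← Finset.sum_product', ← Finset.sum_filter]
  refine Finset.sum_bij' (fun u _ => (Nat.toPNat' (u + 1), Nat.toPNat' ((n : ℕ) - 1 - u)))
    (fun p _ => (p.1 : ℕ) - 1) ?_ ?_ ?_ ?_ ?_
  · intro u hu
    have hu := Finset.mem_range.1 hu
    simp only [Finset.mem_filter, Finset.mem_product, Finset.mem_Icc, ← PNat.coe_le_coe,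
      ← PNat.coe_inj, PNat.add_coe, Nat.toPNat'_coe, PNat.one_coe]
    split_ifs <;> omega
  · rintro ⟨j, k⟩ hp
    simp only [Finset.mem_filter, Finset.mem_product, ← PNat.coe_inj, PNat.add_coe] at hp
    have := j.pos
    have := k.pos
    simp only [Finset.mem_range]
    omega
  · intro u hu
    simp
  · rintro ⟨j, k⟩ hp
    simp only [Finset.mem_filter, Finset.mem_product, ← PNat.coe_inj, PNat.add_coe] at hp
    have := j.pos
    have := k.pos
    simp only [Prod.mk.injEq, ← PNat.coe_inj, Nat.toPNat'_coe]
    split_ifs <;> omega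
  · intro u hu
    have hu := Finset.mem_range.1 hu
    simp only [Nat.toPNat'_coe]
    rw [if_pos (by omega), if_pos (by omega)]

theorem triple_sum (n K : ℕ+) (hn : n ≤ K) (h : ℕ → ℕ → ℕ → A) :
    ∑ u ∈ Finset.range ((n : ℕ) - 1), ∑ v ∈ Finset.range u,
        h (v + 1) (u - v) ((n : ℕ) - 1 - u) =
      ∑ i ∈ Finset.Icc 1 K, ∑ j ∈ Finset.Icc 1 K, ∑ k ∈ Finset.Icc 1 K,
        if i + j + k = n then h i j k else 0 := by
  have hn' : (n : ℕ) ≤ K := hn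
  simp only [← Finset.sum_product']
  rw [← Finset.sum_filter, Finset.sum_sigma']
  refine Finset.sum_bij' (fun u _ => (Nat.toPNat' (u.2 + 1), Nat.toPNat' (u.1 - u.2),
      Nat.toPNat' ((n : ℕ) - 1 - u.1)))
    (fun p _ => ⟨(p.1 : ℕ) + p.2.1 - 1, (p.1 : ℕ) - 1⟩) ?_ ?_ ?_ ?_ ?_
  · rintro ⟨u, v⟩ hu
    simp only [Finset.mem_sigma, Finset.mem_range] at hu
    simp only [Finset.mem_filter, Finset.mem_product, Finset.mem_Icc, ← PNat.coe_le_coe,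
      ← PNat.coe_inj, PNat.add_coe, Nat.toPNat'_coe, PNat.one_coe]
    split_ifs <;> omega
  · rintro ⟨i, j, k⟩ hp
    simp only [Finset.mem_filter, Finset.mem_product, ← PNat.coe_inj, PNat.add_coe] at hp
    have := i.pos
    have := j.pos
    have := k.pos
    simp only [Finset.mem_sigma, Finset.mem_range]
    omega
  · rintro ⟨u, v⟩ hu
    simp only [Finset.mem_sigma, Finset.mem_range] at hu
    simp only [Nat.toPNat'_coe, Sigma.mk.injEq, heq_eq_eq]
    split_ifs <;> omega
  · rintro ⟨i, j, k⟩ hp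
    simp only [Finset.mem_filter, Finset.mem_product, ← PNat.coe_inj, PNat.add_coe] at hp
    have := i.pos
    have := j.pos
    have := k.pos
    simp only [Prod.mk.injEq, ← PNat.coe_inj, Nat.toPNat'_coe]
    split_ifs <;> omega
  · rintro ⟨u, v⟩ hu
    simp only [Finset.mem_sigma, Finset.mem_range] at hu
    simp only [Nat.toPNat'_coe]
    rw [if_pos (by omega), if_pos (by omega), if_pos (by omega)]

theorem triple_sum' (n K : ℕ+) (hn : n ≤ K) (h : ℕ → ℕ → ℕ → A) :
    ∑ u ∈ Finset.range ((n : ℕ) - 1), ∑ v ∈ Finset.range ((n : ℕ) - 2 - u),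
        h (u + 1) (v + 1) ((n : ℕ) - 2 - u - v) =
      ∑ i ∈ Finset.Icc 1 K, ∑ j ∈ Finset.Icc 1 K, ∑ k ∈ Finset.Icc 1 K,
        if i + j + k = n then h i j k else 0 := by
  have hn' : (n : ℕ) ≤ K := hn
  simp only [← Finset.sum_product']
  rw [← Finset.sum_filter, Finset.sum_sigma']
  refine Finset.sum_bij' (fun u _ => (Nat.toPNat' (u.1 + 1), Nat.toPNat' (u.2 + 1),
      Nat.toPNat' ((n : ℕ) - 2 - u.1 - u.2)))
    (fun p _ => ⟨(p.1 : ℕ) - 1, (p.2.1 : ℕ) - 1⟩) ?_ ?_ ?_ ?_ ?_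
  · rintro ⟨u, v⟩ hu
    simp only [Finset.mem_sigma, Finset.mem_range] at hu
    simp only [Finset.mem_filter, Finset.mem_product, Finset.mem_Icc, ← PNat.coe_le_coe,
      ← PNat.coe_inj, PNat.add_coe, Nat.toPNat'_coe, PNat.one_coe]
    split_ifs <;> omega
  · rintro ⟨i, j, k⟩ hp
    simp only [Finset.mem_filter, Finset.mem_product, ← PNat.coe_inj, PNat.add_coe] at hp
    have := i.pos
    have := j.pos
    have := k.pos
    simp only [Finset.mem_sigma, Finset.mem_range]
    omega
  · rintro ⟨u, v⟩ hu
    simp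
  · rintro ⟨i, j, k⟩ hp
    simp only [Finset.mem_filter, Finset.mem_product, ← PNat.coe_inj, PNat.add_coe] at hp
    have := i.pos
    have := j.pos
    have := k.pos
    simp only [Prod.mk.injEq, ← PNat.coe_inj, Nat.toPNat'_coe]
    split_ifs <;> omega
  · rintro ⟨u, v⟩ hu
    simp only [Finset.mem_sigma, Finset.mem_range] at hu
    simp only [Nat.toPNat'_coe]
    rw [if_pos (by omega), if_pos (by omega), if_pos (by omega)]

/-- Contraction with three factors `X_{ae}`. -/
def ctr (x : Matrix (Fin N) (Fin N) A)
    (g : Fin N → Fin N → Fin N → Fin N → Fin N → Fin N → A) : A :=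
  ∑ a, ∑ a', ∑ a'', ∑ e, ∑ e', ∑ e'', x a e * x a' e' * x a'' e'' * g a a' a'' e e' e''

theorem ctr_add (g g' : Fin N → Fin N → Fin N → Fin N → Fin N → Fin N → A) :
    ctr x (fun a a' a'' e e' e'' => g a a' a'' e e' e'' + g' a a' a'' e e' e'') =
      ctr x g + ctr x g' := by
  simp only [ctr, mul_add, Finset.sum_add_distrib]

theorem ctr_mul (c : A) (g : Fin N → Fin N → Fin N → Fin N → Fin N → Fin N → A) :
    ctr x (fun a a' a'' e e' e'' => c * g a a' a'' e e' e'') = c * ctr x g := by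
  simp only [ctr, mul_left_comm _ c, ← Finset.mul_sum]

theorem ctr_sum {ι : Type*} (s : Finset ι)
    (g : ι → Fin N → Fin N → Fin N → Fin N → Fin N → Fin N → A) :
    ctr x (fun a a' a'' e e' e'' => ∑ i ∈ s, g i a a' a'' e e' e'') = ∑ i ∈ s, ctr x (g i) := by
  classical
  induction s using Finset.induction_on with
  | empty => simp [ctr]
  | insert i s hi ih => simp only [Finset.sum_insert hi, ctr_add, ih]

theorem tr3 (i j k : ℕ) :
    ∑ a, ∑ a', ∑ a'', (x ^ i) a a' * (x ^ j) a' a'' * (x ^ k) a'' a = (x ^ (i + j + k)).trace := by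
  rw [Matrix.trace, pow_add, pow_add]
  refine Finset.sum_congr rfl fun a _ => ?_
  rw [Matrix.diag_apply, Matrix.mul_apply, Finset.sum_comm]
  refine Finset.sum_congr rfl fun a'' _ => ?_
  rw [Matrix.mul_apply, Finset.sum_mul]

theorem tr2 (i j : ℕ) :
    ∑ a, ∑ a', (x ^ i) a a' * (x ^ j) a' a = (x ^ (i + j)).trace := by
  rw [Matrix.trace, pow_add]
  refine Finset.sum_congr rfl fun a _ => ?_
  rw [Matrix.diag_apply, Matrix.mul_apply]

theorem ctrA (hx : ∀ i j k l, d i j (x k l) = if k = i ∧ l = j then 1 else 0) (k l m : ℕ+) :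
    ctr x (fun a a' a'' e e' e'' => d a' e ((x ^ (m : ℕ)).trace) *
      (d a'' e' ((x ^ (l : ℕ)).trace) * d a e'' ((x ^ (k : ℕ)).trace))) =
      (k : A) * l * m * (x ^ ((m : ℕ) + l + k)).trace := by
  rw [← tr3, ctr, Finset.mul_sum]
  refine Finset.sum_congr rfl fun a _ => ?_
  rw [Finset.mul_sum]
  refine Finset.sum_congr rfl fun a' _ => ?_
  rw [Finset.mul_sum]
  refine Finset.sum_congr rfl fun a'' _ => ?_
  calc _ = (∑ e, x a e * d a' e ((x ^ (m : ℕ)).trace)) *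
        ((∑ e, x a' e * d a'' e ((x ^ (l : ℕ)).trace)) *
          (∑ e, x a'' e * d a e ((x ^ (k : ℕ)).trace))) := by
        rw [Finset.sum_mul]
        refine Finset.sum_congr rfl fun e _ => ?_
        rw [Finset.sum_mul_sum, Finset.mul_sum]
        refine Finset.sum_congr rfl fun e' _ => ?_
        rw [Finset.mul_sum]
        exact Finset.sum_congr rfl fun e'' _ => by ring
    _ = _ := by
        rw [c1 x d hx _ _ _ m.pos, c1 x d hx _ _ _ l.pos, c1 x d hx _ _ _ k.pos]
        ring


theorem ctrB1 (hx : ∀ i j k l, d i j (x k l) = if k = i ∧ l = j then 1 else 0) (k l : ℕ+) :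
    ctr x (fun a a' a'' e e' e'' => d a' e ((x ^ (l : ℕ)).trace) *
      d a'' e' (d a e'' ((x ^ (k : ℕ)).trace))) =
      (k : A) * l * ∑ u ∈ Finset.range ((k : ℕ) - 1),
        (x ^ (u + 1)).trace * (x ^ ((l : ℕ) + (k - 1 - u))).trace := by
  have h0 : ∀ u, (x ^ (u + 1)).trace * (x ^ ((l : ℕ) + (k - 1 - u))).trace =
      ∑ a, ∑ a', ∑ a'', (x ^ (l : ℕ)) a a' * (x ^ (u + 1)) a'' a'' *
        (x ^ ((k : ℕ) - 1 - u)) a' a := by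
    intro u
    rw [← tr2 x l, Finset.mul_sum]
    refine Finset.sum_congr rfl fun a _ => ?_
    rw [Finset.mul_sum]
    refine Finset.sum_congr rfl fun a' _ => ?_
    rw [Matrix.trace, Finset.sum_mul]
    refine Finset.sum_congr rfl fun a'' _ => ?_
    rw [Matrix.diag_apply]; ring
  simp only [h0, sw3]
  rw [ctr, Finset.mul_sum]
  refine Finset.sum_congr rfl fun a _ => ?_
  rw [Finset.mul_sum]
  refine Finset.sum_congr rfl fun a' _ => ?_
  rw [Finset.mul_sum]
  refine Finset.sum_congr rfl fun a'' _ => ?_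
  calc _ = (∑ e, x a e * d a' e ((x ^ (l : ℕ)).trace)) *
        (∑ e', ∑ e'', x a' e' * x a'' e'' * d a'' e' (d a e'' ((x ^ (k : ℕ)).trace))) := by
        rw [Finset.sum_mul]
        refine Finset.sum_congr rfl fun e _ => ?_
        rw [Finset.mul_sum]
        refine Finset.sum_congr rfl fun e' _ => ?_
        rw [Finset.mul_sum]
        exact Finset.sum_congr rfl fun e'' _ => by ring
    _ = _ := by
        rw [c1 x d hx _ _ _ l.pos, c2 x d hx]
        simp only [Finset.mul_sum]
        exact Finset.sum_congr rfl fun u _ => by ring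

theorem ctrB2 (hx : ∀ i j k l, d i j (x k l) = if k = i ∧ l = j then 1 else 0) (k l : ℕ+) :
    ctr x (fun a a' a'' e e' e'' => d a e'' ((x ^ (k : ℕ)).trace) *
      d a' e (d a'' e' ((x ^ (l : ℕ)).trace))) =
      (k : A) * l * ∑ u ∈ Finset.range ((l : ℕ) - 1),
        (x ^ (u + 1)).trace * (x ^ ((k : ℕ) + (l - 1 - u))).trace := by
  have h0 : ∀ u, (x ^ (u + 1)).trace * (x ^ ((k : ℕ) + (l - 1 - u))).trace =
      ∑ a, ∑ a', ∑ a'', (x ^ (k : ℕ)) a'' a * (x ^ (u + 1)) a' a' *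
        (x ^ ((l : ℕ) - 1 - u)) a a'' := by
    intro u
    rw [← tr2 x k, Finset.sum_comm, Finset.mul_sum]
    refine Finset.sum_congr rfl fun a _ => ?_
    rw [Matrix.trace, Finset.sum_mul]
    refine Finset.sum_congr rfl fun a' _ => ?_
    rw [Finset.mul_sum]
    refine Finset.sum_congr rfl fun a'' _ => ?_
    rw [Matrix.diag_apply]; ring
  simp only [h0, sw3]
  rw [ctr, Finset.mul_sum]
  refine Finset.sum_congr rfl fun a _ => ?_
  rw [Finset.mul_sum]
  refine Finset.sum_congr rfl fun a' _ => ?_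
  rw [Finset.mul_sum]
  refine Finset.sum_congr rfl fun a'' _ => ?_
  calc _ = (∑ e, ∑ e', x a e * x a' e' * d a' e (d a'' e' ((x ^ (l : ℕ)).trace))) *
        (∑ e'', x a'' e'' * d a e'' ((x ^ (k : ℕ)).trace)) := by
        rw [Finset.sum_mul]
        refine Finset.sum_congr rfl fun e _ => ?_
        rw [Finset.sum_mul]
        refine Finset.sum_congr rfl fun e' _ => ?_
        rw [Finset.mul_sum]
        exact Finset.sum_congr rfl fun e'' _ => by ring
    _ = _ := by
        rw [c1 x d hx _ _ _ k.pos, c2 x d hx]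
        simp only [Finset.mul_sum, Finset.sum_mul]
        exact Finset.sum_congr rfl fun u _ => by ring

theorem ctrB3 (hx : ∀ i j k l, d i j (x k l) = if k = i ∧ l = j then 1 else 0) (k l : ℕ+) :
    ctr x (fun a a' a'' e e' e'' => d a'' e' ((x ^ (l : ℕ)).trace) *
      d a' e (d a e'' ((x ^ (k : ℕ)).trace))) =
      (k : A) * l * ∑ u ∈ Finset.range ((k : ℕ) - 1),
        (x ^ ((l : ℕ) + (u + 1))).trace * (x ^ ((k : ℕ) - 1 - u)).trace := by
  have h0 : ∀ u, (x ^ ((l : ℕ) + (u + 1))).trace * (x ^ ((k : ℕ) - 1 - u)).trace =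
      ∑ a, ∑ a', ∑ a'', (x ^ (l : ℕ)) a' a'' * (x ^ (u + 1)) a'' a' *
        (x ^ ((k : ℕ) - 1 - u)) a a := by
    intro u
    rw [← tr2 x l, mul_comm, Matrix.trace, Finset.sum_mul]
    refine Finset.sum_congr rfl fun a _ => ?_
    rw [Finset.mul_sum]
    refine Finset.sum_congr rfl fun a' _ => ?_
    rw [Finset.mul_sum]
    refine Finset.sum_congr rfl fun a'' _ => ?_
    rw [Matrix.diag_apply]; ring
  simp only [h0, sw3]
  rw [ctr, Finset.mul_sum]
  refine Finset.sum_congr rfl fun a _ => ?_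
  rw [Finset.mul_sum]
  refine Finset.sum_congr rfl fun a' _ => ?_
  rw [Finset.mul_sum]
  refine Finset.sum_congr rfl fun a'' _ => ?_
  calc _ = (∑ e', x a' e' * d a'' e' ((x ^ (l : ℕ)).trace)) *
        (∑ e, ∑ e'', x a e * x a'' e'' * d a' e (d a e'' ((x ^ (k : ℕ)).trace))) := by
        rw [Finset.mul_sum]
        refine Finset.sum_congr rfl fun e _ => ?_
        rw [Finset.sum_mul]
        refine Finset.sum_congr rfl fun e' _ => ?_
        rw [Finset.mul_sum]
        exact Finset.sum_congr rfl fun e'' _ => by ring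
    _ = _ := by
        rw [c1 x d hx _ _ _ l.pos, c2 x d hx]
        simp only [Finset.mul_sum]
        exact Finset.sum_congr rfl fun u _ => by ring

theorem ctrC (hx : ∀ i j k l, d i j (x k l) = if k = i ∧ l = j then 1 else 0) (k : ℕ+) :
    ctr x (fun a a' a'' e e' e'' => d a' e (d a'' e' (d a e'' ((x ^ (k : ℕ)).trace)))) =
      (k : A) * (∑ u ∈ Finset.range ((k : ℕ) - 1), ∑ v ∈ Finset.range u,
          (x ^ ((v + 1) + (u - v) + ((k : ℕ) - 1 - u))).trace +
        ∑ u ∈ Finset.range ((k : ℕ) - 1), ∑ v ∈ Finset.range ((k : ℕ) - 2 - u),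
          (x ^ (u + 1)).trace * (x ^ (v + 1)).trace * (x ^ ((k : ℕ) - 2 - u - v)).trace) := by
  have h1 : ∀ u v w : ℕ, (x ^ (u + v + w)).trace =
      ∑ a, ∑ a', ∑ a'', (x ^ u) a'' a' * (x ^ v) a a'' * (x ^ w) a' a := by
    intro u v w
    rw [show u + v + w = v + u + w by omega, ← tr3]
    refine Finset.sum_congr rfl fun a _ => ?_
    rw [Finset.sum_comm]
    refine Finset.sum_congr rfl fun a' _ => Finset.sum_congr rfl fun a'' _ => by ring
  have h2 : ∀ u v w : ℕ, (x ^ u).trace * (x ^ v).trace * (x ^ w).trace =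
      ∑ a, ∑ a', ∑ a'', (x ^ u) a'' a'' * (x ^ v) a' a' * (x ^ w) a a := by
    intro u v w
    rw [mul_comm, Matrix.trace, Finset.sum_mul]
    refine Finset.sum_congr rfl fun a _ => ?_
    rw [mul_comm (Matrix.trace _), Matrix.trace, Finset.sum_mul, Finset.mul_sum]
    refine Finset.sum_congr rfl fun a' _ => ?_
    rw [Matrix.trace, Finset.mul_sum, Finset.mul_sum]
    refine Finset.sum_congr rfl fun a'' _ => ?_
    simp only [Matrix.diag_apply]; ring
  simp only [h1, h2, sw3, ← Finset.sum_add_distrib]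
  rw [ctr, Finset.mul_sum]
  refine Finset.sum_congr rfl fun a _ => ?_
  rw [Finset.mul_sum]
  refine Finset.sum_congr rfl fun a' _ => ?_
  rw [Finset.mul_sum]
  refine Finset.sum_congr rfl fun a'' _ => ?_
  exact c3 x d hx _ _ _ _ _ _ _

theorem pderiv_swap (k l : ℕ+) (f : MvPolynomial ℕ+ ℂ) :
    MvPolynomial.pderiv k (MvPolynomial.pderiv l f) =
      MvPolynomial.pderiv l (MvPolynomial.pderiv k f) := by
  classical
  have h : ⁅MvPolynomial.pderiv (R := ℂ) k, MvPolynomial.pderiv (R := ℂ) l⁆ = 0 := by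
    refine MvPolynomial.derivation_ext fun i => ?_
    rw [Derivation.commutator_apply, MvPolynomial.pderiv_X, MvPolynomial.pderiv_X]
    simp only [Pi.single_apply]
    split_ifs <;> simp
  have := congrArg (fun D => D f) h
  simp only [Derivation.commutator_apply, Derivation.coe_zero, Pi.zero_apply] at this
  exact sub_eq_zero.1 this

theorem collapse2 (K : ℕ+) (g : ℕ+ → A) (hg : ∀ n, ¬ n ≤ K → g n = 0) (h : ℕ+ → ℕ+ → A) :
    ∑ n ∈ Finset.Icc 1 K, g n * ∑ j ∈ Finset.Icc 1 K, ∑ k ∈ Finset.Icc 1 K,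
        (if j + k = n then h j k else 0) =
      ∑ j ∈ Finset.Icc 1 K, ∑ k ∈ Finset.Icc 1 K, g (j + k) * h j k := by
  simp only [Finset.mul_sum]
  rw [Finset.sum_comm]
  refine Finset.sum_congr rfl fun j _ => ?_
  rw [Finset.sum_comm]
  refine Finset.sum_congr rfl fun k _ => ?_
  by_cases hn : j + k ≤ K
  · rw [Finset.sum_eq_single (j + k)]
    · simp
    · intro n _ hne; simp [hne.symm]
    · intro hh; exact absurd (Finset.mem_Icc.2 ⟨one_le, hn⟩) hh
  · rw [hg _ hn, zero_mul]
    refine Finset.sum_eq_zero fun n hm => ?_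
    rw [if_neg, mul_zero]
    rintro rfl
    exact hn (Finset.mem_Icc.1 hm).2

theorem collapse3 (K : ℕ+) (g : ℕ+ → A) (hg : ∀ n, ¬ n ≤ K → g n = 0) (h : ℕ+ → ℕ+ → ℕ+ → A) :
    ∑ n ∈ Finset.Icc 1 K, g n * ∑ i ∈ Finset.Icc 1 K, ∑ j ∈ Finset.Icc 1 K,
        ∑ k ∈ Finset.Icc 1 K, (if i + j + k = n then h i j k else 0) =
      ∑ i ∈ Finset.Icc 1 K, ∑ j ∈ Finset.Icc 1 K, ∑ k ∈ Finset.Icc 1 K,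
        g (i + j + k) * h i j k := by
  simp only [Finset.mul_sum]
  rw [Finset.sum_comm]
  refine Finset.sum_congr rfl fun i _ => ?_
  rw [Finset.sum_comm]
  refine Finset.sum_congr rfl fun j _ => ?_
  rw [Finset.sum_comm]
  refine Finset.sum_congr rfl fun k _ => ?_
  by_cases hn : i + j + k ≤ K
  · rw [Finset.sum_eq_single (i + j + k)]
    · simp
    · intro n _ hne; simp [hne.symm]
    · intro hh; exact absurd (Finset.mem_Icc.2 ⟨one_le, hn⟩) hh
  · rw [hg _ hn, zero_mul]
    refine Finset.sum_eq_zero fun n hm => ?_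
    rw [if_neg, mul_zero]
    rintro rfl
    exact hn (Finset.mem_Icc.1 hm).2

theorem not_mem_pderiv (K : ℕ+) (f : MvPolynomial ℕ+ ℂ)
    (hf : f ∈ MvPolynomial.supported ℂ (Finset.Icc 1 K : Set ℕ+)) (n : ℕ+) (hn : ¬ n ≤ K) :
    MvPolynomial.pderiv n f = 0 := by
  refine MvPolynomial.pderiv_eq_zero_of_notMem_vars fun h => hn ?_
  have := (MvPolynomial.mem_supported.1 hf) h
  exact (Finset.mem_Icc.1 (Finset.mem_coe.1 this)).2

/-- `∂ₗ ∂ₖ f` evaluated at the traces. -/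
def ev2 (x : Matrix (Fin N) (Fin N) A) (f : MvPolynomial ℕ+ ℂ) (k l : ℕ+) : A :=
  MvPolynomial.aeval (fun k : ℕ+ => (x ^ (k : ℕ)).trace)
    (MvPolynomial.pderiv l (MvPolynomial.pderiv k f))

theorem finB (K : ℕ+) (f : MvPolynomial ℕ+ ℂ)
    (hf : f ∈ MvPolynomial.supported ℂ (Finset.Icc 1 K : Set ℕ+)) (h : ℕ → ℕ → ℕ → A) :
    ∑ k ∈ Finset.Icc 1 K, ∑ l ∈ Finset.Icc 1 K, ev2 x f k l *
        ((k : A) * l * ∑ u ∈ Finset.range ((k : ℕ) - 1), h l (u + 1) ((k : ℕ) - 1 - u)) =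
      ∑ l ∈ Finset.Icc 1 K, ∑ i ∈ Finset.Icc 1 K, ∑ j ∈ Finset.Icc 1 K,
        (l : A) * (i + j) * (h l i j * ev2 x f (i + j) l) := by
  rw [Finset.sum_comm]
  refine Finset.sum_congr rfl fun l _ => ?_
  have := collapse2 K (fun k : ℕ+ => ev2 x f k l * ((k : A) * l))
    (fun n hn => by simp [ev2, not_mem_pderiv K f hf n hn]) (fun i j => h l i j)
  rw [Finset.sum_congr rfl fun k hk => by
    rw [pair_sum k K (Finset.mem_Icc.1 hk).2 (h l), ← mul_assoc]]
  rw [this]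
  refine Finset.sum_congr rfl fun i _ => Finset.sum_congr rfl fun j _ => ?_
  push_cast
  ring

theorem finC (K : ℕ+) (f : MvPolynomial ℕ+ ℂ)
    (hf : f ∈ MvPolynomial.supported ℂ (Finset.Icc 1 K : Set ℕ+)) (h h' : ℕ → ℕ → ℕ → A) :
    ∑ k ∈ Finset.Icc 1 K,
      MvPolynomial.aeval (fun k : ℕ+ => (x ^ (k : ℕ)).trace) (MvPolynomial.pderiv k f) *
        ((k : A) * (∑ u ∈ Finset.range ((k : ℕ) - 1), ∑ v ∈ Finset.range u,
          h (v + 1) (u - v) ((k : ℕ) - 1 - u) +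
        ∑ u ∈ Finset.range ((k : ℕ) - 1), ∑ v ∈ Finset.range ((k : ℕ) - 2 - u),
          h' (u + 1) (v + 1) ((k : ℕ) - 2 - u - v))) =
      ∑ i ∈ Finset.Icc 1 K, ∑ j ∈ Finset.Icc 1 K, ∑ k ∈ Finset.Icc 1 K,
        ((i : A) + j + k) * (h i j k + h' i j k) *
          MvPolynomial.aeval (fun k : ℕ+ => (x ^ (k : ℕ)).trace)
            (MvPolynomial.pderiv (i + j + k) f) := by
  have := collapse3 K (fun k : ℕ+ => MvPolynomial.aeval (fun k : ℕ+ => (x ^ (k : ℕ)).trace)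
      (MvPolynomial.pderiv k f) * (k : A))
    (fun n hn => by simp [not_mem_pderiv K f hf n hn]) (fun i j k => h i j k + h' i j k)
  rw [Finset.sum_congr rfl fun k hk => by
    rw [triple_sum k K (Finset.mem_Icc.1 hk).2 h, triple_sum' k K (Finset.mem_Icc.1 hk).2 h',
      ← mul_assoc]]
  simp only [← Finset.sum_add_distrib]
  have e : ∀ i j k n : ℕ+, ((if i + j + k = n then h i j k else 0) +
      (if i + j + k = n then h' i j k else 0)) =
      if i + j + k = n then h i j k + h' i j k else 0 := by
    intro i j k n; split_ifs <;> simp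
  simp only [e]
  rw [this]
  refine Finset.sum_congr rfl fun i _ => Finset.sum_congr rfl fun j _ =>
    Finset.sum_congr rfl fun k _ => ?_
  push_cast
  ring

theorem finW (hx : ∀ i j k l, d i j (x k l) = if k = i ∧ l = j then 1 else 0) (K : ℕ+)
    (f : MvPolynomial ℕ+ ℂ)
    (hf : f ∈ MvPolynomial.supported ℂ (Finset.Icc 1 K : Set ℕ+)) :
    ctr x (fun a a' a'' e e' e'' => d a' e (d a'' e' (d a e''
        (MvPolynomial.aeval (fun k : ℕ+ => (x ^ (k : ℕ)).trace) f)))) =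
      ∑ i ∈ Finset.Icc 1 K, ∑ j ∈ Finset.Icc 1 K, ∑ k ∈ Finset.Icc 1 K,
        ((W3Terms i j k).map (fun s =>
          MvPolynomial.aeval (fun k : ℕ+ => (x ^ (k : ℕ)).trace) (s.apply f))).sum := by
  have hf' : f ∈ MvPolynomial.supported ℂ ((Finset.Icc 1 K : Finset ℕ+) : Set ℕ+) := hf
  have hk := fun k => d_supported _ f hf' k
  have hkl := fun k l => d_supported _ _ (hk k) l
  set P : ℕ+ → A := fun k : ℕ+ => (x ^ (k : ℕ)).trace with hP
  have expand : ∀ D D' D'' : Derivation ℂ A A, D (D' (D'' (MvPolynomial.aeval P f))) =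
      ∑ k ∈ Finset.Icc 1 K, ∑ l ∈ Finset.Icc 1 K, ∑ m ∈ Finset.Icc 1 K,
        MvPolynomial.aeval P (MvPolynomial.pderiv m (MvPolynomial.pderiv l
          (MvPolynomial.pderiv k f))) * (D (P m) * (D' (P l) * D'' (P k))) +
      (∑ k ∈ Finset.Icc 1 K, ∑ l ∈ Finset.Icc 1 K, ev2 x f k l * (D (P l) * D' (D'' (P k))) +
      ∑ k ∈ Finset.Icc 1 K, ∑ l ∈ Finset.Icc 1 K, ev2 x f k l * (D'' (P k) * D (D' (P l))) +
      ∑ k ∈ Finset.Icc 1 K, ∑ l ∈ Finset.Icc 1 K, ev2 x f k l * (D' (P l) * D (D'' (P k)))) +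
      ∑ k ∈ Finset.Icc 1 K, MvPolynomial.aeval P (MvPolynomial.pderiv k f) *
        D (D' (D'' (P k))) := by
    intro D D' D''
    rw [chain _ P D'' f hf', map_sum, map_sum]
    simp only [← Finset.sum_add_distrib]
    refine Finset.sum_congr rfl fun k _ => ?_
    have e1 : D' (MvPolynomial.aeval P (MvPolynomial.pderiv k f) * D'' (P k)) =
        MvPolynomial.aeval P (MvPolynomial.pderiv k f) * D' (D'' (P k)) +
          D'' (P k) * ∑ l ∈ Finset.Icc 1 K, ev2 x f k l * D' (P l) := by
      rw [Derivation.leibniz, smul_eq_mul, smul_eq_mul, chain _ P D' _ (hk k)]; rfl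
    have e2 : D (∑ l ∈ Finset.Icc 1 K, ev2 x f k l * D' (P l)) =
        ∑ l ∈ Finset.Icc 1 K, (ev2 x f k l * D (D' (P l)) + D' (P l) *
          ∑ m ∈ Finset.Icc 1 K, MvPolynomial.aeval P (MvPolynomial.pderiv m
            (MvPolynomial.pderiv l (MvPolynomial.pderiv k f))) * D (P m)) := by
      rw [map_sum]
      refine Finset.sum_congr rfl fun l _ => ?_
      rw [Derivation.leibniz, smul_eq_mul, smul_eq_mul, ev2, ← hP, chain _ P D _ (hkl k l)]
    have e3 : D (MvPolynomial.aeval P (MvPolynomial.pderiv k f)) =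
        ∑ l ∈ Finset.Icc 1 K, ev2 x f k l * D (P l) := by
      rw [chain _ P D _ (hk k)]; rfl
    rw [e1, map_add, Derivation.leibniz, Derivation.leibniz, e2, e3]
    simp only [smul_eq_mul, Finset.mul_sum, Finset.sum_add_distrib, mul_add, Finset.sum_mul]
    have e4 : ∀ l m : ℕ+, D'' (P k) * (D' (P l) * (MvPolynomial.aeval P (MvPolynomial.pderiv m
            (MvPolynomial.pderiv l (MvPolynomial.pderiv k f))) * D (P m))) =
        MvPolynomial.aeval P (MvPolynomial.pderiv m (MvPolynomial.pderiv l
          (MvPolynomial.pderiv k f))) * (D (P m) * (D' (P l) * D'' (P k))) := fun l m => by ring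
    have e5 : ∀ l : ℕ+, D' (D'' (P k)) * (ev2 x f k l * D (P l)) =
        ev2 x f k l * (D (P l) * D' (D'' (P k))) := fun l => by ring
    have e6 : ∀ l : ℕ+, D'' (P k) * (ev2 x f k l * D (D' (P l))) =
        ev2 x f k l * (D'' (P k) * D (D' (P l))) := fun l => by ring
    have e8 : ∀ l : ℕ+, ev2 x f k l * D' (P l) * D (D'' (P k)) =
        ev2 x f k l * (D' (P l) * D (D'' (P k))) := fun l => by ring
    simp only [e4, e5, e6, e8]
    abel
  simp only [expand, ctr_add, ctr_sum, ctr_mul]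
  simp only [hP, ctrA x d hx, ctrB1 x d hx, ctrB2 x d hx, ctrB3 x d hx, ctrC x d hx]
  rw [finC x K f hf (fun i j k => (x ^ (i + j + k)).trace)
    (fun i j k => (x ^ i).trace * (x ^ j).trace * (x ^ k).trace)]
  have b1 := finB x K f hf (fun l i j => (x ^ i).trace * (x ^ (l + j)).trace)
  have b3 := finB x K f hf (fun l i j => (x ^ (l + i)).trace * (x ^ j).trace)
  have b2 : ∑ k ∈ Finset.Icc 1 K, ∑ l ∈ Finset.Icc 1 K, ev2 x f k l *
        ((k : A) * l * ∑ u ∈ Finset.range ((l : ℕ) - 1),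
          (x ^ (u + 1)).trace * (x ^ ((k : ℕ) + (l - 1 - u))).trace) =
      ∑ l ∈ Finset.Icc 1 K, ∑ i ∈ Finset.Icc 1 K, ∑ j ∈ Finset.Icc 1 K,
        (l : A) * (i + j) * ((x ^ (i : ℕ)).trace * (x ^ ((l : ℕ) + j)).trace *
          ev2 x f (i + j) l) := by
    rw [← b1, Finset.sum_comm]
    refine Finset.sum_congr rfl fun k _ => Finset.sum_congr rfl fun l _ => ?_
    rw [ev2, pderiv_swap, ← ev2]
    ring
  have s4 : ∀ g : ℕ+ → ℕ+ → ℕ+ → A, ∑ i ∈ Finset.Icc 1 K, ∑ j ∈ Finset.Icc 1 K,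
      ∑ k ∈ Finset.Icc 1 K, g i j k = ∑ k ∈ Finset.Icc 1 K, ∑ i ∈ Finset.Icc 1 K,
      ∑ j ∈ Finset.Icc 1 K, g i j k := by
    intro g
    rw [Finset.sum_congr rfl fun _ _ => Finset.sum_comm, Finset.sum_comm]
  have b2' := b2.trans (s4 (fun i j l => (l : A) * (i + j) * ((x ^ (i : ℕ)).trace *
    (x ^ ((l : ℕ) + j)).trace * ev2 x f (i + j) l))).symm
  rw [b1, b2', b3.trans Finset.sum_comm]
  simp only [W3Terms, List.map_cons, List.map_nil, List.sum_cons, List.sum_nil, PTerm.apply,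
    List.prod_cons, List.prod_nil, List.foldr_cons, List.foldr_nil, map_smul, map_mul,
    MvPolynomial.aeval_X, PNat.add_coe, map_one]
  simp only [Algebra.smul_def, map_mul, map_add, map_natCast, mul_one, add_zero,
    Finset.sum_add_distrib]
  have r1 : ∑ k ∈ Finset.Icc 1 K, ∑ l ∈ Finset.Icc 1 K, ∑ m ∈ Finset.Icc 1 K,
      MvPolynomial.aeval P (MvPolynomial.pderiv m (MvPolynomial.pderiv l
        (MvPolynomial.pderiv k f))) * ((k : A) * l * m * (x ^ ((m : ℕ) + l + k)).trace) =
      ∑ i ∈ Finset.Icc 1 K, ∑ j ∈ Finset.Icc 1 K, ∑ k ∈ Finset.Icc 1 K,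
        (i : A) * j * k * ((x ^ ((i : ℕ) + j + k)).trace * MvPolynomial.aeval P
          (MvPolynomial.pderiv i (MvPolynomial.pderiv j (MvPolynomial.pderiv k f)))) := by
    rw [s4, Finset.sum_congr rfl fun _ _ => Finset.sum_comm]
    refine Finset.sum_congr rfl fun i _ => Finset.sum_congr rfl fun j _ =>
      Finset.sum_congr rfl fun k _ => by ring
  rw [r1]
  simp only [← Finset.sum_add_distrib]
  refine Finset.sum_congr rfl fun i _ => Finset.sum_congr rfl fun j _ =>
      Finset.sum_congr rfl fun k _ => ?_
  simp only [ev2, ← hP]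
  rw [add_comm (j : ℕ) i]
  ring

end FiniteMatrix

section Truncation

open MvPowerSeries

/-- The variables `X_{ab}` with `a, b < N`. -/
def box (N : ℕ) : Finset (ℕ × ℕ) := Finset.range N ×ˢ Finset.range N

/-- Setting all variables outside the leading `N × N` block to zero. -/
def T0 (N : ℕ) (F : MvPowerSeries (ℕ × ℕ) ℂ) : MvPowerSeries (ℕ × ℕ) ℂ :=
  fun m => if m.support ⊆ box N then coeff m F else 0

theorem coeff_T0 (N : ℕ) (F : MvPowerSeries (ℕ × ℕ) ℂ) (m : (ℕ × ℕ) →₀ ℕ) :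
    coeff m (T0 N F) = if m.support ⊆ box N then coeff m F else 0 := rfl

theorem T0_C (N : ℕ) (r : ℂ) : T0 N (C r) = C r := by
  classical
  ext m
  rw [coeff_T0, coeff_C]
  split_ifs with h1 h2 h3 <;> simp_all

/-- `T0` as a homomorphism. -/
def T (N : ℕ) : MvPowerSeries (ℕ × ℕ) ℂ →ₐ[ℂ] MvPowerSeries (ℕ × ℕ) ℂ where
  toFun := T0 N
  map_one' := T0_C N 1
  map_mul' F G := by
    classical
    ext m
    rw [coeff_mul, coeff_T0, coeff_mul]
    simp only [coeff_T0]
    by_cases h : m.support ⊆ box N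
    · rw [if_pos h]
      refine Finset.sum_congr rfl fun p hp => ?_
      replace hp := Finset.HasAntidiagonal.mem_antidiagonal.1 hp
      rw [if_pos, if_pos]
      · exact (Finsupp.support_mono (by rw [← hp]; exact le_add_self)).trans h
      · exact (Finsupp.support_mono (by rw [← hp]; exact le_self_add)).trans h
    · rw [if_neg h]
      refine (Finset.sum_eq_zero fun p hp => ?_).symm
      replace hp := Finset.HasAntidiagonal.mem_antidiagonal.1 hp
      by_cases h1 : p.1.support ⊆ box N
      · rw [if_neg (c := p.2.support ⊆ box N), mul_zero]
        intro h2
        exact h (by rw [← hp]; exact Finsupp.support_add.trans (Finset.union_subset h1 h2))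
      · rw [if_neg h1, zero_mul]
  map_zero' := by
    ext m
    rw [coeff_T0]
    simp
  map_add' F G := by
    ext m
    rw [map_add, coeff_T0, coeff_T0, coeff_T0, map_add]
    split_ifs <;> simp
  commutes' r := T0_C N _

theorem coeff_T (N : ℕ) (F : MvPowerSeries (ℕ × ℕ) ℂ) (m : (ℕ × ℕ) →₀ ℕ) :
    coeff m (T N F) = if m.support ⊆ box N then coeff m F else 0 := rfl

theorem T_ext {F G : MvPowerSeries (ℕ × ℕ) ℂ} (h : ∀ N, T N F = T N G) : F = G := by
  ext m
  obtain ⟨N, hN⟩ : ∃ N, m.support ⊆ box N := by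
    refine ⟨m.support.sup (fun s => s.1 + s.2 + 1), fun s hs => ?_⟩
    have := Finset.le_sup (f := fun s : ℕ × ℕ => s.1 + s.2 + 1) hs
    simp only [box, Finset.mem_product, Finset.mem_range]
    omega
  have := congrArg (coeff m) (h N)
  rwa [coeff_T, coeff_T, if_pos hN, if_pos hN] at this

theorem T_X (N : ℕ) (s : ℕ × ℕ) : T N (X s) = if s ∈ box N then X s else 0 := by
  classical
  ext m
  rw [coeff_T, coeff_X]
  by_cases hs : s ∈ box N
  · rw [if_pos hs, coeff_X]
    split_ifs with h1 h2 h2 <;> try rfl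
    exact absurd (by rw [h2]; exact Finsupp.support_single_subset.trans (by simpa using hs)) h1
  · rw [if_neg hs, map_zero]
    split_ifs with h1 h2 <;> try rfl
    rw [h2, Finsupp.support_single _ one_ne_zero] at h1
    exact absurd (h1 (Finset.mem_singleton_self s)) hs

theorem T_pderiv (N : ℕ) (s : ℕ × ℕ) (hs : s ∈ box N) (F : MvPowerSeries (ℕ × ℕ) ℂ) :
    T N (pderiv ℂ s F) = pderiv ℂ s (T N F) := by
  classical
  ext m
  rw [coeff_T, coeff_pderiv, coeff_pderiv, coeff_T]
  have : (m + Finsupp.single s 1).support ⊆ box N ↔ m.support ⊆ box N := by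
    constructor
    · exact fun h => (Finsupp.support_mono le_self_add).trans h
    · exact fun h => Finsupp.support_add.trans (Finset.union_subset h
        (Finsupp.support_single_subset.trans (by simpa using hs)))
  simp only [this]
  split_ifs <;> simp

theorem T_lsum {ι : Type*} (N : ℕ) (S : Finset ι) (f : ι → MvPowerSeries (ℕ × ℕ) ℂ)
    (hf : ∀ i ∉ S, T N (f i) = 0) : T N (lsum f) = ∑ i ∈ S, T N (f i) := by
  classical
  ext m
  rw [map_sum, coeff_T]
  simp only [coeff_T]
  by_cases h : m.support ⊆ box N
  · simp only [if_pos h]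
    change ∑ᶠ i, coeff m (f i) = _
    refine finsum_eq_sum_of_support_subset _ fun i hi => ?_
    by_contra hiS
    have := congrArg (coeff m) (hf i hiS)
    rw [coeff_T, if_pos h, map_zero] at this
    exact hi this
  · simp [if_neg h]

/-- The leading `N × N` block of the matrix of variables. -/
def XN (N : ℕ) : Matrix (Fin N) (Fin N) (MvPowerSeries (ℕ × ℕ) ℂ) :=
  Matrix.of fun i j => X ((i : ℕ), (j : ℕ))

theorem T_matPow (N n : ℕ) : ∀ (a b : Fin N), T N (matPow n a b) = (XN N ^ n) a b := by
  induction n with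
  | zero =>
    intro a b
    simp only [matPow, pow_zero, Matrix.one_apply, Fin.val_inj]
    split_ifs <;> simp
  | succ n ih =>
    intro a b
    rw [matPow, T_lsum N (Finset.range N), pow_succ, Matrix.mul_apply, ← Fin.sum_univ_eq_sum_range
      (fun c => T N (matPow n a c * X (c, (b : ℕ))))]
    · refine Finset.sum_congr rfl fun c _ => ?_
      rw [map_mul, ih, T_X, if_pos (by simp [box])]
      rfl
    · intro c hc
      rw [map_mul, T_X, if_neg, mul_zero]
      simp only [box, Finset.mem_product]
      exact fun h => hc h.1

theorem T_traceX (N : ℕ) (k : ℕ+) : T N (traceX k) = (XN N ^ (k : ℕ)).trace := by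
  rw [traceX, T_lsum N (Finset.range N), Matrix.trace,
    ← Fin.sum_univ_eq_sum_range (fun c => T N (matPow k c c))]
  · exact Finset.sum_congr rfl fun c _ => T_matPow N k c c
  · intro c hc
    obtain ⟨n, hn⟩ : ∃ n, (k : ℕ) = n + 1 := ⟨k - 1, by have := k.pos; omega⟩
    rw [hn, matPow, T_lsum N ∅]
    · simp
    · intro a _
      rw [map_mul, T_X, if_neg, mul_zero]
      simp only [box, Finset.mem_product]
      exact fun h => hc h.2

theorem pderiv_XN (N : ℕ) (i j k l : Fin N) :
    pderiv ℂ ((i : ℕ), (j : ℕ)) (XN N k l) = if k = i ∧ l = j then 1 else 0 := by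
  classical
  change pderiv ℂ ((i : ℕ), (j : ℕ)) (X ((k : ℕ), (l : ℕ))) = _
  rw [pderiv_X]
  simp [Pi.single_apply, Prod.ext_iff, Fin.ext_iff]

theorem T_matW (N : ℕ) (F : MvPowerSeries (ℕ × ℕ) ℂ) :
    T N (matW 3 F) = (1 / 3 : ℂ) • ctr (XN N) (fun a a' a'' e e' e'' =>
      pderiv ℂ ((a' : ℕ), (e : ℕ)) (pderiv ℂ ((a'' : ℕ), (e' : ℕ))
        (pderiv ℂ ((a : ℕ), (e'' : ℕ)) (T N F)))) := by
  have r0 : finRotate 3 0 = 1 := by decide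
  have r1 : finRotate 3 1 = 2 := by decide
  have r2 : finRotate 3 2 = 0 := by decide
  let emb : (Fin N × Fin N × Fin N) × (Fin N × Fin N × Fin N) →
      (Fin 3 → ℕ) × (Fin 3 → ℕ) := fun t =>
    (![(t.1.1 : ℕ), t.1.2.1, t.1.2.2], ![(t.2.1 : ℕ), t.2.2.1, t.2.2.2])
  have hemb : Function.Injective emb := by
    rintro ⟨⟨a, a', a''⟩, ⟨e, e', e''⟩⟩ ⟨⟨b, b', b''⟩, ⟨g, g', g''⟩⟩ h
    simpa [emb, Fin.val_inj, and_assoc] using h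
  classical
  rw [matW, map_smul, T_lsum N (Finset.univ.image emb)]
  · rw [Finset.sum_image (fun _ _ _ _ h => hemb h)]
    simp only [Nat.cast_ofNat]
    congr 1
    rw [Fintype.sum_prod_type, Fintype.sum_prod_type]
    simp only [Fintype.sum_prod_type, ctr]
    refine Finset.sum_congr rfl fun a _ => Finset.sum_congr rfl fun a' _ =>
      Finset.sum_congr rfl fun a'' _ => Finset.sum_congr rfl fun e _ =>
      Finset.sum_congr rfl fun e' _ => Finset.sum_congr rfl fun e'' _ => ?_
    have hb : ∀ i j : Fin N, ((i : ℕ), (j : ℕ)) ∈ box N := fun i j => by simp [box]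
    simp only [emb, List.finRange_succ, List.finRange_zero, List.map_nil, List.map_cons,
      List.foldr_cons, List.foldr_nil, Fin.prod_univ_three, map_mul]
    change T N (X ((a : ℕ), (e : ℕ))) * T N (X ((a' : ℕ), (e' : ℕ))) *
      T N (X ((a'' : ℕ), (e'' : ℕ))) * T N (pderiv ℂ ((a' : ℕ), (e : ℕ))
        (pderiv ℂ ((a'' : ℕ), (e' : ℕ)) (pderiv ℂ ((a : ℕ), (e'' : ℕ)) F))) = _
    rw [T_X, T_X, T_X, if_pos (hb _ _), if_pos (hb _ _), if_pos (hb _ _),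
      T_pderiv N _ (hb _ _), T_pderiv N _ (hb _ _), T_pderiv N _ (hb _ _)]
    rfl
  · rintro ⟨a, e⟩ ht
    rw [map_mul, Fin.prod_univ_three, map_mul, map_mul, T_X, T_X, T_X]
    by_cases h0 : (a 0, e 0) ∈ box N
    · by_cases h1 : (a 1, e 1) ∈ box N
      · by_cases h2 : (a 2, e 2) ∈ box N
        · exfalso
          simp only [box, Finset.mem_product, Finset.mem_range] at h0 h1 h2
          apply ht
          rw [Finset.mem_image]
          refine ⟨((⟨a 0, h0.1⟩, ⟨a 1, h1.1⟩, ⟨a 2, h2.1⟩),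
            (⟨e 0, h0.2⟩, ⟨e 1, h1.2⟩, ⟨e 2, h2.2⟩)), Finset.mem_univ _, ?_⟩
          simp only [emb, Prod.mk.injEq]
          constructor <;> (funext i; fin_cases i <;> rfl)
        · simp [h2]
      · simp [h1]
    · simp [h0]

end Truncation

end MatrixModel

open MatrixModel in
/-- On `ℂ[p₁, p₂, …]`, with `p_k = tr (X ^ k)`, the operator `W3` is the operator
`W([3]) = (1/3) :tr (D ^ 3):`. -/
theorem aeval_W3 (f : MvPolynomial ℕ+ ℂ) :
    MvPolynomial.aeval traceX (W3 f) = matW 3 (MvPolynomial.aeval traceX f) := by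
  classical
  obtain ⟨K, hK⟩ := f.vars.exists_le
  have hf : f ∈ MvPolynomial.supported ℂ ((Finset.Icc 1 K : Finset ℕ+) : Set ℕ+) := by
    rw [MvPolynomial.mem_supported]
    intro k hk
    exact Finset.mem_coe.2 (Finset.mem_Icc.2 ⟨one_le, hK k hk⟩)
  have hW : W3 f = (1 / 3 : ℂ) • ∑ i ∈ Finset.Icc 1 K, ∑ j ∈ Finset.Icc 1 K,
      ∑ k ∈ Finset.Icc 1 K, ((W3Terms i j k).map (fun s => s.apply f)).sum := by
    rw [W3, finsum_eq_sum_of_support_subset (s := Finset.Icc 1 K ×ˢ (Finset.Icc 1 K ×ˢ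
      Finset.Icc 1 K))]
    · simp only [Finset.sum_product]
    · rintro ⟨i, j, k⟩ ht
      by_contra hS
      apply ht
      simp only [Finset.coe_product, Set.mem_prod, Finset.mem_coe, Finset.mem_Icc, one_le,
        true_and] at hS
      have z := not_mem_pderiv K f hf
      have z2 : ∀ k n, ¬ n ≤ K → MvPolynomial.pderiv n (MvPolynomial.pderiv k f) = 0 :=
        fun k n hn => not_mem_pderiv K _ (d_supported _ f hf k) n hn
      have z3 : ∀ k l n, ¬ n ≤ K →
          MvPolynomial.pderiv n (MvPolynomial.pderiv k (MvPolynomial.pderiv l f)) = 0 :=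
        fun k l n hn => not_mem_pderiv K _ (d_supported _ _ (d_supported _ f hf l) k) n hn
      have lt1 : ∀ a b : ℕ+, ¬ a ≤ K → ¬ a + b ≤ K := fun a b h h' =>
        h ((PNat.lt_add_right a b).le.trans h')
      have lt2 : ∀ a b : ℕ+, ¬ b ≤ K → ¬ a + b ≤ K := fun a b h h' =>
        h ((PNat.lt_add_left b a).le.trans h')
      have hS' : ¬ i ≤ K ∨ ¬ j ≤ K ∨ ¬ k ≤ K := by tauto
      simp only [W3Terms, List.map_cons, List.map_nil, List.sum_cons, List.sum_nil, PTerm.apply,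
        List.foldr_cons, List.foldr_nil]
      rcases hS' with h | h | h
      · rw [z3 _ _ i h, z2 _ i h, z (i + k) (lt1 _ _ h), z (i + j) (lt1 _ _ h),
          z (i + j + k) (lt1 _ _ (lt1 _ _ h))]
        simp
      · rw [z2 _ j h, z2 _ j h, z (j + k) (lt1 _ _ h), z (i + j) (lt2 _ _ h),
          z (i + j + k) (lt1 _ _ (lt2 _ _ h))]
        simp
      · rw [z k h, z2 _ k h, z (j + k) (lt2 _ _ h), z (i + k) (lt2 _ _ h),
          z (i + j + k) (lt2 _ _ h)]
        simp
  refine T_ext fun N => ?_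
  have hT : ∀ g : MvPolynomial ℕ+ ℂ, T N (MvPolynomial.aeval traceX g) =
      MvPolynomial.aeval (fun k : ℕ+ => (XN N ^ (k : ℕ)).trace) g := by
    intro g
    rw [← AlgHom.comp_apply, MvPolynomial.comp_aeval]
    simp only [T_traceX]
  rw [T_matW, hT, hT, hW, finW (XN N) (fun i j => MvPowerSeries.pderiv ℂ ((i : ℕ), (j : ℕ)))
    (pderiv_XN N) K f hf, map_smul]
  simp only [map_sum, map_list_sum, List.map_map, Function.comp_def]

end ThreeHurwitz

end

open ThreeHurwitz

noncomputable section

set_option linter.unusedSectionVars false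

namespace ThreeHurwitz

/-! ### Power sums of a matrix indexed by permutations -/

section

open Equiv.Perm

/-! ## Cycle types -/

section CycleType

variable {V W : Type*} [Fintype V] [DecidableEq V] [Fintype W] [DecidableEq W]

/-! Let Φ be the generating function, exponential in z and t, of all words in 3-cycles, where a word
of length k on n points has weight z^n t^k p_α and α is the cycle type of its product. Let T be the
same series restricted to words generating a transitive group. The equation for F₃ is the genus zero
part of an equation for T, which in turn is the logarithmic form of a linear equation for Φ.

Linear equation: ∂Φ/∂t = W([3])Φ. At p_k = tr(x^k), the monomial of the cycle type of σ becomes the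
sum over colourings f of the points of ∏ x_{f(v), f(σ v)} (`colSum_eq`). Three derivatives in matrix
entries delete three distinct factors, and the contraction puts them back with the column indices
permuted cyclically. This multiplies σ by a 3-cycle, and each 3-cycle occurs three times
(`ctr_colSum`). The same operator in the variables p_k is computed by `MatrixModel.finW`, and traces
of generic matrices of all sizes separate polynomials (`eq_of_aeval_trace_eq`). Hence the identity
holds in ℂ[p₁, p₂, …] (`sum_typeMonomial_mul`, `allWords_succ`).

Passage to T: the orbit of a base point splits a word into a transitive word on the orbit and an
arbitrary word on the complement, so ∂Φ/∂z = ∂T/∂z · Φ (`derivative_allSeries`), which is Φ = exp T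
in differential form. Dividing the linear equation by Φ gives a nonlinear one for T
(`X_pow_dvd_transSeries`).

Genus zero: by that equation, every monomial z^n t^k p_α of T satisfies 2k ≥ n + ℓ(α) − 2
(`filUpTo_transSeries`). Consider the part where equality holds. There k is determined by n and α,
so ∂/∂t becomes half of the Euler operator minus 2. Higher derivatives of T have too high an order
to contribute, so only products of first derivatives survive. The last summand of W([3]) disappears
for the same reason, which is why it is subtracted in the theorem (`symbol_logDeriv`,
`symbol_W3Terms`, `coeff_genusZero_eq`).

It remains to see that F₃ is this genus zero part, that is, that μ³(α) attains the bound whenever α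
has a factorization at all (`minHurwitz3_div_eq`). All coefficients are nonnegative, so one positive
term on the right of the genus zero equation makes the coefficient on the left positive. Induction
on n + ℓ(α) then reaches every α with n + ℓ(α) even except [1, 1] (`coeff_genusZero_pos`). The
excluded types have no transitive factorization: the odd ones by parity, [1, 1] because two points
carry no 3-cycle. -/

theorem parts_partition_eq (σ : Equiv.Perm V) : σ.partition.parts =
    σ.cycleType + Multiset.replicate (Fintype.card V - σ.cycleType.sum) 1 := by
  rw [parts_partition, sum_cycleType]

theorem cycleType_permCongr (e : V ≃ W) (σ : Equiv.Perm V) :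
    (e.permCongr σ).cycleType = σ.cycleType := by
  rw [← cycleType_extendDomain (e.trans (Equiv.subtypeUnivEquiv (p := fun _ : W => True)
    fun _ => trivial).symm)]
  congr 1

theorem parts_permCongr (e : V ≃ W) (σ : Equiv.Perm V) :
    (e.permCongr σ).partition.parts = σ.partition.parts := by
  rw [parts_partition_eq, parts_partition_eq, cycleType_permCongr, Fintype.card_congr e]

theorem cycleType_sumCongr_one (σ : Equiv.Perm V) :
    (sumCongr σ (1 : Equiv.Perm W)).cycleType = σ.cycleType := by
  classical
  rw [← cycleType_extendDomain (Equiv.ofInjective (Sum.inl : V → V ⊕ W) Sum.inl_injective)]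
  congr 1
  ext w
  rcases w with v | w
  · have := extendDomain_apply_image σ
      (Equiv.ofInjective (Sum.inl : V → V ⊕ W) Sum.inl_injective) v
    simp only [Equiv.ofInjective_apply] at this
    rw [this]; simp
  · rw [extendDomain_apply_not_subtype]
    · simp
    · simp

theorem cycleType_one_sumCongr (τ : Equiv.Perm W) :
    (sumCongr (1 : Equiv.Perm V) τ).cycleType = τ.cycleType := by
  rw [← cycleType_sumCongr_one (W := V) τ, ← cycleType_permCongr (Equiv.sumComm V W)]
  congr 1
  ext w
  rcases w with v | w <;> simp

theorem disjoint_sumCongr (σ : Equiv.Perm V) (τ : Equiv.Perm W) :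
    Disjoint (sumCongr σ (1 : Equiv.Perm W)) (sumCongr (1 : Equiv.Perm V) τ) := by
  rintro (v | w) <;> simp

theorem cycleType_sumCongr (σ : Equiv.Perm V) (τ : Equiv.Perm W) :
    (sumCongr σ τ).cycleType = σ.cycleType + τ.cycleType := by
  rw [← cycleType_sumCongr_one (W := W) σ, ← cycleType_one_sumCongr (V := V) τ,
    ← (disjoint_sumCongr σ τ).cycleType_mul, sumCongr_mul, mul_one, one_mul]

theorem sum_cycleType_le_card (σ : Equiv.Perm V) : σ.cycleType.sum ≤ Fintype.card V := by
  rw [sum_cycleType]; exact Finset.card_le_univ _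

theorem parts_sumCongr (σ : Equiv.Perm V) (τ : Equiv.Perm W) :
    (sumCongr σ τ).partition.parts = σ.partition.parts + τ.partition.parts := by
  have h1 := sum_cycleType_le_card σ
  have h2 := sum_cycleType_le_card τ
  simp only [parts_partition_eq, cycleType_sumCongr, Multiset.sum_add, Fintype.card_sum]
  rw [show Fintype.card V + Fintype.card W - (σ.cycleType.sum + τ.cycleType.sum) =
    (Fintype.card V - σ.cycleType.sum) + (Fintype.card W - τ.cycleType.sum) by omega,
    Multiset.replicate_add]
  abel

theorem parts_finRotate (n : ℕ) : (finRotate (n + 1)).partition.parts = {n + 1} := by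
  rw [parts_partition_eq]
  rcases n with _ | n
  · have : finRotate 1 = 1 := Subsingleton.elim _ _
    simp [this]
  · rw [cycleType_finRotate]; simp

/-- Every multiset of positive integers is the multiset of cycle lengths of a permutation, and a
property that holds for rotations and is compatible with disjoint unions and with relabelling holds
for all permutations. -/
theorem perm_induction {P : ∀ (V : Type) [Fintype V] [DecidableEq V], Equiv.Perm V → Prop}
    (empty : P Empty 1)
    (rot : ∀ n, P (Fin (n + 1)) (finRotate (n + 1)))
    (sum : ∀ (V W : Type) [Fintype V] [DecidableEq V] [Fintype W] [DecidableEq W]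
      (σ : Equiv.Perm V) (τ : Equiv.Perm W), P V σ → P W τ → P (V ⊕ W) (sumCongr σ τ))
    (congr : ∀ (V W : Type) [Fintype V] [DecidableEq V] [Fintype W] [DecidableEq W] (e : V ≃ W)
      (σ : Equiv.Perm V), P V σ → P W (e.permCongr σ))
    (V : Type) [Fintype V] [DecidableEq V] (σ : Equiv.Perm V) : P V σ := by
  have key : ∀ s : Multiset ℕ, (∀ i ∈ s, 0 < i) → ∃ (W : Type) (_ : Fintype W) (_ : DecidableEq W)
      (τ : Equiv.Perm W), τ.partition.parts = s ∧ P W τ := by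
    intro s
    induction s using Multiset.induction with
    | empty => exact fun _ => ⟨Empty, inferInstance, inferInstance, 1, by simp [parts_partition_eq], empty⟩
    | cons a s ih =>
      intro h
      obtain ⟨W, _, _, τ, h1, h2⟩ := ih fun i hi => h i (Multiset.mem_cons_of_mem hi)
      obtain ⟨n, rfl⟩ : ∃ n, a = n + 1 := ⟨a - 1, by
        have := h a (Multiset.mem_cons_self a s); omega⟩
      exact ⟨Fin (n + 1) ⊕ W, inferInstance, inferInstance, sumCongr (finRotate (n + 1)) τ, by
        rw [parts_sumCongr, parts_finRotate, h1, Multiset.singleton_add], sum _ _ _ _ (rot n) h2⟩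
  obtain ⟨W, _, _, τ, h1, h2⟩ := key σ.partition.parts fun i hi => σ.partition.parts_pos hi
  have hc : Fintype.card W = Fintype.card V := by
    rw [← τ.partition.parts_sum, h1, σ.partition.parts_sum]
  let e := Fintype.equivOfCardEq hc
  -- Equal cycle types make the two permutations conjugate, and conjugation is itself a relabelling,
  -- so a second use of `congr` reaches σ.
  have h3 : IsConj (e.permCongr τ) σ := by
    rw [partition_eq_of_isConj]
    ext1
    rw [parts_permCongr, h1]
  obtain ⟨c, hc⟩ := isConj_iff.1 h3
  have : σ = (Equiv.permCongr c) (e.permCongr τ) := by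
    rw [← hc]; ext v; simp
  rw [this]
  exact congr _ _ _ _ (congr _ _ _ _ h2)

end CycleType

/-! ## Power sums of matrices as sums over colourings -/

section Colour

variable {A : Type*} [CommRing A] {ι : Type*} [Fintype ι] [DecidableEq ι]

/-- The sum over all colourings `f` of `∏ x_{f v, f (σ v)}`. -/
def colSum {V : Type*} [Fintype V] [DecidableEq V] (x : Matrix ι ι A) (σ : Equiv.Perm V) : A :=
  ∑ f : V → ι, ∏ v, x (f v) (f (σ v))

theorem colSum_permCongr {V W : Type*} [Fintype V] [DecidableEq V] [Fintype W] [DecidableEq W]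
    (x : Matrix ι ι A) (e : V ≃ W) (σ : Equiv.Perm V) :
    colSum x (e.permCongr σ) = colSum x σ := by
  refine Fintype.sum_equiv (e.arrowCongr (Equiv.refl ι)).symm _ _ fun f => ?_
  refine Fintype.prod_equiv e.symm _ _ fun v => ?_
  simp [Equiv.arrowCongr]

theorem colSum_sumCongr {V W : Type*} [Fintype V] [DecidableEq V] [Fintype W] [DecidableEq W]
    (x : Matrix ι ι A) (σ : Equiv.Perm V) (τ : Equiv.Perm W) :
    colSum x (sumCongr σ τ) = colSum x σ * colSum x τ := by
  rw [colSum, colSum, colSum, Finset.sum_mul_sum, ← Fintype.sum_prod_type']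
  refine Fintype.sum_equiv (Equiv.sumArrowEquivProdArrow V W ι) _ _ fun f => ?_
  rw [Fintype.prod_sum_type]
  simp [Equiv.sumArrowEquivProdArrow]

/-- An entry of a power is a sum over paths from a to b. The tuple g lists the interior vertices, so
`Fin.cons a g` lists the sources of the steps and `Fin.snoc g b` their targets. -/
theorem pow_succ_apply_eq_sum (x : Matrix ι ι A) (n : ℕ) : ∀ a b : ι, (x ^ (n + 1)) a b =
    ∑ g : Fin n → ι, ∏ i : Fin (n + 1),
      x ((Fin.cons a g : Fin (n + 1) → ι) i) ((Fin.snoc g b : Fin (n + 1) → ι) i) := by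
  induction n with
  | zero => intro a b; simp [Fin.snoc]
  | succ n ih =>
    intro a b
    rw [pow_succ', Matrix.mul_apply, ← (Fin.consEquiv fun _ : Fin (n + 1) => ι).sum_comp,
      Fintype.sum_prod_type]
    refine Finset.sum_congr rfl fun c _ => ?_
    rw [ih, Finset.mul_sum]
    refine Finset.sum_congr rfl fun g _ => ?_
    rw [Fin.prod_univ_succ (n := n + 1)]
    congr 1
    simp only [Fin.consEquiv, Equiv.coe_fn_mk, Fin.cons_succ]
    refine Finset.prod_congr rfl fun i _ => ?_
    congr 1
    rw [← Fin.cons_snoc_eq_snoc_cons, Fin.cons_succ]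

/-- A colouring of a cycle is a closed path, and the colour of the point 0 is the diagonal index in
the trace. -/
theorem colSum_finRotate (x : Matrix ι ι A) (n : ℕ) :
    colSum x (finRotate (n + 1)) = (x ^ (n + 1)).trace := by
  rw [colSum, Matrix.trace, ← (Fin.consEquiv fun _ : Fin (n + 1) => ι).sum_comp,
    Fintype.sum_prod_type]
  refine Finset.sum_congr rfl fun a _ => ?_
  rw [Matrix.diag_apply, pow_succ_apply_eq_sum]
  refine Finset.sum_congr rfl fun g _ => Finset.prod_congr rfl fun i _ => ?_
  simp only [Fin.consEquiv, Equiv.coe_fn_mk]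
  congr 1
  induction i using Fin.lastCases with
  | last => rw [finRotate_last]; simp
  | cast i => rw [Fin.snoc_castSucc, finRotate_apply, Fin.coeSucc_eq_succ, Fin.cons_succ]

/-- Both sides are multiplicative under disjoint union and invariant under relabelling, so a single
cycle is enough. -/
theorem colSum_eq {V : Type} [Fintype V] [DecidableEq V] (x : Matrix ι ι A) (σ : Equiv.Perm V) :
    colSum x σ = (σ.partition.parts.map fun i => (x ^ i).trace).prod := by
  refine perm_induction (P := fun V _ _ σ => colSum x σ =
    (σ.partition.parts.map fun i => (x ^ i).trace).prod) ?_ ?_ ?_ ?_ V σ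
  · simp [colSum, parts_partition_eq]
  · intro n; simp [colSum_finRotate, parts_finRotate]
  · intro V W _ _ _ _ σ τ h1 h2
    rw [colSum_sumCongr, parts_sumCongr, h1, h2, Multiset.map_add, Multiset.prod_add]
  · intro V W _ _ _ _ e σ h
    rw [colSum_permCongr, parts_permCongr, h]

end Colour

end

/-! ### Multiplication by 3-cycles as a differential operator in the power sums -/

section

open Equiv.Perm

/-! ## The cut-and-join identity for 3-cycles -/

section ThreeCycleSum

variable {V : Type*} [Fintype V] [DecidableEq V]

/-- The 3-cycles of `V`. -/
abbrev ThreeCycle (V : Type*) [Fintype V] [DecidableEq V] : Type _ :=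
  {δ : Equiv.Perm V // δ.IsThreeCycle}

instance : Fintype (ThreeCycle V) := Fintype.ofFinite _

/-- Summing over ordered triples of distinct points counts each 3-cycle three times. -/
theorem sum_triples {M : Type*} [AddCommMonoid M] (F : Equiv.Perm V → M) :
    ∑ w : V, ∑ u ∈ Finset.univ.erase w, ∑ v ∈ (Finset.univ.erase w).erase u,
      F (Equiv.swap w v * Equiv.swap v u) = 3 • ∑ δ : ThreeCycle V, F δ := by
  have h3 : ∀ δ : ThreeCycle V, 3 • F δ = ∑ _w ∈ δ.1.support, F δ := by
    intro δ
    rw [Finset.sum_const, δ.2.card_support]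
  rw [Finset.smul_sum]
  simp only [h3]
  simp only [Finset.sum_sigma']
  -- The triple (w, u, v) corresponds to the 3-cycle w → v → u → w with w as marked point. The
  -- marked point can be any of the three points of the support, hence the factor 3.
  refine Finset.sum_bij'
    (fun t ht => ⟨⟨Equiv.swap t.1 t.2.2 * Equiv.swap t.2.2 t.2.1, ?_⟩, t.1⟩)
    (fun s _ => ⟨s.2, s.1.1 (s.1.1 s.2), s.1.1 s.2⟩) ?_ ?_ ?_ ?_ ?_
  · simp only [Finset.mem_sigma, Finset.mem_univ, Finset.mem_erase, true_and, and_true] at ht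
    rw [Equiv.swap_comm t.1]
    exact isThreeCycle_swap_mul_swap_same ht.2.2 ht.2.1 (Ne.symm ht.1)
  · rintro ⟨w, u, v⟩ ht
    simp only [Finset.mem_sigma, Finset.mem_univ, Finset.mem_erase, true_and, and_true] at ht
    simp only [Finset.mem_sigma, Finset.mem_univ, true_and, mem_support, coe_mul,
      Function.comp_apply]
    rw [Equiv.swap_apply_of_ne_of_ne (Ne.symm ht.2.2) (Ne.symm ht.1), Equiv.swap_apply_left]
    exact ht.2.2
  · rintro ⟨δ, w⟩ hw
    simp only [Finset.mem_sigma, Finset.mem_univ, true_and] at hw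
    have := δ.2.nodup_iff_mem_support.2 hw
    simp only [Finset.mem_sigma, Finset.mem_univ, Finset.mem_erase, true_and, and_true]
    grind
  · rintro ⟨w, u, v⟩ ht
    simp only [Finset.mem_sigma, Finset.mem_univ, Finset.mem_erase, true_and, and_true] at ht
    have h1 : Equiv.swap w v (Equiv.swap v u w) = v := by
      rw [Equiv.swap_apply_of_ne_of_ne (Ne.symm ht.2.2) (Ne.symm ht.1), Equiv.swap_apply_left]
    have h2 : Equiv.swap w v u = u := Equiv.swap_apply_of_ne_of_ne ht.1 (Ne.symm ht.2.1)
    simp [h1, h2]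
  · rintro ⟨⟨δ, hδ⟩, w⟩ hw
    simp only [Finset.mem_sigma, Finset.mem_univ, true_and] at hw
    simp only [Sigma.mk.injEq, Subtype.mk.injEq, heq_eq_eq, and_true]
    exact (hδ.eq_swap_mul_swap_iff_mem_support.2 hw).symm
  · intros; rfl

end ThreeCycleSum

/-! ### Third-order operators acting on products of matrix entries -/

section Derivative

variable {A : Type*} [CommRing A] [Algebra ℂ A]

theorem derivation_prod {κ : Type*} [DecidableEq κ] (D : Derivation ℂ A A) (s : Finset κ)
    (g : κ → A) : D (∏ v ∈ s, g v) = ∑ u ∈ s, D (g u) * ∏ v ∈ s.erase u, g v := by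
  induction s using Finset.induction_on with
  | empty => simp
  | insert a s ha ih =>
    rw [Finset.prod_insert ha, Derivation.leibniz, ih, Finset.sum_insert ha,
      Finset.erase_insert ha, smul_eq_mul, smul_eq_mul, mul_comm (∏ v ∈ s, g v), add_comm,
      Finset.mul_sum]
    congr 1
    refine Finset.sum_congr rfl fun u hu => ?_
    rw [Finset.erase_insert_of_ne (by rintro rfl; exact ha hu),
      Finset.prod_insert (fun h => ha (Finset.mem_of_mem_erase h))]
    ring

variable {N : ℕ} (x : Matrix (Fin N) (Fin N) A) (d : Fin N → Fin N → Derivation ℂ A A)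

/-- By the Leibniz rule the innermost derivative deletes the factor at w, the next one the factor at
u, the outermost the factor at v. The three points are distinct because the deleted factors leave
only constants behind, on which later derivatives vanish. -/
theorem derivation_prod_entries (hx : ∀ i j k l, d i j (x k l) = if k = i ∧ l = j then 1 else 0)
    {V : Type*} [DecidableEq V] (f g : V → Fin N) (a a' a'' e e' e'' : Fin N) (s : Finset V) :
    d a' e (d a'' e' (d a e'' (∏ v ∈ s, x (f v) (g v)))) =
      ∑ w ∈ s, ∑ u ∈ s.erase w, ∑ v ∈ (s.erase w).erase u,
        (∏ t ∈ ((s.erase w).erase u).erase v, x (f t) (g t)) *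
        ((if f w = a ∧ g w = e'' then 1 else 0) * (if f u = a'' ∧ g u = e' then 1 else 0) *
          (if f v = a' ∧ g v = e then 1 else 0)) := by
  have hz : ∀ (i j : Fin N) (P : Prop) [Decidable P], d i j (if P then 1 else 0 : A) = 0 := by
    intro i j P _; split_ifs <;> simp
  simp only [derivation_prod, hx, map_sum, Derivation.leibniz, hz, smul_eq_mul, add_zero,
    mul_zero]
  refine Finset.sum_congr rfl fun w _ => ?_
  rw [Finset.mul_sum]
  refine Finset.sum_congr rfl fun u _ => ?_
  rw [Finset.mul_sum, Finset.mul_sum]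
  refine Finset.sum_congr rfl fun v _ => ?_
  ring

/-- The Kronecker deltas left by the derivatives fix all six contraction indices. What comes back is
the three deleted entries with unchanged rows and with columns permuted along w → v → u → w. -/
theorem ctr_derivation_prod_entries
    (hx : ∀ i j k l, d i j (x k l) = if k = i ∧ l = j then 1 else 0)
    {V : Type*} [DecidableEq V] (f g : V → Fin N) (s : Finset V) :
    MatrixModel.ctr x (fun a a' a'' e e' e'' => d a' e (d a'' e' (d a e''
      (∏ v ∈ s, x (f v) (g v))))) =
      ∑ w ∈ s, ∑ u ∈ s.erase w, ∑ v ∈ (s.erase w).erase u,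
        (∏ t ∈ ((s.erase w).erase u).erase v, x (f t) (g t)) *
        (x (f w) (g v) * x (f v) (g u) * x (f u) (g w)) := by
  simp only [derivation_prod_entries x d hx, MatrixModel.ctr_sum, MatrixModel.ctr_mul]
  refine Finset.sum_congr rfl fun w _ => Finset.sum_congr rfl fun u _ =>
    Finset.sum_congr rfl fun v _ => congrArg _ ?_
  simp only [MatrixModel.ctr, ite_and, mul_ite, mul_one, mul_zero,
    Finset.sum_ite_eq, Finset.mem_univ, if_true, Finset.sum_ite_irrel, Finset.sum_const_zero]

/-- The matrix operator `:tr (D ^ 3):` acts on colour sums as right multiplication by the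
3-cycles. -/
theorem ctr_colSum (hx : ∀ i j k l, d i j (x k l) = if k = i ∧ l = j then 1 else 0)
    {V : Type*} [Fintype V] [DecidableEq V] (σ : Equiv.Perm V) :
    MatrixModel.ctr x (fun a a' a'' e e' e'' => d a' e (d a'' e' (d a e'' (colSum x σ)))) =
      3 * ∑ δ : ThreeCycle V, colSum x (σ * δ.1) := by
  simp only [colSum, map_sum, MatrixModel.ctr_sum, ctr_derivation_prod_entries x d hx]
  rw [Finset.sum_comm (s := (Finset.univ : Finset (ThreeCycle V))), Finset.mul_sum]
  refine Finset.sum_congr rfl fun f _ => ?_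
  have := sum_triples (V := V) (M := A) (fun δ => ∏ v, x (f v) (f ((σ * δ) v)))
  rw [nsmul_eq_mul, Nat.cast_ofNat] at this
  rw [← this]
  refine Finset.sum_congr rfl fun w _ => Finset.sum_congr rfl fun u hu =>
    Finset.sum_congr rfl fun v hv => ?_
  have hvw := hv
  simp only [Finset.mem_erase, Finset.mem_univ, and_true] at hu hvw
  -- With δ the 3-cycle w → v → u → w, the permutations σδ and σ agree off {w, u, v}. On these
  -- points σδ takes the values σ v, σ w, σ u at w, u, v, which are the permuted columns.
  rw [← Finset.mul_prod_erase _ _ (Finset.mem_univ w),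
    ← Finset.mul_prod_erase _ _ (show u ∈ Finset.univ.erase w by simpa using hu),
    ← Finset.mul_prod_erase _ _ hv]
  have h1 : Equiv.swap w v (Equiv.swap v u w) = v := by
    rw [Equiv.swap_apply_of_ne_of_ne (Ne.symm hvw.2) (Ne.symm hu), Equiv.swap_apply_left]
  have h2 : Equiv.swap w v u = u := Equiv.swap_apply_of_ne_of_ne hu (Ne.symm hvw.1)
  have h3 : ∏ t ∈ ((Finset.univ.erase w).erase u).erase v,
      x (f t) (f ((σ * (Equiv.swap w v * Equiv.swap v u)) t)) =
      ∏ t ∈ ((Finset.univ.erase w).erase u).erase v, x (f t) (f (σ t)) := by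
    refine Finset.prod_congr rfl fun t ht => ?_
    simp only [Finset.mem_erase, Finset.mem_univ, and_true] at ht
    simp only [coe_mul, Function.comp_apply]
    rw [Equiv.swap_apply_of_ne_of_ne ht.1 ht.2.1, Equiv.swap_apply_of_ne_of_ne ht.2.2 ht.1]
  rw [h3]
  simp only [coe_mul, Function.comp_apply, h1, h2, Equiv.swap_apply_left, Equiv.swap_apply_right]
  ring

end Derivative

/-! ## Power sums take arbitrary values -/

/-- Induction on K. Adjoining r times all (K+1)-st roots of unity leaves the power sums of degree 1,
…, K unchanged and adds (K+1) r^(K+1) in degree K+1, so r is chosen as a root of the remaining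
defect divided by K+1. -/
theorem exists_powerSum_eq (c : ℕ → ℂ) (K : ℕ) : ∃ (N : ℕ) (y : Fin N → ℂ),
    ∀ m, 1 ≤ m → m ≤ K → ∑ i, y i ^ m = c m := by
  induction K with
  | zero => exact ⟨0, Fin.elim0, fun m h1 h2 => by omega⟩
  | succ K ih =>
    obtain ⟨N, y, hy⟩ := ih
    obtain ⟨r, hr⟩ := IsAlgClosed.exists_pow_nat_eq
      ((c (K + 1) - ∑ i, y i ^ (K + 1)) / ((K + 1 : ℕ) : ℂ)) (Nat.succ_pos K)
    have hζ := Complex.isPrimitiveRoot_exp (K + 1) (Nat.succ_ne_zero K)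
    set ζ := Complex.exp (2 * Real.pi * Complex.I / ((K + 1 : ℕ) : ℂ))
    refine ⟨N + (K + 1), Fin.append y fun i => r * ζ ^ (i : ℕ), fun m h1 h2 => ?_⟩
    rw [Fin.sum_univ_add]
    simp only [Fin.append_left, Fin.append_right, mul_pow, ← Finset.mul_sum]
    have hgeom : ∑ i : Fin (K + 1), (ζ ^ (i : ℕ)) ^ m = ∑ i ∈ Finset.range (K + 1), (ζ ^ m) ^ i := by
      rw [← Fin.sum_univ_eq_sum_range (fun i => (ζ ^ m) ^ i)]
      exact Finset.sum_congr rfl fun i _ => by rw [← pow_mul, ← pow_mul, mul_comm]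
    rw [hgeom]
    rcases Nat.lt_or_ge m (K + 1) with h | h
    · have h0 : ∑ i ∈ Finset.range (K + 1), (ζ ^ m) ^ i = 0 := by
        have h1' : ζ ^ m ≠ 1 := hζ.pow_ne_one_of_pos_of_lt (by omega) h
        have := geom_sum_mul (ζ ^ m) (K + 1)
        rw [← pow_mul, mul_comm m, pow_mul, hζ.pow_eq_one, one_pow, sub_self] at this
        exact (mul_eq_zero.1 this).resolve_right (sub_ne_zero.2 h1')
      rw [h0, mul_zero, add_zero, hy m h1 (by omega)]
    · obtain rfl : m = K + 1 := by omega
      rw [hζ.pow_eq_one, hr]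
      have : ((K + 1 : ℕ) : ℂ) ≠ 0 := Nat.cast_ne_zero.2 (Nat.succ_ne_zero K)
      simp only [one_pow, Finset.sum_const, Finset.card_range, nsmul_eq_mul, mul_one]
      rw [div_mul_cancel₀ _ this]
      ring

/-- The generic matrix of size `N`. -/
def genericMatrix (N : ℕ) : Matrix (Fin N) (Fin N) (MvPolynomial (Fin N × Fin N) ℂ) :=
  Matrix.of fun i j => MvPolynomial.X (i, j)

/-- The traces of the powers of generic matrices are algebraically independent in the limit of
large size. -/
theorem eq_of_aeval_trace_eq {f g : MvPolynomial ℕ+ ℂ}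
    (h : ∀ N, MvPolynomial.aeval (fun k : ℕ+ => (genericMatrix N ^ (k : ℕ)).trace) f =
      MvPolynomial.aeval (fun k : ℕ+ => (genericMatrix N ^ (k : ℕ)).trace) g) : f = g := by
  refine MvPolynomial.funext fun c => ?_
  obtain ⟨K, hK⟩ := (f.vars ∪ g.vars).exists_le
  -- Polynomials over ℂ are determined by their values. Only variables up to K occur, so any point c
  -- can be realised there by the traces of the powers of a diagonal matrix.
  obtain ⟨N, y, hy⟩ := exists_powerSum_eq (fun m => c m.toPNat') K
  let φ : MvPolynomial (Fin N × Fin N) ℂ →ₐ[ℂ] ℂ :=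
    MvPolynomial.aeval fun ij => Matrix.diagonal y ij.1 ij.2
  have hφ : ∀ k : ℕ+, φ ((genericMatrix N ^ (k : ℕ)).trace) = ∑ i, y i ^ (k : ℕ) := by
    intro k
    have h1 : φ.toRingHom.mapMatrix (genericMatrix N) = Matrix.diagonal y := by
      ext i j; simp [genericMatrix, φ]
    have h2 : φ ((genericMatrix N ^ (k : ℕ)).trace) =
        (φ.toRingHom.mapMatrix (genericMatrix N ^ (k : ℕ))).trace := by
      simp [Matrix.trace]
    rw [h2, map_pow, h1, Matrix.diagonal_pow, Matrix.trace_diagonal]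
    simp
  have key : ∀ q : MvPolynomial ℕ+ ℂ, (∀ k ∈ q.vars, k ≤ K) → MvPolynomial.eval c q =
      φ (MvPolynomial.aeval (fun k : ℕ+ => (genericMatrix N ^ (k : ℕ)).trace) q) := by
    intro q hq
    rw [← AlgHom.comp_apply, MvPolynomial.comp_aeval, MvPolynomial.aeval_eq_eval₂Hom]
    refine MvPolynomial.eval₂Hom_congr' (by ext; rfl) (fun k hk _ => ?_) rfl
    rw [hφ, hy k k.pos (hq k hk), PNat.coe_toPNat']
  rw [key f fun k hk => hK k (Finset.mem_union_left _ hk),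
    key g fun k hk => hK k (Finset.mem_union_right _ hk), h N]

/-! ## Cut-and-join -/

section CutJoin

variable {V : Type} [Fintype V] [DecidableEq V]

/-- The monomial recording the cycle type of a permutation. -/
def typeMonomial (σ : Equiv.Perm V) : MvPolynomial ℕ+ ℂ :=
  (σ.partition.parts.map fun i => MvPolynomial.X i.toPNat').prod

/-- This links the two computations of the matrix operator: `MatrixModel.finW` sees a polynomial in
traces, `ctr_colSum` a sum over colourings. -/
theorem aeval_typeMonomial {N : ℕ} {A : Type*} [CommRing A] [Algebra ℂ A]
    (x : Matrix (Fin N) (Fin N) A) (σ : Equiv.Perm V) :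
    MvPolynomial.aeval (fun k : ℕ+ => (x ^ (k : ℕ)).trace) (typeMonomial σ) = colSum x σ := by
  rw [colSum_eq, typeMonomial, map_multiset_prod, Multiset.map_map]
  congr 1
  refine Multiset.map_congr rfl fun i hi => ?_
  simp [Nat.toPNat'_coe, σ.partition.parts_pos hi]

theorem typeMonomial_mem_supported (σ : Equiv.Perm V) (K : ℕ+) (hK : Fintype.card V ≤ K) :
    typeMonomial σ ∈ MvPolynomial.supported ℂ ((Finset.Icc 1 K : Finset ℕ+) : Set ℕ+) := by
  refine Subalgebra.multiset_prod_mem _ fun q hq => ?_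
  obtain ⟨i, hi, rfl⟩ := Multiset.mem_map.1 hq
  rw [MvPolynomial.X_mem_supported]
  have h1 := σ.partition.parts_pos hi
  have h2 := Multiset.le_sum_of_mem hi
  rw [σ.partition.parts_sum] at h2
  refine Finset.mem_coe.2 (Finset.mem_Icc.2 ⟨one_le, ?_⟩)
  rw [← PNat.coe_le_coe, Nat.toPNat'_coe, if_pos h1]
  omega

/-- Multiplying a permutation of at most `K` points by all 3-cycles. -/
theorem sum_typeMonomial_mul (σ : Equiv.Perm V) (K : ℕ+) (hK : Fintype.card V ≤ K) :
    (3 : ℂ) • ∑ δ : ThreeCycle V, typeMonomial (σ * δ.1) =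
      ∑ i ∈ Finset.Icc 1 K, ∑ j ∈ Finset.Icc 1 K, ∑ k ∈ Finset.Icc 1 K,
        ((W3Terms i j k).map (fun s => s.apply (typeMonomial σ))).sum := by
  refine eq_of_aeval_trace_eq fun N => ?_
  have hx : ∀ i j k l : Fin N, (MvPolynomial.pderiv (R := ℂ) (i, j)) (genericMatrix N k l) =
      if k = i ∧ l = j then 1 else 0 := by
    intro i j k l
    simp [genericMatrix, MvPolynomial.pderiv_X, Pi.single_apply, Prod.ext_iff]
  -- The same contraction is evaluated twice: in the variables p_k here, and through 3-cycles in
  -- `h'`.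
  have h := MatrixModel.finW (genericMatrix N) (fun i j => MvPolynomial.pderiv (i, j)) hx K _
    (typeMonomial_mem_supported σ K hK)
  have h' := ctr_colSum (genericMatrix N) (fun i j => MvPolynomial.pderiv (i, j)) hx σ
  simp only [aeval_typeMonomial] at h
  rw [h'] at h
  simp only [map_smul, map_sum, map_list_sum, List.map_map, Function.comp_def,
    aeval_typeMonomial]
  rw [← h, Algebra.smul_def, map_ofNat]

end CutJoin

end

/-! ### Words of 3-cycles and their decomposition by orbits -/

section

open Equiv.Perm

/-! ## Sums over words -/

section WordSum

variable {X Y : Type*} [Fintype X] [Fintype Y]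

/-- The sum of `f` over the words of length `k` in the alphabet `X`. -/
def wordSum {M : Type*} [AddCommMonoid M] : ℕ → (List X → M) → M
  | 0, f => f []
  | k + 1, f => ∑ x, wordSum k fun w => f (x :: w)

theorem wordSum_eq_sum_ofFn {M : Type*} [AddCommMonoid M] (k : ℕ) : ∀ f : List X → M,
    wordSum k f = ∑ δ : Fin k → X, f (List.ofFn δ) := by
  induction k with
  | zero => intro f; simp [wordSum]
  | succ k ih =>
    intro f
    rw [wordSum, ← (Fin.consEquiv fun _ : Fin (k + 1) => X).sum_comp, Fintype.sum_prod_type]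
    refine Finset.sum_congr rfl fun x _ => ?_
    rw [ih]
    refine Finset.sum_congr rfl fun g _ => ?_
    simp [Fin.consEquiv, List.ofFn_succ]

theorem wordSum_sum {M κ : Type*} [AddCommMonoid M] (s : Finset κ) (k : ℕ)
    (f : κ → List X → M) :
    wordSum k (fun w => ∑ i ∈ s, f i w) = ∑ i ∈ s, wordSum k (f i) := by
  simp only [wordSum_eq_sum_ofFn]
  exact Finset.sum_comm

theorem map_wordSum {M M' F : Type*} [AddCommMonoid M] [AddCommMonoid M'] [FunLike F M M']
    [AddMonoidHomClass F M M'] (φ : F) (k : ℕ) (f : List X → M) :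
    φ (wordSum k f) = wordSum k fun w => φ (f w) := by
  simp only [wordSum_eq_sum_ofFn, map_sum]

theorem wordSum_map_of_injective {M : Type*} [AddCommMonoid M] (i : Y → X)
    (hi : Function.Injective i) (k : ℕ) : ∀ f : List X → M,
    (∀ w, (∃ x ∈ w, x ∉ Set.range i) → f w = 0) → wordSum k f = wordSum k fun w => f (w.map i) := by
  classical
  induction k with
  | zero => intro f _; simp [wordSum]
  | succ k ih =>
    intro f hf
    rw [wordSum, wordSum, ← Finset.sum_subset (Finset.subset_univ (Finset.univ.image i)),
      Finset.sum_image fun _ _ _ _ h => hi h]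
    · refine Finset.sum_congr rfl fun y _ => ?_
      rw [ih]
      · simp
      · rintro w ⟨x, hx, hx'⟩
        exact hf _ ⟨x, List.mem_cons_of_mem _ hx, hx'⟩
    · intro x _ hx
      rw [wordSum_eq_sum_ofFn]
      refine Finset.sum_eq_zero fun δ _ => hf _ ⟨x, List.mem_cons_self, ?_⟩
      simpa using hx

/-- The letters of `w` from the first alphabet. -/
def lefts (w : List (X ⊕ Y)) : List X := w.filterMap Sum.getLeft?

/-- The letters of `w` from the second alphabet. -/
def rights (w : List (X ⊕ Y)) : List Y := w.filterMap Sum.getRight?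

/-- A word in two alphabets is a pair of words together with the set of positions of the first
alphabet, which explains the binomial coefficient. The induction splits off the first letter and
uses Pascal's rule. -/
theorem wordSum_shuffle {R : Type*} [CommRing R] (k : ℕ) : ∀ (f : List X → R) (g : List Y → R),
    wordSum k (fun w => f (lefts w) * g (rights w)) =
      ∑ ij ∈ Finset.HasAntidiagonal.antidiagonal k, (k.choose ij.1 : R) * (wordSum ij.1 f * wordSum ij.2 g) := by
  induction k with
  | zero => intro f g; simp [wordSum, lefts, rights]
  | succ k ih =>
    intro f g
    rw [Finset.sum_antidiagonal_choose_succ_mul fun i j => wordSum i f * wordSum j g, wordSum,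
      Fintype.sum_sum_type, add_comm]
    congr 1
    · have : ∀ y : Y, wordSum k (fun w : List (X ⊕ Y) => f (lefts (Sum.inr y :: w)) *
          g (rights (Sum.inr y :: w))) = _ := fun y => ih f fun w => g (y :: w)
      simp only [this, wordSum]
      rw [Finset.sum_comm]
      simp only [Finset.mul_sum]
    · have : ∀ x : X, wordSum k (fun w : List (X ⊕ Y) => f (lefts (Sum.inl x :: w)) *
          g (rights (Sum.inl x :: w))) = _ := fun x => ih (fun w => f (x :: w)) g
      simp only [this, wordSum]
      rw [Finset.sum_comm]
      refine Finset.sum_congr rfl fun ij hij => ?_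
      rw [← Nat.choose_symm_of_eq_add (Finset.HasAntidiagonal.mem_antidiagonal.1 hij).symm, Finset.sum_mul,
        Finset.mul_sum]

end WordSum

/-! ## Words of 3-cycles and their orbits -/

section Orbit

variable {V W A B : Type} [Fintype V] [DecidableEq V] [Fintype W] [DecidableEq W]
  [Fintype A] [DecidableEq A] [Fintype B] [DecidableEq B]

/-- The product of a word of 3-cycles. -/
def wordProd (w : List (ThreeCycle V)) : Equiv.Perm V := (w.map Subtype.val).prod

/-- The set `U` is preserved by the letters of `w`. -/
def Preserves (w : List (ThreeCycle V)) (U : Set V) : Prop := ∀ δ ∈ w, ∀ a, δ.1 a ∈ U ↔ a ∈ U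

/-- The letters of `w` generate a transitive group. -/
def IsTransitive (w : List (ThreeCycle V)) : Prop :=
  Nonempty V ∧ ∀ U : Set V, Preserves w U → U.Nonempty → U = Set.univ

/-- The orbit of `v` under the group generated by the letters of `w`. -/
def wordOrbit (w : List (ThreeCycle V)) (v : V) : Set V := {a | ∀ U, Preserves w U → v ∈ U → a ∈ U}

theorem preserves_wordOrbit (w : List (ThreeCycle V)) (v : V) : Preserves w (wordOrbit w v) := by
  intro δ hδ a
  exact ⟨fun h U hU hv => (hU δ hδ a).1 (h U hU hv), fun h U hU hv => (hU δ hδ a).2 (h U hU hv)⟩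

theorem Preserves.compl {w : List (ThreeCycle V)} {U : Set V} (h : Preserves w U) :
    Preserves w Uᶜ := fun δ hδ a => not_congr (h δ hδ a)

/-- The complement of a preserved set is preserved, so transitivity can be tested on the sets
containing one chosen base point. -/
theorem isTransitive_iff (w : List (ThreeCycle V)) (v : V) :
    IsTransitive w ↔ wordOrbit w v = Set.univ := by
  constructor
  · rintro ⟨_, h⟩
    exact h _ (preserves_wordOrbit w v) ⟨v, fun U _ hv => hv⟩
  · intro h
    refine ⟨⟨v⟩, fun U hU ⟨u, hu⟩ => ?_⟩
    have key : ∀ U', Preserves w U' → v ∈ U' → U' = Set.univ := fun U' hU' hv =>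
      Set.eq_univ_of_forall fun a => (h ▸ Set.mem_univ a : a ∈ wordOrbit w v) U' hU' hv
    by_cases hv : v ∈ U
    · exact key U hU hv
    · have := key Uᶜ hU.compl hv
      exact absurd hu (this ▸ Set.mem_univ u : u ∈ Uᶜ)

/-- A 3-cycle of one of two parts of `V` as a 3-cycle of `V`. -/
def ThreeCycle.incl (e : A ⊕ B ≃ V) : ThreeCycle A ⊕ ThreeCycle B → ThreeCycle V
  | .inl δ => ⟨e.permCongr (sumCongr δ.1 1), by
      rw [IsThreeCycle, cycleType_permCongr, cycleType_sumCongr_one]; exact δ.2⟩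
  | .inr δ => ⟨e.permCongr (sumCongr 1 δ.1), by
      rw [IsThreeCycle, cycleType_permCongr, cycleType_one_sumCongr]; exact δ.2⟩

theorem ThreeCycle.incl_injective (e : A ⊕ B ≃ V) : Function.Injective (ThreeCycle.incl e) := by
  have key : ∀ {σ σ' : Equiv.Perm A} {τ τ' : Equiv.Perm B},
      e.permCongr (sumCongr σ τ) = e.permCongr (sumCongr σ' τ') → σ = σ' ∧ τ = τ' := by
    intro σ σ' τ τ' h
    have := @sumCongrHom_injective A B (σ, τ) (σ', τ') (e.permCongr.injective h)
    simpa using this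
  rintro (δ | δ) (δ' | δ') h <;> have := key (congrArg Subtype.val h)
  · exact congrArg _ (Subtype.ext this.1)
  · exact absurd this.1 δ.2.ne_one
  · exact absurd this.1.symm δ'.2.ne_one
  · exact congrArg _ (Subtype.ext this.2)

/-- A permutation preserving the first part is a pair (σ, τ), and its cycle type is the union of the
two. This union has the single element 3, so one of σ and τ has empty cycle type and is the
identity. -/
theorem ThreeCycle.mem_range_incl (e : A ⊕ B ≃ V) (δ : ThreeCycle V)
    (h : ∀ a, ∃ a', δ.1 (e (.inl a)) = e (.inl a')) : δ ∈ Set.range (ThreeCycle.incl e) := by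
  have h1 : e.symm.permCongr δ.1 ∈ (sumCongrHom A B).range := by
    refine mem_sumCongrHom_range_of_perm_mapsTo_inl ?_
    rintro _ ⟨a, rfl⟩
    obtain ⟨a', ha'⟩ := h a
    exact ⟨a', by simp [ha']⟩
  obtain ⟨⟨σ, τ⟩, hστ⟩ := h1
  have h2 : δ.1 = e.permCongr (sumCongr σ τ) := by
    have : sumCongr σ τ = e.symm.permCongr δ.1 := hστ
    rw [this]; ext; simp
  have h3 := δ.2.cycleType
  rw [h2, cycleType_permCongr, cycleType_sumCongr] at h3
  have h4 := congrArg Multiset.card h3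
  rw [Multiset.card_add, Multiset.card_singleton] at h4
  rcases Nat.eq_zero_or_pos (Multiset.card σ.cycleType) with h0 | h0
  · have hσ : σ = 1 := cycleType_eq_zero.1 (Multiset.card_eq_zero.1 h0)
    subst hσ
    refine ⟨.inr ⟨τ, by simpa [IsThreeCycle] using h3⟩, Subtype.ext h2.symm⟩
  · have hτ : τ = 1 := cycleType_eq_zero.1 (Multiset.card_eq_zero.1 (by omega))
    subst hτ
    refine ⟨.inl ⟨σ, by simpa [IsThreeCycle] using h3⟩, Subtype.ext h2.symm⟩

/-- Letters of different parts commute, so only the order inside each part matters. -/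
theorem wordProd_map_incl (e : A ⊕ B ≃ V) (w : List (ThreeCycle A ⊕ ThreeCycle B)) :
    wordProd (w.map (ThreeCycle.incl e)) =
      e.permCongr (sumCongr (wordProd (lefts w)) (wordProd (rights w))) := by
  induction w with
  | nil => ext; simp [wordProd, lefts, rights]
  | cons x w ih =>
    have hm : ∀ σ τ : Equiv.Perm (A ⊕ B), e.permCongr σ * e.permCongr τ = e.permCongr (σ * τ) := by
      intro σ τ; ext; simp
    have hc : wordProd ((x :: w).map (ThreeCycle.incl e)) =
      (ThreeCycle.incl e x).1 * wordProd (w.map (ThreeCycle.incl e)) := by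
      simp [wordProd]
    rw [hc, ih]
    rcases x with x | x
    · have h1 : wordProd (lefts (Sum.inl x :: w)) = x.1 * wordProd (lefts w) := by
        simp [wordProd, lefts]
      have h2 : rights (Sum.inl x :: w) = rights w := List.filterMap_cons_none rfl
      rw [h1, h2, ThreeCycle.incl, hm, sumCongr_mul, one_mul]
    · have h1 : wordProd (rights (Sum.inr x :: w)) = x.1 * wordProd (rights w) := by
        simp [wordProd, rights]
      have h2 : lefts (Sum.inr x :: w) = lefts w := List.filterMap_cons_none rfl
      rw [h1, h2, ThreeCycle.incl, hm, sumCongr_mul, one_mul]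

theorem typeMonomial_permCongr (e : V ≃ W) (σ : Equiv.Perm V) :
    typeMonomial (e.permCongr σ) = typeMonomial σ := by
  rw [typeMonomial, typeMonomial, parts_permCongr]

theorem typeMonomial_sumCongr (σ : Equiv.Perm A) (τ : Equiv.Perm B) :
    typeMonomial (sumCongr σ τ) = typeMonomial σ * typeMonomial τ := by
  rw [typeMonomial, typeMonomial, typeMonomial, parts_sumCongr, Multiset.map_add,
    Multiset.prod_add]

/-- Letters from B fix the part A pointwise and letters from A preserve it. The orbit of a is
therefore its orbit under the letters from A alone. -/
theorem wordOrbit_map_incl (e : A ⊕ B ≃ V) (w : List (ThreeCycle A ⊕ ThreeCycle B)) (a : A) :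
    wordOrbit (w.map (ThreeCycle.incl e)) (e (.inl a)) = Set.range (fun a => e (.inl a)) ↔
      IsTransitive (lefts w) := by
  rw [isTransitive_iff _ a]
  constructor
  · intro h
    refine Set.eq_univ_of_forall fun b U hU ha => ?_
    have hb : e (.inl b) ∈ wordOrbit (w.map (ThreeCycle.incl e)) (e (.inl a)) := by
      rw [h]; exact ⟨b, rfl⟩
    have hP : Preserves (w.map (ThreeCycle.incl e)) ((fun a => e (.inl a)) '' U) := by
      intro δ hδ v
      obtain ⟨x, hx, rfl⟩ := List.mem_map.1 hδ
      obtain ⟨v, rfl⟩ := e.surjective v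
      rcases x with x | x
      · rcases v with v | v
        · have := hU x (List.mem_filterMap.2 ⟨_, hx, rfl⟩) v
          simpa [ThreeCycle.incl] using this
        · simp [ThreeCycle.incl]
      · rcases v with v | v <;> simp [ThreeCycle.incl]
    obtain ⟨b', hb', hbb⟩ := hb _ hP ⟨a, ha, rfl⟩
    simpa using (show b' = b by simpa using hbb) ▸ hb'
  · intro h
    refine Set.Subset.antisymm ?_ ?_
    · intro v hv
      refine hv _ ?_ ⟨a, rfl⟩
      intro δ hδ v
      obtain ⟨x, hx, rfl⟩ := List.mem_map.1 hδ
      obtain ⟨v, rfl⟩ := e.surjective v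
      rcases x with x | x <;> rcases v with v | v <;> simp [ThreeCycle.incl]
    · rintro _ ⟨b, rfl⟩ U hU ha
      have hb : b ∈ wordOrbit (lefts w) a := h ▸ Set.mem_univ b
      refine hb {c | e (.inl c) ∈ U} ?_ ha
      intro δ hδ c
      obtain ⟨x, hx, hxδ⟩ := List.mem_filterMap.1 hδ
      rcases x with x | x
      · obtain rfl : x = δ := by simpa using hxδ
        have := hU _ (List.mem_map_of_mem (f := ThreeCycle.incl e) hx) (e (.inl c))
        simpa [ThreeCycle.incl] using this
      · simp at hxδ

theorem mem_range_incl_of_wordOrbit (e : A ⊕ B ≃ V) (w : List (ThreeCycle V)) (v : V)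
    (h : wordOrbit w v = Set.range fun a => e (.inl a)) (δ : ThreeCycle V) (hδ : δ ∈ w) :
    δ ∈ Set.range (ThreeCycle.incl e) := by
  refine ThreeCycle.mem_range_incl e δ fun a => ?_
  have h1 : δ.1 (e (.inl a)) ∈ wordOrbit w v := by
    rw [preserves_wordOrbit w v δ hδ, h]
    exact ⟨a, rfl⟩
  rw [h] at h1
  obtain ⟨a', ha'⟩ := h1
  exact ⟨a', ha'.symm⟩

/-- The cycle types of the products of the words of length `k` in the 3-cycles of `V`. -/
def allWords (V : Type) [Fintype V] [DecidableEq V] (k : ℕ) : MvPolynomial ℕ+ ℂ :=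
  wordSum (X := ThreeCycle V) k fun w => typeMonomial (wordProd w)

open scoped Classical in
/-- The cycle types of the products of the words of length `k` in the 3-cycles of `V` that
generate a transitive group. -/
def transWords (V : Type) [Fintype V] [DecidableEq V] (k : ℕ) : MvPolynomial ℕ+ ℂ :=
  wordSum (X := ThreeCycle V) k fun w => if IsTransitive w then typeMonomial (wordProd w) else 0

open scoped Classical in
-- If the orbit of a is A, every letter preserves A and so lies in A or in its complement B. The
-- letters in A then form a transitive word, those in B are arbitrary, and the two words are
-- shuffled.
theorem wordSum_orbit (e : A ⊕ B ≃ V) (a : A) (k : ℕ) :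
    wordSum k (fun w => if wordOrbit w (e (.inl a)) = Set.range (fun a => e (.inl a)) then
      typeMonomial (wordProd w) else 0) =
    ∑ ij ∈ Finset.HasAntidiagonal.antidiagonal k, (k.choose ij.1 : MvPolynomial ℕ+ ℂ) *
      (transWords A ij.1 * allWords B ij.2) := by
  rw [wordSum_map_of_injective _ (ThreeCycle.incl_injective e)]
  · simp only [transWords, allWords]
    rw [← wordSum_shuffle]
    congr 1
    funext w
    simp only [wordOrbit_map_incl, wordProd_map_incl, typeMonomial_permCongr,
      typeMonomial_sumCongr, ite_mul, zero_mul]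
  · rintro w ⟨δ, hδ, hδ'⟩
    rw [if_neg]
    exact fun h => hδ' (mem_range_incl_of_wordOrbit e w _ h δ hδ)

/-- Relabelling a 3-cycle. -/
def ThreeCycle.congr (e : V ≃ W) (δ : ThreeCycle V) : ThreeCycle W :=
  ⟨e.permCongr δ.1, by rw [IsThreeCycle, cycleType_permCongr]; exact δ.2⟩

theorem ThreeCycle.congr_injective (e : V ≃ W) : Function.Injective (ThreeCycle.congr e) :=
  fun _ _ h => Subtype.ext (e.permCongr.injective (congrArg Subtype.val h))

theorem ThreeCycle.congr_surjective (e : V ≃ W) : Function.Surjective (ThreeCycle.congr e) :=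
  fun δ => ⟨ThreeCycle.congr e.symm δ, Subtype.ext (by ext; simp [ThreeCycle.congr])⟩

theorem wordProd_map_congr (e : V ≃ W) (w : List (ThreeCycle V)) :
    wordProd (w.map (ThreeCycle.congr e)) = e.permCongr (wordProd w) := by
  induction w with
  | nil => ext; simp [wordProd]
  | cons x w ih =>
    simp only [wordProd, List.map_cons, List.prod_cons] at ih ⊢
    rw [ih]
    ext; simp [ThreeCycle.congr]

theorem IsTransitive.map_congr (e : V ≃ W) {w : List (ThreeCycle V)} (h : IsTransitive w) :
    IsTransitive (w.map (ThreeCycle.congr e)) := by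
  obtain ⟨⟨v⟩, h⟩ := h
  refine ⟨⟨e v⟩, fun U hU hne => ?_⟩
  have := h (e ⁻¹' U) (fun δ hδ a => by
    simpa [ThreeCycle.congr] using hU _ (List.mem_map_of_mem (f := ThreeCycle.congr e) hδ) (e a))
    (by obtain ⟨u, hu⟩ := hne; exact ⟨e.symm u, by simpa using hu⟩)
  rw [Set.preimage_eq_univ_iff, e.range_eq_univ] at this
  exact Set.univ_subset_iff.1 this

theorem isTransitive_map_congr_iff (e : V ≃ W) (w : List (ThreeCycle V)) :
    IsTransitive (w.map (ThreeCycle.congr e)) ↔ IsTransitive w := by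
  refine ⟨fun h => ?_, IsTransitive.map_congr e⟩
  have := IsTransitive.map_congr e.symm h
  rwa [List.map_map, show ThreeCycle.congr e.symm ∘ ThreeCycle.congr e = id from
    funext fun δ => Subtype.ext (by ext; simp [ThreeCycle.congr]), List.map_id] at this

theorem allWords_congr (e : V ≃ W) (k : ℕ) : allWords V k = allWords W k := by
  rw [allWords, allWords, wordSum_map_of_injective _ (ThreeCycle.congr_injective e)]
  · simp only [wordProd_map_congr, typeMonomial_permCongr]
  · rintro w ⟨δ, _, h⟩
    exact absurd (ThreeCycle.congr_surjective e δ) h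

theorem transWords_congr (e : V ≃ W) (k : ℕ) : transWords V k = transWords W k := by
  rw [transWords, transWords, wordSum_map_of_injective _ (ThreeCycle.congr_injective e)]
  · refine congrArg _ (funext fun w => ?_)
    classical
    rw [wordProd_map_congr, typeMonomial_permCongr]
    exact if_congr (isTransitive_map_congr_iff e w).symm rfl rfl
  · rintro w ⟨δ, _, h⟩
    exact absurd (ThreeCycle.congr_surjective e δ) h

/-- Decomposition of words according to the orbit of a base point. -/
theorem allWords_fin_succ (n k : ℕ) : allWords (Fin (n + 1)) k =
    ∑ ab ∈ Finset.HasAntidiagonal.antidiagonal n, (n.choose ab.1 : MvPolynomial ℕ+ ℂ) *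
      ∑ ij ∈ Finset.HasAntidiagonal.antidiagonal k, (k.choose ij.1 : MvPolynomial ℕ+ ℂ) *
        (transWords (Fin (ab.1 + 1)) ij.1 * allWords (Fin ab.2) ij.2) := by
  classical
  -- Words are sorted by the orbit of 0, with S the rest of that orbit.
  have h1 : allWords (Fin (n + 1)) k = ∑ S ∈ (Finset.univ.erase (0 : Fin (n + 1))).powerset,
      wordSum (X := ThreeCycle (Fin (n + 1))) k (fun w =>
        if wordOrbit w 0 = ↑(insert 0 S : Finset (Fin (n + 1))) then
          typeMonomial (wordProd w) else 0) := by
    rw [← wordSum_sum, allWords]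
    congr 1
    funext w
    have h0 : (0 : Fin (n + 1)) ∈ (wordOrbit w 0).toFinset := by
      rw [Set.mem_toFinset]; exact fun U _ h => h
    rw [Finset.sum_eq_single ((wordOrbit w 0).toFinset.erase 0), if_pos]
    · rw [Finset.insert_erase h0, Set.coe_toFinset]
    · intro S hS hne
      rw [if_neg]
      intro h
      apply hne
      have h0S : (0 : Fin (n + 1)) ∉ S := fun h => by
        have := Finset.mem_powerset.1 hS h
        simp at this
      simp only [h, Finset.toFinset_coe, Finset.erase_insert h0S]
    · intro h
      exact absurd (Finset.mem_powerset.2 (Finset.erase_subset_erase _ (Finset.subset_univ _))) h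
  let G : ℕ → MvPolynomial ℕ+ ℂ := fun m =>
    ∑ ij ∈ Finset.HasAntidiagonal.antidiagonal k, (k.choose ij.1 : MvPolynomial ℕ+ ℂ) *
      (transWords (Fin (m + 1)) ij.1 * allWords (Fin (n - m)) ij.2)
  have h2 : ∀ S ∈ (Finset.univ.erase (0 : Fin (n + 1))).powerset,
      wordSum (X := ThreeCycle (Fin (n + 1))) k (fun w =>
        if wordOrbit w 0 = ↑(insert 0 S : Finset (Fin (n + 1))) then
          typeMonomial (wordProd w) else 0) = G S.card := by
    intro S hS
    have h0S : (0 : Fin (n + 1)) ∉ S := fun h => by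
      have := Finset.mem_powerset.1 hS h
      simp at this
    let S' : Finset (Fin (n + 1)) := insert 0 S
    let e := Equiv.sumCompl (fun v => v ∈ S')
    have hr : (Set.range fun a : {v // v ∈ S'} => e (.inl a)) = ↑S' := by
      ext v; simp [e]
    have := wordSum_orbit e ⟨0, Finset.mem_insert_self 0 S⟩ k
    rw [hr, show e (.inl ⟨0, Finset.mem_insert_self 0 S⟩) = 0 from rfl] at this
    refine this.trans ?_
    have c1 : Fintype.card {v // v ∈ S'} = S.card + 1 := by
      rw [Fintype.card_coe, Finset.card_insert_of_notMem h0S]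
    have c2 : Fintype.card {v // ¬ v ∈ S'} = n - S.card := by
      rw [Fintype.card_subtype_compl, c1, Fintype.card_fin]
      omega
    refine Finset.sum_congr rfl fun ij _ => ?_
    rw [transWords_congr (Fintype.equivFinOfCardEq c1), allWords_congr (Fintype.equivFinOfCardEq c2)]
  -- The contribution depends only on the size of S, a subset of the n points other than 0, so each
  -- size m is counted n choose m times.
  rw [h1, Finset.sum_congr rfl h2, Finset.sum_powerset_apply_card,
    Finset.Nat.sum_antidiagonal_eq_sum_range_succ_mk, Finset.card_erase_of_mem (Finset.mem_univ _),
    Finset.card_univ, Fintype.card_fin, Nat.add_sub_cancel]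
  refine Finset.sum_congr rfl fun m _ => ?_
  rw [nsmul_eq_mul]

end Orbit

/-! ## Elementary values -/

section Values

variable {V : Type} [Fintype V] [DecidableEq V]

theorem typeMonomial_mul_comm (σ τ : Equiv.Perm V) :
    typeMonomial (σ * τ) = typeMonomial (τ * σ) := by
  have : (σ * τ).partition = (τ * σ).partition :=
    partition_eq_of_isConj.1 (isConj_iff.2 ⟨τ, by group⟩)
  rw [typeMonomial, typeMonomial, this]

/-- The first letter can be moved to the end, since this only conjugates the product. It then
multiplies each shorter word on the right, where `sum_typeMonomial_mul` applies. This is the linear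
cut-and-join equation. -/
theorem allWords_succ (k : ℕ) (K : ℕ+) (hK : Fintype.card V ≤ K) :
    (3 : ℂ) • allWords V (k + 1) = ∑ i ∈ Finset.Icc 1 K, ∑ j ∈ Finset.Icc 1 K,
      ∑ l ∈ Finset.Icc 1 K, ((W3Terms i j l).map (fun s => s.apply (allWords V k))).sum := by
  -- Additivity of every term lets the operator be exchanged with the sum over words.
  have hlin : ∀ s : PTerm, ∃ φ : MvPolynomial ℕ+ ℂ →+ MvPolynomial ℕ+ ℂ, ∀ f, s.apply f = φ f := by
    intro s
    have h2 : ∀ l : List ℕ+, ∃ φ : MvPolynomial ℕ+ ℂ →+ MvPolynomial ℕ+ ℂ,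
        ∀ f, l.foldr (fun k g => MvPolynomial.pderiv k g) f = φ f := by
      intro l
      induction l with
      | nil => exact ⟨AddMonoidHom.id _, fun f => rfl⟩
      | cons a l ih =>
        obtain ⟨φ, hφ⟩ := ih
        exact ⟨(MvPolynomial.pderiv a).toLinearMap.toAddMonoidHom.comp φ, fun f => by simp [hφ]⟩
    obtain ⟨φ, hφ⟩ := h2 s.der
    exact ⟨(DistribSMul.toAddMonoidHom _ s.coef).comp
      ((AddMonoidHom.mulLeft (s.mul.map MvPolynomial.X).prod).comp φ), fun f => by
        simp [PTerm.apply, hφ]⟩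
  choose φ hφ using hlin
  have h1 : allWords V (k + 1) = wordSum (X := ThreeCycle V) k fun w =>
      ∑ δ : ThreeCycle V, typeMonomial (wordProd w * δ.1) := by
    rw [wordSum_sum, allWords, wordSum]
    refine Finset.sum_congr rfl fun δ _ => ?_
    congr 1
    funext w
    rw [typeMonomial_mul_comm]
    simp [wordProd]
  have h2 : (3 : ℂ) • allWords V (k + 1) = wordSum (X := ThreeCycle V) k fun w =>
      ∑ i ∈ Finset.Icc 1 K, ∑ j ∈ Finset.Icc 1 K, ∑ l ∈ Finset.Icc 1 K,
        ((W3Terms i j l).map (fun s => s.apply (typeMonomial (wordProd w)))).sum := by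
    rw [h1, ← DistribSMul.toAddMonoidHom_apply, map_wordSum]
    simp only [DistribSMul.toAddMonoidHom_apply, sum_typeMonomial_mul _ K hK]
  rw [h2, wordSum_sum]
  refine Finset.sum_congr rfl fun i _ => ?_
  rw [wordSum_sum]
  refine Finset.sum_congr rfl fun j _ => ?_
  rw [wordSum_sum]
  refine Finset.sum_congr rfl fun l _ => ?_
  have h3 : ∀ L : List PTerm, (L.map (fun s => s.apply (allWords V k))).sum =
      wordSum (X := ThreeCycle V) k fun w =>
        (L.map (fun s => s.apply (typeMonomial (wordProd w)))).sum := by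
    intro L
    induction L with
    | nil => simp [wordSum_eq_sum_ofFn]
    | cons s L ih =>
      simp only [List.map_cons, List.sum_cons, ih]
      rw [hφ, allWords, map_wordSum]
      simp only [wordSum_eq_sum_ofFn, ← Finset.sum_add_distrib, hφ]
  rw [h3]

theorem allWords_fin_zero (k : ℕ) : allWords (Fin 0) k = if k = 0 then 1 else 0 := by
  have : IsEmpty (ThreeCycle (Fin 0)) := ⟨fun δ => δ.2.ne_one (Subsingleton.elim _ _)⟩
  rcases k with _ | k
  · simp [allWords, wordSum, typeMonomial, parts_partition_eq, wordProd]
  · simp [allWords, wordSum]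

/-- Transitivity includes that there is a point, so T has no constant term in z. -/
theorem transWords_fin_zero (k : ℕ) : transWords (Fin 0) k = 0 := by
  rw [transWords, wordSum_eq_sum_ofFn]
  refine Finset.sum_eq_zero fun δ _ => if_neg fun h => ?_
  obtain ⟨v⟩ := h.1
  exact v.elim0

end Values

end

/-! ### The exponential formula and the nonlinear equation for transitive words -/

section

open PowerSeries

/-! ## Coefficientwise derivations of power series -/

section CoeffDerivation

variable {S : Type*} [CommRing S] [Algebra ℂ S]

/-- A derivation of the coefficients acting on power series. -/
def coeffDerivation (D : Derivation ℂ S S) : Derivation ℂ S⟦X⟧ S⟦X⟧ :=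
  Derivation.mk'
    { toFun := fun f => PowerSeries.mk fun n => D (coeff n f)
      map_add' := fun f g => by ext; simp
      map_smul' := fun c f => by ext; simp }
    (fun f g => by
      ext n
      simp only [LinearMap.coe_mk, AddHom.coe_mk, coeff_mk, smul_eq_mul, map_add, coeff_mul,
        map_sum, Derivation.leibniz, Finset.sum_add_distrib]
      congr 1
      exact Finset.Nat.sum_antidiagonal_swap
        (f := fun ij => (coeff ij.1) g * D ((coeff ij.2) f)))

@[simp] theorem coeff_coeffDerivation (D : Derivation ℂ S S) (f : S⟦X⟧) (n : ℕ) :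
    coeff n (coeffDerivation D f) = D (coeff n f) := by
  simp [coeffDerivation]

theorem coeffDerivation_derivative (D : Derivation ℂ S S) (f : S⟦X⟧) :
    coeffDerivation D (d⁄dX S f) = d⁄dX S (coeffDerivation D f) := by
  ext n
  simp only [coeff_coeffDerivation, coeff_derivative, Derivation.leibniz, smul_eq_mul, map_add,
    Derivation.map_natCast, Derivation.map_one_eq_zero]
  ring

/-- Uniqueness for a linear differential equation: the equation expresses (n+1) u_{n+1} through
earlier coefficients, and n+1 is invertible over ℂ. -/
theorem eq_zero_of_derivative_eq_mul {u g : S⟦X⟧} (h : d⁄dX S u = g * u) (h0 : coeff 0 u = 0) :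
    u = 0 := by
  ext n
  rw [map_zero]
  induction n using Nat.strong_induction_on with
  | _ n ih =>
    rcases n with _ | n
    · exact h0
    · have h1 := congrArg (coeff n) h
      rw [coeff_derivative, coeff_mul, Finset.sum_eq_zero] at h1
      · have h2 : (((n + 1 : ℕ) : ℂ)) • coeff (n + 1) u = 0 := by
          rw [Algebra.smul_def, map_natCast, mul_comm]; push_cast; exact h1
        have h3 : ((n + 1 : ℕ) : ℂ) ≠ 0 := Nat.cast_ne_zero.2 n.succ_ne_zero
        rw [← inv_smul_smul₀ h3 (coeff (n + 1) u), h2, smul_zero]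
      · intro ij hij
        rw [ih ij.2 (by have := Finset.HasAntidiagonal.mem_antidiagonal.1 hij; omega), mul_zero]

/-- If `Φ' = T' Φ` and `Φ(0) = 1`, `T(0) = 0`, then `D Φ = Φ · D T` for every derivation `D` of the
coefficients. -/
theorem coeffDerivation_of_derivative_eq_mul (D : Derivation ℂ S S) {Φ T : S⟦X⟧}
    (h : d⁄dX S Φ = d⁄dX S T * Φ) (hΦ : coeff 0 Φ = 1) (hT : coeff 0 T = 0) :
    coeffDerivation D Φ = Φ * coeffDerivation D T := by
  rw [← sub_eq_zero]
  -- The difference u = DΦ − Φ·DT satisfies u' = T'u: both (DΦ)' and (Φ·DT)' contain Φ·DT', which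
  -- cancels.
  refine eq_zero_of_derivative_eq_mul (g := d⁄dX S T) ?_ ?_
  · rw [map_sub, ← coeffDerivation_derivative, h, Derivation.leibniz, Derivation.leibniz,
      coeffDerivation_derivative, h]
    simp only [smul_eq_mul]
    ring
  · simp only [map_sub, coeff_coeffDerivation, hΦ, Derivation.map_one_eq_zero, coeff_mul,
      Finset.Nat.antidiagonal_zero, Finset.sum_singleton, hT, map_zero, mul_zero, sub_zero]

end CoeffDerivation

/-! ## Exponential generating functions -/

/-- The ring `ℂ[p₁, p₂, …][[t]]`. -/
abbrev TSeries : Type := (MvPolynomial ℕ+ ℂ)⟦X⟧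

/-- The ring `ℂ[p₁, p₂, …][[t]][[z]]`. -/
abbrev TZSeries : Type := TSeries⟦X⟧

/-- The derivative with respect to `t`. -/
def derivT : Derivation ℂ TZSeries TZSeries :=
  coeffDerivation ((PowerSeries.derivative (MvPolynomial ℕ+ ℂ)).restrictScalars ℂ)

/-- The derivative with respect to `p_i`. -/
def derivP (i : ℕ+) : Derivation ℂ TZSeries TZSeries :=
  coeffDerivation (coeffDerivation (MvPolynomial.pderiv i))

/-- The variable `p_i`. -/
def varP (i : ℕ+) : TZSeries := C (C (MvPolynomial.X i))

/-- The exponential generating function of an array of polynomials. -/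
def egf (a : ℕ → ℕ → MvPolynomial ℕ+ ℂ) : TZSeries :=
  PowerSeries.mk fun n => PowerSeries.mk fun k => ((n.factorial * k.factorial : ℂ)⁻¹) • a n k

theorem coeff_coeff_egf (a : ℕ → ℕ → MvPolynomial ℕ+ ℂ) (n k : ℕ) :
    coeff k (coeff n (egf a)) = ((n.factorial * k.factorial : ℂ)⁻¹) • a n k := by
  simp [egf]

/-- The generating function of all words of 3-cycles. -/
def allSeries : TZSeries := egf fun n k => allWords (Fin n) k

/-- The generating function of the transitive words of 3-cycles. -/
def transSeries : TZSeries := egf fun n k => transWords (Fin n) k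

theorem coeff_zero_allSeries : coeff 0 allSeries = 1 := by
  ext1 k
  rw [allSeries, coeff_coeff_egf, allWords_fin_zero, coeff_one]
  split_ifs with h
  · simp [h]
  · simp

theorem coeff_zero_transSeries : coeff 0 transSeries = 0 := by
  ext1 k
  rw [transSeries, coeff_coeff_egf, transWords_fin_zero, smul_zero, map_zero]

/-- The orbit recursion `allWords_fin_succ` in terms of generating functions. The base point
accounts for the derivative in z on both sides, and the binomial coefficients are absorbed by the
factorials. This expresses Φ = exp T without forming an exponential. -/
theorem derivative_allSeries :
    d⁄dX TSeries allSeries = d⁄dX TSeries transSeries * allSeries := by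
  ext1 n
  ext1 k
  have hc : ∀ (f : TZSeries) (m l : ℕ), coeff l (coeff m (d⁄dX TSeries f)) =
      ((m + 1 : ℕ) : ℂ) • coeff l (coeff (m + 1) f) := by
    intro f m l
    rw [coeff_derivative, ← Nat.cast_succ, mul_comm, ← nsmul_eq_mul, map_nsmul, Nat.cast_smul_eq_nsmul]
  rw [hc, coeff_mul, map_sum]
  simp only [coeff_mul, hc]
  rw [allSeries, transSeries, coeff_coeff_egf, allWords_fin_succ]
  simp only [coeff_coeff_egf, smul_smul, Finset.smul_sum, Finset.mul_sum]
  refine Finset.sum_congr rfl fun ab hab => Finset.sum_congr rfl fun ij hij => ?_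
  rw [Finset.HasAntidiagonal.mem_antidiagonal] at hab hij
  subst hab hij
  have hN : ∀ (m : ℕ) (f : MvPolynomial ℕ+ ℂ), (m : MvPolynomial ℕ+ ℂ) * f = (m : ℂ) • f := by
    intro m f; rw [← nsmul_eq_mul, Nat.cast_smul_eq_nsmul]
  rw [hN, hN, smul_mul_smul_comm, smul_smul, smul_smul]
  congr 1
  rw [Nat.cast_add_choose, Nat.cast_add_choose, Nat.factorial_succ, Nat.factorial_succ]
  have h1 := fun m : ℕ => Nat.cast_ne_zero (R := ℂ).2 m.factorial_ne_zero
  have h2 := fun m : ℕ => Nat.cast_ne_zero (R := ℂ).2 m.succ_ne_zero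
  have h3 := h1 ab.1
  have h4 := h1 ab.2
  have h5 := h1 ij.1
  have h6 := h1 ij.2
  have h7 := h2 ab.1
  have h8 := h2 (ab.1 + ab.2)
  have h9 := h1 (ab.1 + ab.2)
  have h10 := h1 (ij.1 + ij.2)
  push_cast at *
  field_simp

theorem derivT_allSeries : derivT allSeries = allSeries * derivT transSeries :=
  coeffDerivation_of_derivative_eq_mul _ derivative_allSeries coeff_zero_allSeries
    coeff_zero_transSeries

theorem derivP_allSeries (i : ℕ+) : derivP i allSeries = allSeries * derivP i transSeries :=
  coeffDerivation_of_derivative_eq_mul _ derivative_allSeries coeff_zero_allSeries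
    coeff_zero_transSeries

theorem isUnit_allSeries : IsUnit allSeries := by
  rw [PowerSeries.isUnit_iff_constantCoeff, ← PowerSeries.coeff_zero_eq_constantCoeff_apply,
    coeff_zero_allSeries]
  exact isUnit_one

/-- The iterated `p`-derivatives of `exp T`, divided by `exp T`. -/
def logDeriv (T : TZSeries) : List ℕ+ → TZSeries
  | [] => 1
  | i :: l => derivP i (logDeriv T l) + derivP i T * logDeriv T l

/-- Since ∂Φ = Φ·∂T, one has ∂(Φ L) = Φ (∂L + ∂T·L), which is the recursion of `logDeriv`. -/
theorem foldr_derivP_allSeries (l : List ℕ+) :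
    l.foldr (fun k g => derivP k g) allSeries = allSeries * logDeriv transSeries l := by
  induction l with
  | nil => simp [logDeriv]
  | cons i l ih =>
    rw [List.foldr_cons, ih, Derivation.leibniz, derivP_allSeries, logDeriv]
    simp only [smul_eq_mul]
    ring

theorem coeff_coeff_derivP (i : ℕ+) (f : TZSeries) (n k : ℕ) :
    coeff k (coeff n (derivP i f)) = MvPolynomial.pderiv i (coeff k (coeff n f)) := by
  simp [derivP]

theorem coeff_coeff_derivT (f : TZSeries) (n k : ℕ) :
    coeff k (coeff n (derivT f)) = ((k + 1 : ℕ) : ℂ) • coeff (k + 1) (coeff n f) := by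
  simp only [derivT, coeff_coeffDerivation, Derivation.restrictScalars_apply, coeff_derivative]
  rw [← Nat.cast_succ, mul_comm, ← nsmul_eq_mul, Nat.cast_smul_eq_nsmul]

theorem coeff_coeff_varP_mul (i : ℕ+) (f : TZSeries) (n k : ℕ) :
    coeff k (coeff n (varP i * f)) = MvPolynomial.X i * coeff k (coeff n f) := by
  rw [varP, coeff_C_mul, coeff_C_mul]

/-- The operators involve only the variables p_i, so they act separately on each coefficient of z^n
t^k. -/
theorem coeff_coeff_apply (s : PTerm) (f : TZSeries) (n k : ℕ) :
    coeff k (coeff n (s.coef • ((s.mul.map varP).prod *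
      s.der.foldr (fun k g => derivP k g) f))) = s.apply (coeff k (coeff n f)) := by
  have h1 : ∀ l : List ℕ+, coeff k (coeff n (l.foldr (fun k g => derivP k g) f)) =
      l.foldr (fun k g => MvPolynomial.pderiv k g) (coeff k (coeff n f)) := by
    intro l
    induction l with
    | nil => rfl
    | cons i l ih => rw [List.foldr_cons, coeff_coeff_derivP, ih, List.foldr_cons]
  have h2 : ∀ (l : List ℕ+) (g : TZSeries), coeff k (coeff n ((l.map varP).prod * g)) =
      (l.map MvPolynomial.X).prod * coeff k (coeff n g) := by
    intro l g
    induction l with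
    | nil => simp
    | cons i l ih =>
      rw [List.map_cons, List.prod_cons, mul_assoc, coeff_coeff_varP_mul, ih, List.map_cons,
        List.prod_cons, mul_assoc]
  rw [PTerm.apply, ← h1, ← h2]
  rfl

/-- A term of `W([3])` applied to `exp T` and divided by `exp T`. -/
def PTerm.logApply (s : PTerm) (T : TZSeries) : TZSeries :=
  s.coef • ((s.mul.map varP).prod * logDeriv T s.der)

/-- The nonlinear cut-and-join equation for the transitive words. -/
theorem X_pow_dvd_transSeries (N : ℕ+) : (X : TZSeries) ^ ((N : ℕ) + 1) ∣
    (3 : ℂ) • derivT transSeries - ∑ i ∈ Finset.Icc 1 N, ∑ j ∈ Finset.Icc 1 N,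
      ∑ k ∈ Finset.Icc 1 N, ((W3Terms i j k).map (fun s => s.logApply transSeries)).sum := by
  -- The sums over i, j, k may be cut off at N only on at most N points, so the linear equation is
  -- obtained up to z^N.
  have h1 : (X : TZSeries) ^ ((N : ℕ) + 1) ∣
      (3 : ℂ) • derivT allSeries - ∑ i ∈ Finset.Icc 1 N, ∑ j ∈ Finset.Icc 1 N,
        ∑ k ∈ Finset.Icc 1 N, ((W3Terms i j k).map (fun s => s.coef • ((s.mul.map varP).prod *
          s.der.foldr (fun k g => derivP k g) allSeries))).sum := by
    rw [X_pow_dvd_iff]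
    intro n hn
    ext1 k
    have hs : ∀ (c : ℂ) (f : TZSeries), coeff k (coeff n (c • f)) = c • coeff k (coeff n f) :=
      fun _ _ => rfl
    simp only [map_sub, map_sum, map_list_sum, List.map_map, Function.comp_def, coeff_coeff_apply,
      map_zero]
    simp only [hs, coeff_coeff_derivT]
    have ha : ∀ s : PTerm, s.apply (coeff k (coeff n allSeries)) =
        ((n.factorial * k.factorial : ℂ)⁻¹) • s.apply (allWords (Fin n) k) := by
      intro s
      rw [allSeries, coeff_coeff_egf]
      have : ∀ (c : ℂ) (f : MvPolynomial ℕ+ ℂ), s.der.foldr (fun k g => MvPolynomial.pderiv k g)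
          (c • f) = c • s.der.foldr (fun k g => MvPolynomial.pderiv k g) f := by
        intro c f
        induction s.der with
        | nil => rfl
        | cons i l ih => rw [List.foldr_cons, ih, Derivation.map_smul, List.foldr_cons]
      rw [PTerm.apply, this, PTerm.apply, mul_smul_comm, smul_comm]
    have hl : ∀ L : List PTerm, (L.map fun s => s.apply (coeff k (coeff n allSeries))).sum =
        ((n.factorial * k.factorial : ℂ)⁻¹) • (L.map fun s => s.apply (allWords (Fin n) k)).sum := by
      intro L
      rw [List.smul_sum, List.map_map]
      simp only [ha, Function.comp_def]
    simp only [hl, ← Finset.smul_sum]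
    rw [← allWords_succ k N (by rw [Fintype.card_fin]; omega), allSeries, coeff_coeff_egf, sub_eq_zero]
    simp only [smul_smul]
    congr 1
    rw [Nat.factorial_succ]
    have h1 := Nat.cast_ne_zero (R := ℂ).2 n.factorial_ne_zero
    have h2 := Nat.cast_ne_zero (R := ℂ).2 k.factorial_ne_zero
    have h3 := Nat.cast_ne_zero (R := ℂ).2 k.succ_ne_zero
    push_cast at *
    field_simp
  -- Every term is Φ times its logarithmic version. As Φ has constant term 1 in z it is a unit and
  -- can be divided out.
  have h2 : (3 : ℂ) • derivT allSeries - ∑ i ∈ Finset.Icc 1 N, ∑ j ∈ Finset.Icc 1 N,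
        ∑ k ∈ Finset.Icc 1 N, ((W3Terms i j k).map (fun s => s.coef • ((s.mul.map varP).prod *
          s.der.foldr (fun k g => derivP k g) allSeries))).sum =
      allSeries * ((3 : ℂ) • derivT transSeries - ∑ i ∈ Finset.Icc 1 N, ∑ j ∈ Finset.Icc 1 N,
      ∑ k ∈ Finset.Icc 1 N, ((W3Terms i j k).map (fun s => s.logApply transSeries)).sum) := by
    have hs : ∀ s : PTerm, s.coef • ((s.mul.map varP).prod *
          s.der.foldr (fun k g => derivP k g) allSeries) =
        allSeries * s.logApply transSeries := by
      intro s
      rw [foldr_derivP_allSeries, PTerm.logApply, mul_smul_comm, mul_left_comm]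
    simp only [hs, List.sum_map_mul_left, ← Finset.mul_sum, mul_sub, derivT_allSeries,
      mul_smul_comm]
  rw [h2] at h1
  exact isUnit_allSeries.dvd_mul_left.1 h1

end

/-! ### The Riemann–Hurwitz bound and the part where it is an equality -/

section

open PowerSeries

/-! ## The genus filtration and its symbols -/

/-- The coefficient of `z ^ n t ^ k p ^ a`. -/
def cf (f : TZSeries) (n k : ℕ) (a : ℕ+ →₀ ℕ) : ℂ := MvPolynomial.coeff a (coeff k (coeff n f))

theorem cf_add (f g : TZSeries) (n k : ℕ) (a : ℕ+ →₀ ℕ) :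
    cf (f + g) n k a = cf f n k a + cf g n k a := by simp [cf]

theorem cf_smul (c : ℂ) (f : TZSeries) (n k : ℕ) (a : ℕ+ →₀ ℕ) :
    cf (c • f) n k a = c * cf f n k a :=
  (MvPolynomial.coeff_smul a c (coeff k (coeff n f))).trans (smul_eq_mul _ _)

theorem cf_mul (f g : TZSeries) (n k : ℕ) (a : ℕ+ →₀ ℕ) : cf (f * g) n k a =
    ∑ x ∈ Finset.HasAntidiagonal.antidiagonal n, ∑ c ∈ Finset.HasAntidiagonal.antidiagonal a,
      ∑ y ∈ Finset.HasAntidiagonal.antidiagonal k, cf f x.1 y.1 c.1 * cf g x.2 y.2 c.2 := by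
  simp only [cf, coeff_mul, map_sum, MvPolynomial.coeff_sum, MvPolynomial.coeff_mul]
  exact Finset.sum_congr rfl fun x _ => Finset.sum_comm

theorem cf_derivP (i : ℕ+) (f : TZSeries) (n k : ℕ) (a : ℕ+ →₀ ℕ) :
    cf (derivP i f) n k a = cf f n k (a + Finsupp.single i 1) * (a i + 1) := by
  rw [cf, coeff_coeff_derivP, MvPolynomial.coeff_pderiv]
  rfl

theorem cf_derivT (f : TZSeries) (n k : ℕ) (a : ℕ+ →₀ ℕ) :
    cf (derivT f) n k a = ((k + 1 : ℕ) : ℂ) * cf f n (k + 1) a := by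
  rw [cf, coeff_coeff_derivT, MvPolynomial.coeff_smul, smul_eq_mul]; rfl

theorem cf_varP (i : ℕ+) (n k : ℕ) (a : ℕ+ →₀ ℕ) :
    cf (varP i) n k a = if n = 0 ∧ k = 0 ∧ a = Finsupp.single i 1 then 1 else 0 := by
  classical
  rw [cf, varP, coeff_C]
  split_ifs with h1 h2 h2
  · rw [coeff_C, if_pos h2.2.1, MvPolynomial.coeff_X, if_pos h2.2.2.symm]
  · rw [coeff_C]
    split_ifs with h3
    · rw [MvPolynomial.coeff_X, if_neg fun h => h2 ⟨h1, h3, h.symm⟩]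
    · simp
  · exact absurd h2.1 h1
  · simp

theorem cf_one (n k : ℕ) (a : ℕ+ →₀ ℕ) :
    cf 1 n k a = if n = 0 ∧ k = 0 ∧ a = 0 then 1 else 0 := by
  classical
  rw [cf, coeff_one]
  split_ifs with h1 h2 h2
  · rw [coeff_one, if_pos h2.2.1, MvPolynomial.coeff_one, if_pos h2.2.2.symm]
  · rw [coeff_one]
    split_ifs with h3
    · rw [MvPolynomial.coeff_one, if_neg fun h => h2 ⟨h1, h3, h.symm⟩]
    · simp
  · exact absurd h2.1 h1
  · simp

/-- Up to order `K` in `t`, the monomials `z ^ n t ^ k p ^ a` of `f` satisfy `2 k ≥ n + |a| + d`. -/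
def FilUpTo (K : ℕ) (d : ℤ) (f : TZSeries) : Prop :=
  ∀ n k a, k ≤ K → cf f n k a ≠ 0 → (n : ℤ) + a.degree + d ≤ 2 * k

theorem FilUpTo.mono {K : ℕ} {d d' : ℤ} {f : TZSeries} (h : FilUpTo K d f) (hd : d' ≤ d) :
    FilUpTo K d' f := fun n k a hk h0 => by have := h n k a hk h0; omega

theorem FilUpTo.add {K : ℕ} {d : ℤ} {f g : TZSeries} (hf : FilUpTo K d f) (hg : FilUpTo K d g) :
    FilUpTo K d (f + g) := by
  intro n k a hk h
  rw [cf_add] at h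
  by_cases h1 : cf f n k a = 0
  · rw [h1, zero_add] at h
    exact hg n k a hk h
  · exact hf n k a hk h1

theorem filUpTo_zero (K : ℕ) (d : ℤ) : FilUpTo K d 0 := by
  intro n k a _ h
  simp [cf] at h

theorem FilUpTo.smul {K : ℕ} {d : ℤ} {f : TZSeries} (hf : FilUpTo K d f) (c : ℂ) :
    FilUpTo K d (c • f) := by
  intro n k a hk h
  rw [cf_smul] at h
  exact hf n k a hk (right_ne_zero_of_mul h)

theorem FilUpTo.sum {K : ℕ} {d : ℤ} {κ : Type*} (s : Finset κ) {f : κ → TZSeries}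
    (hf : ∀ i ∈ s, FilUpTo K d (f i)) : FilUpTo K d (∑ i ∈ s, f i) := by
  classical
  induction s using Finset.induction_on with
  | empty => simpa using filUpTo_zero K d
  | insert i s hi ih =>
    rw [Finset.sum_insert hi]
    exact (hf i (Finset.mem_insert_self i s)).add
      (ih fun j hj => hf j (Finset.mem_insert_of_mem hj))

theorem FilUpTo.list_sum {K : ℕ} {d : ℤ} (l : List TZSeries) (hf : ∀ f ∈ l, FilUpTo K d f) :
    FilUpTo K d l.sum := by
  induction l with
  | nil => exact filUpTo_zero K d
  | cons f l ih =>
    rw [List.sum_cons]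
    exact (hf f List.mem_cons_self).add (ih fun g hg => hf g (List.mem_cons_of_mem _ hg))

theorem FilUpTo.mul {K : ℕ} {d e : ℤ} {f g : TZSeries} (hf : FilUpTo K d f)
    (hg : FilUpTo K e g) : FilUpTo K (d + e) (f * g) := by
  intro n k a hk h
  rw [cf_mul] at h
  obtain ⟨x, hx, h⟩ := Finset.exists_ne_zero_of_sum_ne_zero h
  obtain ⟨c, hc, h⟩ := Finset.exists_ne_zero_of_sum_ne_zero h
  obtain ⟨y, hy, h⟩ := Finset.exists_ne_zero_of_sum_ne_zero h
  rw [Finset.HasAntidiagonal.mem_antidiagonal] at hx hc hy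
  have h1 := hf _ _ _ (by omega) (left_ne_zero_of_mul h)
  have h2 := hg _ _ _ (by omega) (right_ne_zero_of_mul h)
  have h3 : a.degree = c.1.degree + c.2.degree := by rw [← hc, map_add]
  omega

theorem FilUpTo.derivP {K : ℕ} {d : ℤ} {f : TZSeries} (hf : FilUpTo K d f) (i : ℕ+) :
    FilUpTo K (d + 1) (derivP i f) := by
  intro n k a hk h
  rw [cf_derivP] at h
  have := hf _ _ _ hk (left_ne_zero_of_mul h)
  rw [map_add, Finsupp.degree_single] at this
  push_cast at this
  omega

theorem filUpTo_varP (K : ℕ) (i : ℕ+) : FilUpTo K (-1) (varP i) := by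
  intro n k a _ h
  rw [cf_varP] at h
  obtain ⟨rfl, rfl, rfl⟩ := (ite_ne_right_iff.1 h).1
  simp

theorem filUpTo_one (K : ℕ) : FilUpTo K 0 1 := by
  intro n k a _ h
  rw [cf_one] at h
  obtain ⟨rfl, rfl, rfl⟩ := (ite_ne_right_iff.1 h).1
  simp

theorem filUpTo_prod_varP (K : ℕ) (l : List ℕ+) :
    FilUpTo K (-(l.length : ℤ)) (l.map varP).prod := by
  induction l with
  | nil => simpa using filUpTo_one K
  | cons i l ih =>
    rw [List.map_cons, List.prod_cons]
    refine ((filUpTo_varP K i).mul ih).mono ?_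
    rw [List.length_cons]; push_cast; omega

/-- T has weight −2 and a derivative in p_i raises the weight by 1, so each factor ∂T costs 1. The
other summand, where the derivative falls on earlier factors, has strictly higher weight than is
needed. -/
theorem filUpTo_logDeriv {K : ℕ} {T : TZSeries} (hT : FilUpTo K (-2) T) (l : List ℕ+) :
    FilUpTo K (-(l.length : ℤ)) (logDeriv T l) := by
  induction l with
  | nil => simpa [logDeriv] using filUpTo_one K
  | cons i l ih =>
    rw [logDeriv]
    refine FilUpTo.add ((ih.derivP i).mono ?_) (((hT.derivP i).mul ih).mono ?_) <;>
    · rw [List.length_cons]; push_cast; omega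

theorem PTerm.filUpTo_logApply {K : ℕ} {T : TZSeries} (hT : FilUpTo K (-2) T) (s : PTerm) :
    FilUpTo K (-(s.mul.length + s.der.length : ℤ)) (s.logApply T) := by
  refine FilUpTo.smul (((filUpTo_prod_varP K s.mul).mul (filUpTo_logDeriv hT s.der)).mono ?_) _
  omega

/-- The value 4 yields weight −4, which is the weight −2 of T lowered by the 2 that a derivative in
t costs. -/
theorem length_W3Terms {i j k : ℕ+} {s : PTerm} (hs : s ∈ W3Terms i j k) :
    s.mul.length + s.der.length ≤ 4 := by
  simp only [W3Terms, List.mem_cons, List.not_mem_nil, or_false] at hs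
  rcases hs with rfl | rfl | rfl | rfl | rfl | rfl <;> simp

theorem cf_derivT_transSeries (N : ℕ+) (n k : ℕ) (a : ℕ+ →₀ ℕ) (hn : n ≤ N) :
    cf ((3 : ℂ) • derivT transSeries) n k a = cf (∑ i ∈ Finset.Icc 1 N, ∑ j ∈ Finset.Icc 1 N,
      ∑ l ∈ Finset.Icc 1 N, ((W3Terms i j l).map (fun s => s.logApply transSeries)).sum) n k a := by
  have h := X_pow_dvd_iff.1 (X_pow_dvd_transSeries N) n (by omega)
  rw [map_sub, sub_eq_zero] at h
  rw [cf, h, cf]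

theorem typeMonomial_eq_monomial {V : Type} [Fintype V] [DecidableEq V] (σ : Equiv.Perm V) :
    typeMonomial σ =
      MvPolynomial.monomial (Multiset.toFinsupp (σ.partition.parts.map Nat.toPNat')) 1 := by
  rw [typeMonomial]
  generalize σ.partition.parts = s
  induction s using Multiset.induction with
  | empty => simp
  | cons a s ih =>
    rw [Multiset.map_cons, Multiset.prod_cons, ih, Multiset.map_cons, ← Multiset.singleton_add,
      map_add, Multiset.toFinsupp_singleton, MvPolynomial.X, MvPolynomial.monomial_mul, one_mul]

/-- The initial value in t: the empty word is transitive only on one point, so T = z p₁ at t = 0. -/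
theorem transWords_zero (V : Type) [Fintype V] [DecidableEq V] :
    transWords V 0 = if Fintype.card V = 1 then MvPolynomial.X 1 else 0 := by
  classical
  have hw : transWords V 0 = if IsTransitive ([] : List (ThreeCycle V)) then
      typeMonomial (1 : Equiv.Perm V) else 0 := rfl
  rw [hw]
  have : IsTransitive ([] : List (ThreeCycle V)) ↔ Fintype.card V = 1 := by
    constructor
    · rintro ⟨⟨v⟩, h⟩
      rw [Fintype.card_eq_one_iff]
      refine ⟨v, fun w => ?_⟩
      have := h {v} (by simp [Preserves]) ⟨v, rfl⟩
      exact (this ▸ Set.mem_univ w : w ∈ ({v} : Set V))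
    · intro h
      obtain ⟨v, hv⟩ := Fintype.card_eq_one_iff.1 h
      exact ⟨⟨v⟩, fun U _ ⟨u, hu⟩ => Set.eq_univ_of_forall fun w => by rwa [hv w, ← hv u]⟩
  rw [if_congr this rfl rfl]
  split_ifs with h
  · simp [typeMonomial, parts_partition_eq, h]; rfl
  · rfl

theorem cf_transSeries (n k : ℕ) (a : ℕ+ →₀ ℕ) : cf transSeries n k a =
    ((n.factorial * k.factorial : ℂ)⁻¹) * MvPolynomial.coeff a (transWords (Fin n) k) := by
  rw [cf, transSeries, coeff_coeff_egf, MvPolynomial.coeff_smul, smul_eq_mul]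

theorem cf_transSeries_zero (n : ℕ) (a : ℕ+ →₀ ℕ) : cf transSeries n 0 a =
    if n = 1 ∧ a = Finsupp.single 1 1 then 1 else 0 := by
  classical
  rw [cf_transSeries, transWords_zero, Fintype.card_fin]
  by_cases h : n = 1
  · subst h
    simp [MvPolynomial.coeff_X, eq_comm]
  · simp [h]

/-- The Riemann–Hurwitz bound for transitive words. -/
theorem filUpTo_transSeries (K : ℕ) : FilUpTo K (-2) transSeries := by
  induction K with
  | zero =>
    intro n k a hk h
    obtain rfl : k = 0 := by omega
    rw [cf_transSeries_zero] at h
    obtain ⟨rfl, rfl⟩ := (ite_ne_right_iff.1 h).1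
    simp
  | succ K ih =>
    intro n k a hk h
    rcases Nat.lt_or_ge k (K + 1) with h1 | h1
    · exact ih n k a (by omega) h
    · obtain rfl : k = K + 1 := by omega
      -- The coefficient of t^(K+1) in T is, up to the factor 3(K+1), that of t^K on the right side,
      -- which involves T only up to order K. Passing from K to K+1 raises 2k by 2 and turns −4 into
      -- −2.
      have h2 : FilUpTo K (-4) (∑ i ∈ Finset.Icc 1 n.succPNat, ∑ j ∈ Finset.Icc 1 n.succPNat,
          ∑ l ∈ Finset.Icc 1 n.succPNat,
            ((W3Terms i j l).map (fun s => s.logApply transSeries)).sum) := by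
        refine FilUpTo.sum _ fun i _ => FilUpTo.sum _ fun j _ => FilUpTo.sum _ fun l _ =>
          FilUpTo.list_sum _ fun f hf => ?_
        obtain ⟨s, hs, rfl⟩ := List.mem_map.1 hf
        refine (s.filUpTo_logApply ih).mono ?_
        have := length_W3Terms hs
        omega
      have h3 := h2 n K a le_rfl (by
        rw [← cf_derivT_transSeries _ _ _ _ (by simp), cf_smul, cf_derivT]
        exact mul_ne_zero three_ne_zero (mul_ne_zero (Nat.cast_ne_zero.2 K.succ_ne_zero) h))
      push_cast
      omega

/-- The monomials `z ^ n t ^ k p ^ a` of `f` satisfy `2 k ≥ n + |a| + d`. -/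
def Fil (d : ℤ) (f : TZSeries) : Prop := ∀ K, FilUpTo K d f

/-- The total degree in `z` and `p`. -/
def totalDeg (m : Option ℕ+ →₀ ℕ) : ℤ := (m none : ℤ) + m.some.degree

theorem totalDeg_add (m m' : Option ℕ+ →₀ ℕ) :
    totalDeg (m + m') = totalDeg m + totalDeg m' := by
  simp only [totalDeg, Finsupp.some_add, map_add, Finsupp.add_apply]
  push_cast; ring

/-- The part of `f` formed by the monomials `z ^ n t ^ k p ^ a` with `2 k = n + |a| + d`, at
`t = 1`. -/
def symbol (d : ℤ) (f : TZSeries) : Series := fun m =>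
  if 2 * (((totalDeg m + d) / 2).toNat : ℤ) = totalDeg m + d then
    cf f (m none) ((totalDeg m + d) / 2).toNat m.some else 0

theorem coeff_symbol_of_eq {d : ℤ} (f : TZSeries) {m : Option ℕ+ →₀ ℕ} {k : ℕ}
    (h : 2 * (k : ℤ) = totalDeg m + d) :
    MvPowerSeries.coeff m (symbol d f) = cf f (m none) k m.some := by
  have : ((totalDeg m + d) / 2).toNat = k := by omega
  change (if _ then _ else _) = _
  rw [this, if_pos h]

theorem coeff_symbol_of_ne {d : ℤ} (f : TZSeries) {m : Option ℕ+ →₀ ℕ}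
    (h : ∀ k : ℕ, 2 * (k : ℤ) ≠ totalDeg m + d) : MvPowerSeries.coeff m (symbol d f) = 0 :=
  if_neg (h _)

theorem symbol_add (d : ℤ) (f g : TZSeries) : symbol d (f + g) = symbol d f + symbol d g := by
  ext m
  rw [map_add]
  by_cases h : ∃ k : ℕ, 2 * (k : ℤ) = totalDeg m + d
  · obtain ⟨k, hk⟩ := h
    rw [coeff_symbol_of_eq _ hk, coeff_symbol_of_eq _ hk, coeff_symbol_of_eq _ hk, cf_add]
  · push Not at h
    rw [coeff_symbol_of_ne _ h, coeff_symbol_of_ne _ h, coeff_symbol_of_ne _ h, add_zero]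

theorem symbol_smul (d : ℤ) (c : ℂ) (f : TZSeries) : symbol d (c • f) = c • symbol d f := by
  ext m
  rw [MvPowerSeries.coeff_smul]
  by_cases h : ∃ k : ℕ, 2 * (k : ℤ) = totalDeg m + d
  · obtain ⟨k, hk⟩ := h
    rw [coeff_symbol_of_eq _ hk, coeff_symbol_of_eq _ hk, cf_smul]
  · push Not at h
    rw [coeff_symbol_of_ne _ h, coeff_symbol_of_ne _ h, mul_zero]

/-- `symbol` as a linear map. -/
def symbolHom (d : ℤ) : TZSeries →ₗ[ℂ] Series where
  toFun := symbol d
  map_add' := symbol_add d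
  map_smul' := symbol_smul d

/-- The monomials selected by the symbol violate the stronger inequality. -/
theorem symbol_eq_zero {d e : ℤ} {f : TZSeries} (hf : Fil e f) (h : d < e) : symbol d f = 0 := by
  ext m
  rw [map_zero]
  by_cases h : ∃ k : ℕ, 2 * (k : ℤ) = totalDeg m + d
  · obtain ⟨k, hk⟩ := h
    rw [coeff_symbol_of_eq _ hk]
    by_contra h0
    have := hf k _ _ _ le_rfl h0
    rw [totalDeg] at hk
    omega
  · push Not at h
    exact coeff_symbol_of_ne _ h

theorem sum_antidiagonal_option {M : Type*} [AddCommMonoid M] (m : Option ℕ+ →₀ ℕ)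
    (F : (Option ℕ+ →₀ ℕ) → (Option ℕ+ →₀ ℕ) → M) :
    ∑ x ∈ Finset.HasAntidiagonal.antidiagonal m, F x.1 x.2 =
      ∑ n ∈ Finset.HasAntidiagonal.antidiagonal (m none),
        ∑ a ∈ Finset.HasAntidiagonal.antidiagonal m.some,
          F (a.1.optionElim n.1) (a.2.optionElim n.2) := by
  rw [← Finset.sum_product']
  refine Finset.sum_bij' (fun x _ => ((x.1 none, x.2 none), (x.1.some, x.2.some)))
    (fun y _ => (y.2.1.optionElim y.1.1, y.2.2.optionElim y.1.2)) ?_ ?_ ?_ ?_ ?_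
  · rintro ⟨x, y⟩ h
    rw [Finset.HasAntidiagonal.mem_antidiagonal] at h
    subst h
    simp [Finsupp.some_add]
  · rintro ⟨⟨n, n'⟩, ⟨a, a'⟩⟩ h
    simp only [Finset.mem_product, Finset.HasAntidiagonal.mem_antidiagonal] at h ⊢
    ext i
    rcases i with _ | i
    · simpa using h.1
    · simpa using DFunLike.congr_fun h.2 i
  · rintro ⟨x, y⟩ _; simp
  · rintro ⟨⟨n, n'⟩, ⟨a, a'⟩⟩ _; simp
  · rintro ⟨x, y⟩ _; simp

/-- The two inequalities of the factors add up to that of the product. Equality for the product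
forces equality for both, so exactly one distribution of the exponent of t contributes to each pair
of monomials. -/
theorem symbol_mul {d e : ℤ} {f g : TZSeries} (hf : Fil d f) (hg : Fil e g) :
    symbol (d + e) (f * g) = symbol d f * symbol e g := by
  classical
  ext m
  rw [MvPowerSeries.coeff_mul]
  by_cases h : ∃ k : ℕ, 2 * (k : ℤ) = totalDeg m + (d + e)
  · obtain ⟨k, hk⟩ := h
    rw [coeff_symbol_of_eq _ hk, cf_mul, sum_antidiagonal_option m fun x y =>
      MvPowerSeries.coeff x (symbol d f) * MvPowerSeries.coeff y (symbol e g)]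
    refine Finset.sum_congr rfl fun n hn => Finset.sum_congr rfl fun a ha => ?_
    rw [Finset.HasAntidiagonal.mem_antidiagonal] at hn ha
    have hdeg : (m.some.degree : ℤ) = a.1.degree + a.2.degree := by rw [← ha, map_add]; push_cast; rfl
    have t1 : totalDeg (a.1.optionElim n.1) = n.1 + a.1.degree := by simp [totalDeg]
    have t2 : totalDeg (a.2.optionElim n.2) = n.2 + a.2.degree := by simp [totalDeg]
    rw [totalDeg] at hk
    have key : ∀ y ∈ Finset.HasAntidiagonal.antidiagonal k,
        cf f n.1 y.1 a.1 * cf g n.2 y.2 a.2 ≠ 0 →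
        2 * (y.1 : ℤ) = totalDeg (a.1.optionElim n.1) + d ∧
        2 * (y.2 : ℤ) = totalDeg (a.2.optionElim n.2) + e := by
      intro y hy h0
      rw [Finset.HasAntidiagonal.mem_antidiagonal] at hy
      have h1 := hf _ _ _ _ le_rfl (left_ne_zero_of_mul h0)
      have h2 := hg _ _ _ _ le_rfl (right_ne_zero_of_mul h0)
      omega
    by_cases h1 : ∃ k₁ : ℕ, 2 * (k₁ : ℤ) = totalDeg (a.1.optionElim n.1) + d
    · obtain ⟨k₁, h1⟩ := h1
      by_cases h2 : ∃ k₂ : ℕ, 2 * (k₂ : ℤ) = totalDeg (a.2.optionElim n.2) + e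
      · obtain ⟨k₂, h2⟩ := h2
        rw [coeff_symbol_of_eq _ h1, coeff_symbol_of_eq _ h2, Finset.sum_eq_single (k₁, k₂)]
        · simp
        · intro y hy hne
          by_contra h0
          have := key y hy h0
          exact hne (Prod.ext (by omega) (by omega))
        · intro hy
          exact absurd (Finset.HasAntidiagonal.mem_antidiagonal.2 (by dsimp only; omega)) hy
      · rw [Finset.sum_eq_zero]
        · push Not at h2
          rw [coeff_symbol_of_ne _ h2, mul_zero]
        · intro y hy
          by_contra h0
          exact h2 ⟨_, (key y hy h0).2⟩
    · rw [Finset.sum_eq_zero]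
      · push Not at h1
        rw [coeff_symbol_of_ne _ h1, zero_mul]
      · intro y hy
        by_contra h0
        exact h1 ⟨_, (key y hy h0).1⟩
  · rw [Finset.sum_eq_zero]
    · push Not at h
      exact coeff_symbol_of_ne _ h
    · intro x hx
      rw [Finset.HasAntidiagonal.mem_antidiagonal] at hx
      by_contra h0
      have h1 : ∃ k₁ : ℕ, 2 * (k₁ : ℤ) = totalDeg x.1 + d := by
        by_contra h1
        push Not at h1
        exact left_ne_zero_of_mul h0 (coeff_symbol_of_ne _ h1)
      have h2 : ∃ k₂ : ℕ, 2 * (k₂ : ℤ) = totalDeg x.2 + e := by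
        by_contra h2
        push Not at h2
        exact right_ne_zero_of_mul h0 (coeff_symbol_of_ne _ h2)
      obtain ⟨k₁, h1⟩ := h1
      obtain ⟨k₂, h2⟩ := h2
      refine h ⟨k₁ + k₂, ?_⟩
      rw [← hx, totalDeg_add]
      push_cast; omega

theorem symbol_one : symbol 0 1 = 1 := by
  classical
  ext m
  rw [MvPowerSeries.coeff_one]
  by_cases h : ∃ k : ℕ, 2 * (k : ℤ) = totalDeg m + 0
  · obtain ⟨k, hk⟩ := h
    rw [coeff_symbol_of_eq _ hk, cf_one]
    refine if_congr ⟨?_, ?_⟩ rfl rfl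
    · rintro ⟨h1, _, h3⟩
      rw [← m.optionElim_some, h1, h3]
      ext i; rcases i with _ | i <;> simp
    · rintro rfl
      simp [totalDeg] at hk ⊢
      exact hk
  · push Not at h
    rw [coeff_symbol_of_ne _ h, if_neg]
    rintro rfl
    exact h 0 (by simp [totalDeg])

theorem symbol_varP (i : ℕ+) : symbol (-1) (varP i) = p i := by
  classical
  ext m
  rw [p, MvPowerSeries.coeff_X]
  have hs : m = Finsupp.single (some i) 1 ↔ m none = 0 ∧ m.some = Finsupp.single i 1 := by
    constructor
    · rintro rfl; simp
    · rintro ⟨h1, h3⟩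
      rw [← m.optionElim_some, h1, h3]
      ext j; rcases j with _ | j <;> simp [Finsupp.single_apply]
  by_cases h : ∃ k : ℕ, 2 * (k : ℤ) = totalDeg m + -1
  · obtain ⟨k, hk⟩ := h
    rw [coeff_symbol_of_eq _ hk, cf_varP]
    refine if_congr ⟨fun ⟨h1, _, h3⟩ => hs.2 ⟨h1, h3⟩, fun h => ?_⟩ rfl rfl
    rw [hs] at h
    rw [totalDeg, h.1, h.2, Finsupp.degree_single] at hk
    exact ⟨h.1, by push_cast at hk; omega, h.2⟩
  · push Not at h
    rw [coeff_symbol_of_ne _ h, if_neg]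
    intro h'
    rw [hs] at h'
    exact h 0 (by rw [totalDeg, h'.1, h'.2, Finsupp.degree_single]; simp)

theorem symbol_derivP (d : ℤ) (i : ℕ+) (f : TZSeries) :
    symbol (d + 1) (derivP i f) = dp i (symbol d f) := by
  ext m
  rw [dp, MvPowerSeries.coeff_pderiv]
  have ht : totalDeg (m + Finsupp.single (some i) 1) = totalDeg m + 1 := by
    rw [totalDeg_add]; simp [totalDeg]
  by_cases h : ∃ k : ℕ, 2 * (k : ℤ) = totalDeg m + (d + 1)
  · obtain ⟨k, hk⟩ := h
    rw [coeff_symbol_of_eq _ hk, coeff_symbol_of_eq (k := k) _ (by rw [ht]; omega), cf_derivP]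
    simp [Finsupp.some_add]
  · push Not at h
    rw [coeff_symbol_of_ne _ h, coeff_symbol_of_ne, zero_mul]
    intro k hk
    rw [ht] at hk
    exact h k (by omega)

/-- On the monomials of the symbol the exponent k equals half of the total degree plus d, so ∂/∂t
multiplies by that number. This is the source of the Euler operator and of the factor 1/2 in the
theorem. -/
theorem coeff_symbol_derivT (d : ℤ) (f : TZSeries) (m : Option ℕ+ →₀ ℕ) :
    MvPowerSeries.coeff m (symbol (d - 2) (derivT f)) =
      ((totalDeg m + d : ℤ) / 2 : ℂ) * MvPowerSeries.coeff m (symbol d f) := by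
  by_cases h : ∃ k : ℕ, 2 * (k : ℤ) = totalDeg m + d
  · obtain ⟨k, hk⟩ := h
    rw [coeff_symbol_of_eq f hk, ← hk]
    -- For k = 0 the factor is zero, and on the left the exponent of t would have to be −1.
    rcases k with _ | k
    · rw [coeff_symbol_of_ne]
      · simp
      · intro k' hk'; push_cast at hk; omega
    · rw [coeff_symbol_of_eq (k := k) _ (by push_cast at hk; omega), cf_derivT]
      push_cast; ring
  · push Not at h
    rw [coeff_symbol_of_ne f h, mul_zero, coeff_symbol_of_ne]
    intro k hk
    exact h (k + 1) (by push_cast; omega)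

/-! ## The genus zero equation -/

/-- The genus zero part of the generating function of transitive words. -/
def genusZero : Series := symbol (-2) transSeries

theorem fil_transSeries : Fil (-2) transSeries := filUpTo_transSeries

theorem symbol_prod_varP (l : List ℕ+) :
    symbol (-(l.length : ℤ)) (l.map varP).prod = (l.map p).prod := by
  induction l with
  | nil => simpa using symbol_one
  | cons i l ih =>
    rw [List.map_cons, List.prod_cons, List.map_cons, List.prod_cons, ← ih, ← symbol_varP,
      ← symbol_mul (fun K => filUpTo_varP K i) fun K => filUpTo_prod_varP K l]
    congr 1
    rw [List.length_cons]; push_cast; omega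

/-- This is where higher derivatives turn into products of first derivatives. In ∂L + ∂T·L the first
summand has weight too high to be seen by the symbol, and the symbol of the second is the product of
symbols. -/
theorem symbol_logDeriv (l : List ℕ+) : symbol (-(l.length : ℤ)) (logDeriv transSeries l) =
    (l.map fun k => dp k genusZero).prod := by
  induction l with
  | nil => simpa [logDeriv] using symbol_one
  | cons i l ih =>
    have h1 : Fil (-(l.length : ℤ)) (logDeriv transSeries l) := fun K =>
      filUpTo_logDeriv (fil_transSeries K) l
    have h2 : -(((i :: l).length : ℕ) : ℤ) = (-2 + 1) + -(l.length : ℤ) := by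
      rw [List.length_cons]; push_cast; omega
    rw [logDeriv, symbol_add, symbol_eq_zero (fun K => (h1 K).derivP i)
      (by rw [List.length_cons]; push_cast; omega), zero_add, h2,
      symbol_mul (fun K => (fil_transSeries K).derivP i) h1, ih, symbol_derivP, List.map_cons,
      List.prod_cons]
    rfl

theorem PTerm.symbol_logApply (s : PTerm) :
    symbol (-(s.mul.length + s.der.length : ℤ)) (s.logApply transSeries) =
      s.applyTilde genusZero := by
  rw [PTerm.logApply, PTerm.applyTilde, symbol_smul, ← symbol_logDeriv, ← symbol_prod_varP,
    ← symbol_mul (fun K => filUpTo_prod_varP K _) fun K => filUpTo_logDeriv (fil_transSeries K) _,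
    neg_add]

/-- The first five of the six terms of `3 W([3])`. -/
def W3MainTerms (i j k : ℕ+) : List PTerm :=
  [⟨(i : ℂ) * j * k, [i + j + k], [i, j, k]⟩,
   ⟨(i : ℂ) * (j + k), [i + k, j], [i, j + k]⟩,
   ⟨(j : ℂ) * (i + k), [i + j, k], [j, i + k]⟩,
   ⟨(k : ℂ) * (i + j), [k + j, i], [k, i + j]⟩,
   ⟨(i : ℂ) + j + k, [i, j, k], [i + j + k]⟩]

theorem W3Terms_eq (i j k : ℕ+) : W3Terms i j k =
    W3MainTerms i j k ++ [⟨(i : ℂ) + j + k, [i + j + k], [i + j + k]⟩] := rfl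

/-- The first five terms have exactly four variables and derivatives, hence weight −4. The sixth has
two, hence weight −2, and leaves no trace. -/
theorem symbol_W3Terms (i j k : ℕ+) :
    symbol (-4) ((W3Terms i j k).map (fun s => s.logApply transSeries)).sum =
      ((W3MainTerms i j k).map (fun s => s.applyTilde genusZero)).sum := by
  have h1 : ∀ s ∈ W3MainTerms i j k, symbol (-4) (s.logApply transSeries) =
      s.applyTilde genusZero := by
    intro s hs
    rw [← s.symbol_logApply]
    congr 1
    simp only [W3MainTerms, List.mem_cons, List.not_mem_nil, or_false] at hs
    rcases hs with rfl | rfl | rfl | rfl | rfl <;> simp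
  rw [W3Terms_eq, List.map_append, List.sum_append, symbol_add]
  have h2 : symbol (-4) ([(⟨(i : ℂ) + j + k, [i + j + k], [i + j + k]⟩ : PTerm)].map
      (fun s => s.logApply transSeries)).sum = 0 := by
    rw [List.map_singleton, List.sum_singleton]
    exact symbol_eq_zero (fun K => PTerm.filUpTo_logApply (fil_transSeries K) _) (by simp)
  rw [h2, add_zero, ← show symbolHom (-4) _ = symbol (-4) _ from rfl, map_list_sum, List.map_map]
  exact congrArg _ (List.map_congr_left h1)

/-- The genus zero cut-and-join equation, coefficientwise. -/
theorem coeff_genusZero_eq (N : ℕ+) (m : Option ℕ+ →₀ ℕ) (hm : m none ≤ N) :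
    3 * (((totalDeg m - 2 : ℤ) / 2 : ℂ) * MvPowerSeries.coeff m genusZero) =
      MvPowerSeries.coeff m (∑ i ∈ Finset.Icc 1 N, ∑ j ∈ Finset.Icc 1 N,
        ∑ k ∈ Finset.Icc 1 N, ((W3MainTerms i j k).map (fun s => s.applyTilde genusZero)).sum) := by
  have h1 : MvPowerSeries.coeff m (symbol (-4) ((3 : ℂ) • derivT transSeries)) =
      MvPowerSeries.coeff m (symbol (-4) (∑ i ∈ Finset.Icc 1 N, ∑ j ∈ Finset.Icc 1 N,
      ∑ l ∈ Finset.Icc 1 N, ((W3Terms i j l).map (fun s => s.logApply transSeries)).sum)) := by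
    by_cases h : ∃ k : ℕ, 2 * (k : ℤ) = totalDeg m + -4
    · obtain ⟨k, hk⟩ := h
      rw [coeff_symbol_of_eq _ hk, coeff_symbol_of_eq _ hk, cf_derivT_transSeries N _ _ _ hm]
    · push Not at h
      rw [coeff_symbol_of_ne _ h, coeff_symbol_of_ne _ h]
  have h2 := coeff_symbol_derivT (-2) transSeries m
  rw [symbol_smul, MvPowerSeries.coeff_smul, show (-4 : ℤ) = -2 - 2 by norm_num, h2] at h1
  rw [genusZero, sub_eq_add_neg, h1]
  congr 1
  rw [← show symbolHom (-2 - 2) _ = symbol (-2 - 2) _ from rfl]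
  simp only [map_sum]
  exact Finset.sum_congr rfl fun i _ => Finset.sum_congr rfl fun j _ =>
    Finset.sum_congr rfl fun k _ => symbol_W3Terms i j k

end

/-! ### Factorization counts as coefficients of the genus zero series -/

section

open Equiv.Perm

/-! ## Counting transitive words -/

/-- The exponent vector of the cycle type of a permutation. -/
def typeExp {V : Type} [Fintype V] [DecidableEq V] (σ : Equiv.Perm V) : ℕ+ →₀ ℕ :=
  Multiset.toFinsupp (σ.partition.parts.map Nat.toPNat')

section Counting

variable {V : Type} [Fintype V] [DecidableEq V]

theorem coeff_transWords (a : ℕ+ →₀ ℕ) (k : ℕ) : MvPolynomial.coeff a (transWords V k) =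
    (Nat.card {δ : Fin k → ThreeCycle V // IsTransitive (List.ofFn δ) ∧
      typeExp (wordProd (List.ofFn δ)) = a} : ℂ) := by
  classical
  rw [Nat.card_eq_fintype_card, Fintype.card_subtype, transWords, wordSum_eq_sum_ofFn,
    MvPolynomial.coeff_sum, Finset.natCast_card_filter]
  refine Finset.sum_congr rfl fun δ _ => ?_
  split_ifs with h1 h2 h2
  · rw [typeMonomial_eq_monomial, ← typeExp, MvPolynomial.coeff_monomial, if_pos h2.2]
  · rw [typeMonomial_eq_monomial, ← typeExp, MvPolynomial.coeff_monomial, if_neg fun h => h2 ⟨h1, h⟩]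
  · exact absurd h2.1 h1
  · rw [MvPolynomial.coeff_zero]

theorem coeff_transWords_ne_zero_iff (a : ℕ+ →₀ ℕ) (k : ℕ) :
    MvPolynomial.coeff a (transWords V k) ≠ 0 ↔ ∃ δ : Fin k → ThreeCycle V,
      IsTransitive (List.ofFn δ) ∧ typeExp (wordProd (List.ofFn δ)) = a := by
  rw [coeff_transWords, Nat.cast_ne_zero, Nat.card_ne_zero]
  exact ⟨fun h => nonempty_subtype.1 h.1, fun h => ⟨nonempty_subtype.2 h, inferInstance⟩⟩

theorem sign_wordProd (w : List (ThreeCycle V)) : sign (wordProd w) = 1 := by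
  induction w with
  | nil => simp [wordProd]
  | cons δ w ih =>
    rw [show wordProd (δ :: w) = δ.1 * wordProd w by simp [wordProd], Equiv.Perm.sign_mul, ih, δ.2.sign,
      one_mul]

/-- The sign gives the parity of the sum plus the number of the nontrivial cycle lengths, and every
fixed point contributes 2 to n + ℓ. As 3-cycles are even, this is the parity condition for a
factorization. -/
theorem even_card_add_card_parts {σ : Equiv.Perm V} (h : sign σ = 1) :
    Even (Fintype.card V + σ.partition.parts.card) := by
  rw [sign_of_cycleType] at h
  have h1 : Even (σ.cycleType.sum + σ.cycleType.card) := by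
    by_contra h0
    rw [Nat.not_even_iff_odd] at h0
    rw [h0.neg_one_pow] at h
    exact absurd h (by decide)
  have h2 := sum_cycleType_le_card σ
  rw [parts_partition_eq, Multiset.card_add, Multiset.card_replicate]
  rw [Nat.even_iff] at h1 ⊢
  omega

theorem degree_toFinsupp {κ : Type*} [DecidableEq κ] (s : Multiset κ) :
    (Multiset.toFinsupp s).degree = s.card := by
  induction s using Multiset.induction with
  | empty => simp
  | cons a s ih =>
    rw [← Multiset.singleton_add, map_add, map_add, Multiset.toFinsupp_singleton,
      Finsupp.degree_single, ih, Multiset.card_add, Multiset.card_singleton]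

theorem map_coe_map_toPNat' {s : Multiset ℕ} (hs : ∀ i ∈ s, 0 < i) :
    (s.map Nat.toPNat').map PNat.val = s := by
  rw [Multiset.map_map]
  refine (Multiset.map_congr rfl fun i hi => ?_).trans (Multiset.map_id s)
  simp [Nat.toPNat'_coe, hs i hi]

theorem sum_map_coe_typeExp (σ : Equiv.Perm V) :
    ((Finsupp.toMultiset (typeExp σ)).map PNat.val).sum = Fintype.card V := by
  rw [typeExp, Multiset.toFinsupp_toMultiset, map_coe_map_toPNat' fun i => σ.partition.parts_pos,
    σ.partition.parts_sum]

end Counting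

/-! ## Exponent vectors of multisets -/

/-- The exponent vector of the monomial `z ^ |s| p_s`. -/
def zpExp (s : Multiset ℕ+) : Option ℕ+ →₀ ℕ :=
  Finsupp.single none (s.map PNat.val).sum + Multiset.toFinsupp (s.map some)

theorem zpExp_none (s : Multiset ℕ+) : zpExp s none = (s.map PNat.val).sum := by
  simp [zpExp]

theorem some_zpExp (s : Multiset ℕ+) : (zpExp s).some = Multiset.toFinsupp s := by
  ext i
  simp [zpExp, Multiset.count_map_eq_count' some s (Option.some_injective _)]

theorem totalDeg_zpExp (s : Multiset ℕ+) :
    totalDeg (zpExp s) = (s.map PNat.val).sum + s.card := by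
  rw [totalDeg, zpExp_none, some_zpExp, degree_toFinsupp]

theorem zpExp_cons (a : ℕ+) (s : Multiset ℕ+) :
    zpExp (a ::ₘ s) = zpExp s + Finsupp.single none (a : ℕ) + Finsupp.single (some a) 1 := by
  rw [zpExp, zpExp, Multiset.map_cons, Multiset.map_cons, Multiset.sum_cons,
    ← Multiset.singleton_add (some a), map_add, Multiset.toFinsupp_singleton, Finsupp.single_add]
  abel

theorem zpExp_zero : zpExp 0 = 0 := by simp [zpExp]

theorem zpExp_injective : Function.Injective zpExp := by
  intro s t h
  have := congrArg Finsupp.some h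
  rw [some_zpExp, some_zpExp] at this
  exact Multiset.toFinsupp.injective this

/-! ## Properties of the genus zero series -/

theorem coeff_zpExp_genusZero (s : Multiset ℕ+) {k : ℕ}
    (hk : 2 * (k : ℤ) + 2 = (s.map PNat.val).sum + s.card) :
    MvPowerSeries.coeff (zpExp s) genusZero =
      (((s.map PNat.val).sum.factorial * k.factorial : ℂ)⁻¹) *
        MvPolynomial.coeff (Multiset.toFinsupp s) (transWords (Fin (s.map PNat.val).sum) k) := by
  rw [genusZero, coeff_symbol_of_eq (k := k) _ (by rw [totalDeg_zpExp]; omega), zpExp_none,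
    some_zpExp, cf_transSeries]

/-- A nonzero coefficient comes from an actual word, so the exponents of the p_i form the cycle type
of a permutation of as many points as the exponent of z, and there is at least one point. -/
theorem exists_of_coeff_genusZero_ne_zero {m : Option ℕ+ →₀ ℕ}
    (h : MvPowerSeries.coeff m genusZero ≠ 0) : m = zpExp (Finsupp.toMultiset m.some) ∧
      0 < m none := by
  have hk : ∃ k : ℕ, 2 * (k : ℤ) = totalDeg m + -2 := by
    by_contra hk
    push Not at hk
    exact h (coeff_symbol_of_ne _ hk)
  obtain ⟨k, hk⟩ := hk
  rw [genusZero, coeff_symbol_of_eq _ hk, cf_transSeries] at h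
  obtain ⟨δ, h1, h2⟩ := (coeff_transWords_ne_zero_iff _ _).1 (right_ne_zero_of_mul h)
  have h3 := sum_map_coe_typeExp (wordProd (List.ofFn δ))
  rw [h2, Fintype.card_fin] at h3
  constructor
  · ext i
    rcases i with _ | i
    · rw [zpExp_none, h3]
    · rw [← Finsupp.some_apply, ← Finsupp.some_apply, some_zpExp, Finsupp.toMultiset_toFinsupp]
  · obtain ⟨⟨v⟩, _⟩ := h1
    exact v.pos

/-- Only finitely many variables `p_i` occur with a given power of `z`. -/
theorem X_pow_dvd_dp_genusZero (N : ℕ) (i : ℕ+) (hi : N < i) :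
    (MvPowerSeries.X none : Series) ^ (N + 1) ∣ dp i genusZero := by
  rw [MvPowerSeries.X_pow_dvd_iff]
  intro m hm
  rw [dp, MvPowerSeries.coeff_pderiv]
  by_contra h
  obtain ⟨h1, _⟩ := exists_of_coeff_genusZero_ne_zero (left_ne_zero_of_mul h)
  have h2 := DFunLike.congr_fun h1 none
  rw [zpExp_none] at h2
  -- Before differentiation p_i occurs, so i is one of the parts, whose sum is the exponent of z.
  have h3 : i ∈ Finsupp.toMultiset (m + Finsupp.single (some i) 1).some := by
    rw [Finsupp.mem_toMultiset]; simp [Finsupp.some_add]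
  have h4 := Multiset.le_sum_of_mem (Multiset.mem_map_of_mem PNat.val h3)
  rw [← h2] at h4
  simp at h4
  have : (i : ℕ) ≤ m none := h4
  omega

/-! ### Positivity of the genus zero coefficients -/

section Positivity

open scoped ComplexOrder

/-- All coefficients of `f` are nonnegative. -/
def CoeffNonneg (f : Series) : Prop := ∀ m, 0 ≤ MvPowerSeries.coeff m f

theorem CoeffNonneg.mul {f g : Series} (hf : CoeffNonneg f) (hg : CoeffNonneg g) :
    CoeffNonneg (f * g) := by
  classical
  intro m
  rw [MvPowerSeries.coeff_mul]
  exact Finset.sum_nonneg fun x _ => mul_nonneg (hf _) (hg _)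

theorem CoeffNonneg.mul_pos {f g : Series} (hf : CoeffNonneg f) (hg : CoeffNonneg g)
    {m m' : Option ℕ+ →₀ ℕ} (h : 0 < MvPowerSeries.coeff m f) (h' : 0 < MvPowerSeries.coeff m' g) :
    0 < MvPowerSeries.coeff (m + m') (f * g) := by
  classical
  rw [MvPowerSeries.coeff_mul]
  exact Finset.sum_pos' (fun x _ => mul_nonneg (hf _) (hg _))
    ⟨(m, m'), Finset.HasAntidiagonal.mem_antidiagonal.2 rfl, _root_.mul_pos h h'⟩

theorem coeffNonneg_one : CoeffNonneg 1 := by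
  classical
  intro m
  rw [MvPowerSeries.coeff_one]
  split_ifs <;> simp

theorem coeffNonneg_list_prod (l : List Series) (h : ∀ f ∈ l, CoeffNonneg f) :
    CoeffNonneg l.prod := by
  induction l with
  | nil => exact coeffNonneg_one
  | cons f l ih =>
    rw [List.prod_cons]
    exact (h f List.mem_cons_self).mul (ih fun g hg => h g (List.mem_cons_of_mem _ hg))

theorem coeffNonneg_p (i : ℕ+) : CoeffNonneg (p i) := by
  classical
  intro m
  rw [p, MvPowerSeries.coeff_X]
  split_ifs <;> simp

theorem coeff_p_pos (i : ℕ+) : 0 < MvPowerSeries.coeff (Finsupp.single (some i) 1) (p i) := by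
  rw [p, MvPowerSeries.coeff_index_single_self_X]
  exact one_pos

theorem coeffNonneg_genusZero : CoeffNonneg genusZero := by
  intro m
  by_cases h : ∃ k : ℕ, 2 * (k : ℤ) = totalDeg m + -2
  · obtain ⟨k, hk⟩ := h
    rw [genusZero, coeff_symbol_of_eq _ hk, cf_transSeries, coeff_transWords]
    have : ((m none).factorial * k.factorial : ℂ)⁻¹ =
        (((((m none).factorial * k.factorial : ℕ) : ℝ)⁻¹ : ℝ) : ℂ) := by push_cast; rfl
    rw [this]
    exact mul_nonneg (Complex.zero_le_real.2 (by positivity)) (Nat.cast_nonneg _)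
  · push Not at h
    rw [genusZero, coeff_symbol_of_ne _ h]

theorem coeffNonneg_dp_genusZero (i : ℕ+) : CoeffNonneg (dp i genusZero) := by
  intro m
  rw [dp, MvPowerSeries.coeff_pderiv]
  exact mul_nonneg (coeffNonneg_genusZero _) (by positivity)

/-- The derivative removes the part i from p_s but keeps its share z^i. -/
theorem coeff_dp_genusZero_pos {i : ℕ+} {s : Multiset ℕ+}
    (h : 0 < MvPowerSeries.coeff (zpExp (i ::ₘ s)) genusZero) :
    0 < MvPowerSeries.coeff (zpExp s + Finsupp.single none (i : ℕ)) (dp i genusZero) := by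
  rw [dp, MvPowerSeries.coeff_pderiv, ← zpExp_cons]
  exact _root_.mul_pos h (by positivity)

theorem W3MainTerms_coef_pos {i j k : ℕ+} {s : PTerm} (hs : s ∈ W3MainTerms i j k) :
    0 < s.coef := by
  have hp : ∀ a : ℕ+, (0 : ℂ) < (a : ℂ) := fun a => Nat.cast_pos.2 a.pos
  have := hp i
  have := hp j
  have := hp k
  simp only [W3MainTerms, List.mem_cons, List.not_mem_nil, or_false] at hs
  rcases hs with rfl | rfl | rfl | rfl | rfl <;> dsimp only <;> positivity

theorem coeffNonneg_applyTilde {i j k : ℕ+} {s : PTerm} (hs : s ∈ W3MainTerms i j k) :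
    CoeffNonneg (s.applyTilde genusZero) := by
  intro m
  rw [PTerm.applyTilde, MvPowerSeries.coeff_smul]
  refine mul_nonneg (W3MainTerms_coef_pos hs).le ?_
  refine (coeffNonneg_list_prod _ fun f hf => ?_).mul (coeffNonneg_list_prod _ fun f hf => ?_) m
  · obtain ⟨a, _, rfl⟩ := List.mem_map.1 hf
    exact coeffNonneg_p a
  · obtain ⟨a, _, rfl⟩ := List.mem_map.1 hf
    exact coeffNonneg_dp_genusZero a

/-- A positive contribution to the genus zero equation makes a coefficient positive. -/
theorem coeff_genusZero_pos_of_term {m : Option ℕ+ →₀ ℕ} {i j k : ℕ+} {s : PTerm}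
    (hs : s ∈ W3MainTerms i j k)
    (h : 0 < MvPowerSeries.coeff m ((s.mul.map p).prod * (s.der.map fun k => dp k genusZero).prod)) :
    0 < MvPowerSeries.coeff m genusZero := by
  -- If the coefficient were zero, the left side of the genus zero equation would vanish whatever
  -- the Euler factor is, while the right side is a sum of nonnegative terms, one of them positive.
  refine lt_of_le_of_ne (coeffNonneg_genusZero m) fun h0 => ?_
  -- The cutoff has to cover the three indices as well as the exponent of z.
  let N : ℕ+ := i + j + k + (m none).succPNat
  have hN : m none ≤ N := by
    simp only [N, PNat.add_coe, Nat.succPNat_coe]; omega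
  have h1 := coeff_genusZero_eq N m hN
  rw [← h0, mul_zero, mul_zero] at h1
  have hnn : ∀ i j k, 0 ≤ MvPowerSeries.coeff m
      ((W3MainTerms i j k).map (fun s => s.applyTilde genusZero)).sum := by
    intro i j k
    rw [map_list_sum, List.map_map]
    refine List.sum_nonneg fun c hc => ?_
    obtain ⟨t, ht, rfl⟩ := List.mem_map.1 hc
    exact coeffNonneg_applyTilde ht m
  have hpos : 0 < MvPowerSeries.coeff m
      ((W3MainTerms i j k).map (fun s => s.applyTilde genusZero)).sum := by
    rw [map_list_sum, List.map_map]
    have h2 : 0 < MvPowerSeries.coeff m (s.applyTilde genusZero) := by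
      rw [PTerm.applyTilde, MvPowerSeries.coeff_smul]
      exact _root_.mul_pos (W3MainTerms_coef_pos hs) h
    refine lt_of_lt_of_le h2 (List.single_le_sum ?_ _ (List.mem_map.2 ⟨s, hs, rfl⟩))
    intro c hc
    obtain ⟨t, ht, rfl⟩ := List.mem_map.1 hc
    exact coeffNonneg_applyTilde ht m
  have hb : ∀ a : ℕ+, a ≤ N → a ∈ Finset.Icc 1 N := fun a ha => Finset.mem_Icc.2 ⟨one_le, ha⟩
  have hi : i ∈ Finset.Icc 1 N := hb i (by
    rw [← PNat.coe_le_coe]; simp only [N, PNat.add_coe]; omega)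
  have hj : j ∈ Finset.Icc 1 N := hb j (by
    rw [← PNat.coe_le_coe]; simp only [N, PNat.add_coe]; omega)
  have hk : k ∈ Finset.Icc 1 N := hb k (by
    rw [← PNat.coe_le_coe]; simp only [N, PNat.add_coe]; omega)
  simp only [map_sum] at h1
  refine (ne_of_gt ?_) h1.symm
  exact Finset.sum_pos' (fun i _ => Finset.sum_nonneg fun j _ => Finset.sum_nonneg fun k _ =>
    hnn i j k) ⟨i, hi, Finset.sum_pos' (fun j _ => Finset.sum_nonneg fun k _ => hnn i j k)
      ⟨j, hj, Finset.sum_pos' (fun k _ => hnn i j k) ⟨k, hk, hpos⟩⟩⟩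

theorem coeff_singleton_one_pos : 0 < MvPowerSeries.coeff (zpExp {1}) genusZero := by
  rw [genusZero, coeff_symbol_of_eq (k := 0) _ (by rw [totalDeg_zpExp]; simp), zpExp_none,
    some_zpExp, cf_transSeries_zero, if_pos]
  · exact one_pos
  · simp

/-- Every cycle type allowed by parity has a genus zero transitive factorization into 3-cycles,
except `[1, 1]`. -/
theorem coeff_genusZero_pos (d : ℕ) : ∀ s : Multiset ℕ+, (s.map PNat.val).sum + s.card = d →
    Even d → s ≠ 0 → (s.map PNat.val).sum ≠ 2 →
    0 < MvPowerSeries.coeff (zpExp s) genusZero := by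
  induction d using Nat.strong_induction_on with
  | _ d ih =>
    intro s hd he hs h2
    obtain ⟨i, hi⟩ := Multiset.exists_mem_of_ne_zero hs
    obtain ⟨s, rfl⟩ := Multiset.exists_cons_of_mem hi
    rcases s.empty_or_exists_mem with rfl | ⟨j, hj⟩
    · simp only [Multiset.cons_zero, Multiset.map_singleton, Multiset.sum_singleton,
        Multiset.card_singleton] at hd h2 ⊢
      by_cases h1 : i = 1
      · subst h1; exact coeff_singleton_one_pos
      · have h1' : (i : ℕ) ≠ 1 := fun h => h1 (PNat.coe_eq_one_iff.1 h)
        have hi := i.pos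
        rw [Nat.even_iff] at he
        -- One part, odd and at least 3: it is joined from 1, 1 and i − 2 by the term with three
        -- derivatives, and i − 2 is again odd.
        obtain ⟨k, hk⟩ : ∃ k : ℕ+, i = 1 + 1 + k :=
          ⟨((i : ℕ) - 2).toPNat', PNat.eq (by
            rw [PNat.add_coe, PNat.add_coe, Nat.toPNat'_coe, if_pos (by omega), PNat.one_coe]
            omega)⟩
        have hkpos : 0 < MvPowerSeries.coeff (zpExp {k}) genusZero := by
          have hk' : (i : ℕ) = 1 + 1 + k := by rw [hk]; rfl
          refine ih (k + 1) (by omega) _ (by simp) ?_ (by simp) ?_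
          · rw [Nat.even_iff]; omega
          · simp only [Multiset.map_singleton, Multiset.sum_singleton]
            have : (PNat.val k) = (k : ℕ) := rfl
            omega
        have d1 := coeff_dp_genusZero_pos (i := 1) (s := 0) coeff_singleton_one_pos
        have dk := coeff_dp_genusZero_pos (i := k) (s := 0) hkpos
        refine coeff_genusZero_pos_of_term (i := 1) (j := 1) (k := k)
          (s := ⟨_, [1 + 1 + k], [1, 1, k]⟩) (List.mem_cons_self) ?_
        have hexp : zpExp {i} = Finsupp.single (some (1 + 1 + k)) 1 +
            ((zpExp 0 + Finsupp.single none ((1 : ℕ+) : ℕ)) +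
            ((zpExp 0 + Finsupp.single none ((1 : ℕ+) : ℕ)) +
              (zpExp 0 + Finsupp.single none (k : ℕ)))) := by
          rw [← Multiset.cons_zero, zpExp_cons, hk, PNat.add_coe, PNat.add_coe, Finsupp.single_add,
            Finsupp.single_add, zpExp_zero]
          abel
        rw [hexp]
        simp only [List.map_cons, List.map_nil, List.prod_cons, List.prod_nil, mul_one]
        have n1 := coeffNonneg_dp_genusZero 1
        have nk := coeffNonneg_dp_genusZero k
        exact (coeffNonneg_p _).mul_pos (n1.mul (n1.mul nk)) (coeff_p_pos _)
          (n1.mul_pos (n1.mul nk) d1 (n1.mul_pos nk d1 dk))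
    · obtain ⟨s, rfl⟩ := Multiset.exists_cons_of_mem hj
      rcases s.empty_or_exists_mem with rfl | ⟨k, hk⟩
      -- Two parts, of even sum and not both 1, so one of them, say j, exceeds 1. A mixed term
      -- obtains {i, j} from {1} and {i + j − 1}, the latter being odd.
      · have key : ∀ i j : ℕ+, (i : ℕ) + j + 2 = d → (i : ℕ) + j ≠ 2 → 1 < j →
            0 < MvPowerSeries.coeff (zpExp (i ::ₘ j ::ₘ 0)) genusZero := by
          intro i j hd h2 hj1
          have hi := i.pos
          have hj1' : 1 < (j : ℕ) := PNat.coe_lt_coe 1 j |>.2 hj1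
          rw [Nat.even_iff] at he
          obtain ⟨l, hl⟩ : ∃ l : ℕ+, j = 1 + l :=
            ⟨((j : ℕ) - 1).toPNat', PNat.eq (by
              rw [PNat.add_coe, Nat.toPNat'_coe, if_pos (by omega), PNat.one_coe]
              omega)⟩
          have hl' : (j : ℕ) = 1 + l := by rw [hl]; rfl
          have hpos : 0 < MvPowerSeries.coeff (zpExp {i + l}) genusZero := by
            have hv : PNat.val (i + l) = i + l := rfl
            refine ih (i + l + 1) (by omega) _ (by simp) ?_ (by simp) ?_
            · rw [Nat.even_iff]; omega
            · simp only [Multiset.map_singleton, Multiset.sum_singleton]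
              omega
          have d1 := coeff_dp_genusZero_pos (i := 1) (s := 0) coeff_singleton_one_pos
          have d2 := coeff_dp_genusZero_pos (i := i + l) (s := 0) hpos
          refine coeff_genusZero_pos_of_term (i := i) (j := l) (k := 1)
            (s := ⟨((1 : ℕ+) : ℂ) * (i + l), [1 + l, i], [1, i + l]⟩) ?_ ?_
          · simp [W3MainTerms]
          have hexp : zpExp (i ::ₘ j ::ₘ 0) =
              (Finsupp.single (some (1 + l)) 1 + Finsupp.single (some i) 1) +
              ((zpExp 0 + Finsupp.single none ((1 : ℕ+) : ℕ)) +
                (zpExp 0 + Finsupp.single none ((i + l : ℕ+) : ℕ))) := by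
            rw [zpExp_cons, zpExp_cons, hl, PNat.add_coe, PNat.add_coe, Finsupp.single_add,
              Finsupp.single_add, zpExp_zero]
            abel
          rw [hexp]
          simp only [List.map_cons, List.map_nil, List.prod_cons, List.prod_nil, mul_one]
          have n1 := coeffNonneg_dp_genusZero 1
          have n2 := coeffNonneg_dp_genusZero (i + l)
          have q1 := coeffNonneg_p (1 + l)
          have q2 := coeffNonneg_p i
          exact (q1.mul q2).mul_pos (n1.mul n2) (q1.mul_pos q2 (coeff_p_pos _) (coeff_p_pos _))
            (n1.mul_pos n2 d1 d2)
        simp only [Multiset.map_cons, Multiset.map_zero, Multiset.sum_cons, Multiset.sum_zero,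
          Multiset.card_cons, Multiset.card_zero] at hd h2
        have hvi : PNat.val i = i := rfl
        have hvj : PNat.val j = j := rfl
        by_cases hj1 : 1 < j
        · exact key i j (by omega) (by omega) hj1
        · rw [Multiset.cons_swap]
          refine key j i (by omega) (by omega) ?_
          have : j = 1 := le_antisymm (not_lt.1 hj1) one_le
          subst this
          rw [← PNat.coe_lt_coe]
          have := i.pos
          simp only [PNat.one_coe] at *
          omega
      · obtain ⟨t, rfl⟩ := Multiset.exists_cons_of_mem hk
        simp only [Multiset.map_cons, Multiset.sum_cons, Multiset.card_cons] at hd h2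
        have hv : PNat.val (i + j + k) = PNat.val i + PNat.val j + PNat.val k := rfl
        -- Three or more parts: i, j, k arise by cutting i + j + k. The sum of the parts is
        -- unchanged and their number drops by 2, so parity and the exclusion of sum 2 are
        -- inherited.
        have hpos : 0 < MvPowerSeries.coeff (zpExp ((i + j + k) ::ₘ t)) genusZero := by
          refine ih (d - 2) (by omega) _ ?_ ?_ (Multiset.cons_ne_zero) ?_
          · simp only [Multiset.map_cons, Multiset.sum_cons, Multiset.card_cons]
            omega
          · rw [Nat.even_iff] at he ⊢; omega
          · simp only [Multiset.map_cons, Multiset.sum_cons]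
            omega
        have d1 := coeff_dp_genusZero_pos hpos
        refine coeff_genusZero_pos_of_term (i := i) (j := j) (k := k)
          (s := ⟨(i : ℂ) + j + k, [i, j, k], [i + j + k]⟩) ?_ ?_
        · simp [W3MainTerms]
        have hexp : zpExp (i ::ₘ j ::ₘ k ::ₘ t) =
            (Finsupp.single (some i) 1 + (Finsupp.single (some j) 1 + Finsupp.single (some k) 1)) +
              (zpExp t + Finsupp.single none ((i + j + k : ℕ+) : ℕ)) := by
          rw [zpExp_cons, zpExp_cons, zpExp_cons, PNat.add_coe, PNat.add_coe, Finsupp.single_add,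
            Finsupp.single_add]
          abel
        rw [hexp]
        simp only [List.map_cons, List.map_nil, List.prod_cons, List.prod_nil, mul_one]
        have qi := coeffNonneg_p i
        have qj := coeffNonneg_p j
        have qk := coeffNonneg_p k
        exact (qi.mul (qj.mul qk)).mul_pos (coeffNonneg_dp_genusZero _)
          (qi.mul_pos (qj.mul qk) (coeff_p_pos i) (qj.mul_pos qk (coeff_p_pos j) (coeff_p_pos k))) d1

theorem coeff_genusZero_ne_zero (s : Multiset ℕ+) (he : Even ((s.map PNat.val).sum + s.card))
    (hs : s ≠ 0) (h2 : (s.map PNat.val).sum ≠ 2) :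
    MvPowerSeries.coeff (zpExp s) genusZero ≠ 0 :=
  (coeff_genusZero_pos _ s rfl he hs h2).ne'

end Positivity

end

/-! ### Identification of F₃ and comparison of coefficients -/

section

open Equiv.Perm

/-! ## The series `F3` is the genus zero series -/

/-- An orbit of the generated group is a preserved set, and conversely a set preserved by the
generators is preserved by the whole group, by induction on the closure. -/
theorem isTransitive_ofFn_iff {n k : ℕ} (hn : 0 < n) (δ : Fin k → ThreeCycle (Fin n)) :
    IsTransitive (List.ofFn δ) ↔ MulAction.IsPretransitive
      (Subgroup.closure (Set.range fun i => (δ i).1)) (Fin n) := by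
  constructor
  · rintro ⟨_, h⟩
    refine ⟨fun u v => ?_⟩
    have h1 := h (MulAction.orbit (Subgroup.closure (Set.range fun i => (δ i).1)) u) ?_
      ⟨u, MulAction.mem_orbit_self u⟩
    · have hv : v ∈ MulAction.orbit (Subgroup.closure (Set.range fun i => (δ i).1)) u :=
        h1 ▸ Set.mem_univ v
      exact hv
    · intro τ hτ a
      obtain ⟨i, rfl⟩ := (List.mem_ofFn' δ τ).1 hτ
      let g : Subgroup.closure (Set.range fun i => (δ i).1) :=
        ⟨(δ i).1, Subgroup.subset_closure ⟨i, rfl⟩⟩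
      constructor
      · rintro ⟨x, hx⟩
        exact ⟨g⁻¹ * x, (mul_smul g⁻¹ x u).trans (inv_smul_eq_iff.2 hx)⟩
      · rintro ⟨x, rfl⟩
        exact ⟨g * x, mul_smul g x u⟩
  · intro h
    refine ⟨⟨⟨0, hn⟩⟩, fun U hU ⟨u, hu⟩ => Set.eq_univ_of_forall fun v => ?_⟩
    obtain ⟨⟨g, hg⟩, rfl⟩ := h.exists_smul_eq u v
    have key : ∀ a, g a ∈ U ↔ a ∈ U := by
      induction hg using Subgroup.closure_induction with
      | mem x hx =>
        obtain ⟨i, rfl⟩ := hx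
        exact hU _ ((List.mem_ofFn' δ _).2 ⟨i, rfl⟩)
      | one => intro a; rfl
      | mul x y _ _ hx hy => intro a; rw [coe_mul, Function.comp_apply, hx, hy]
      | inv x _ hx => intro a; rw [← hx, ← Equiv.Perm.mul_apply, mul_inv_cancel, Equiv.Perm.one_apply]
    exact (key u).2 hu

/-- The parts of a partition as positive integers. -/
def pparts {n : ℕ} (α : n.Partition) : Multiset ℕ+ := α.parts.map Nat.toPNat'

theorem map_coe_pparts {n : ℕ} (α : n.Partition) : (pparts α).map PNat.val = α.parts :=
  map_coe_map_toPNat' fun _ => α.parts_pos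

theorem sum_pparts {n : ℕ} (α : n.Partition) : ((pparts α).map PNat.val).sum = n := by
  rw [map_coe_pparts, α.parts_sum]

theorem typeExp_eq_iff {n : ℕ} (σ : Equiv.Perm (Fin n)) (α : n.Partition) :
    typeExp σ = Multiset.toFinsupp (pparts α) ↔ IsOfType σ α := by
  rw [typeExp, Multiset.toFinsupp.injective.eq_iff, IsOfType]
  constructor
  · intro h
    rw [← map_coe_map_toPNat' fun i => σ.partition.parts_pos, h, map_coe_pparts]
  · intro h
    rw [h]; rfl

theorem wordProd_ofFn {n k : ℕ} (δ : Fin k → ThreeCycle (Fin n)) :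
    wordProd (List.ofFn δ) = (List.ofFn fun i => (δ i).1).prod := by
  rw [wordProd, List.map_ofFn]; rfl

/-- In a tuple (δ₁, …, δ_k, σ) the permutation σ is determined by the word, so counting tuples is
counting words. -/
theorem hurwitz3_eq_coeff {n : ℕ} (hn : 0 < n) (k : ℕ) (α : n.Partition) :
    (hurwitz3 k α : ℂ) =
      MvPolynomial.coeff (Multiset.toFinsupp (pparts α)) (transWords (Fin n) k) := by
  rw [coeff_transWords, hurwitz3]
  congr 1
  refine Nat.card_congr
    { toFun := fun t => ⟨fun i => ⟨t.1.1 i, t.2.2.1 i⟩, ?_, ?_⟩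
      invFun := fun δ => ⟨(fun i => (δ.1 i).1, wordProd (List.ofFn δ.1)),
        (typeExp_eq_iff _ _).1 δ.2.2, fun i => (δ.1 i).2, (wordProd_ofFn _).symm,
        (isTransitive_ofFn_iff hn _).1 δ.2.1⟩
      left_inv := ?_
      right_inv := fun _ => rfl }
  · exact (isTransitive_ofFn_iff hn _).2 t.2.2.2.2
  · rw [typeExp_eq_iff, wordProd_ofFn, t.2.2.2.1]
    exact t.2.1
  · rintro ⟨⟨δ, σ⟩, h⟩
    refine Subtype.ext (Prod.ext rfl ?_)
    exact (wordProd_ofFn _).trans h.2.2.1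

theorem exists_transFact_iff {n : ℕ} (k : ℕ) (α : n.Partition) :
    (∃ (δ : Fin k → Equiv.Perm (Fin n)) (σ : Equiv.Perm (Fin n)),
      IsOfType σ α ∧ IsTransFact δ σ) ↔ hurwitz3 k α ≠ 0 := by
  rw [hurwitz3, Nat.card_ne_zero]
  constructor
  · rintro ⟨δ, σ, h⟩
    exact ⟨⟨⟨(δ, σ), h⟩⟩, inferInstance⟩
  · rintro ⟨⟨⟨δ, σ⟩, h⟩, _⟩
    exact ⟨δ, σ, h⟩

/-- The minimal number of factors is the one of genus zero. -/
theorem minHurwitz3_div_eq (n : ℕ) (hn : 0 < n) (α : n.Partition) :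
    (minHurwitz3 α : ℂ) / (n.factorial * (mu3 α).factorial) =
      MvPowerSeries.coeff (zpExp (pparts α)) genusZero := by
  have hset : {k | ∃ (δ : Fin k → Equiv.Perm (Fin n)) (σ : Equiv.Perm (Fin n)),
      IsOfType σ α ∧ IsTransFact δ σ} = {k | hurwitz3 k α ≠ 0} :=
    Set.ext fun k => exists_transFact_iff k α
  have hcoeff : ∀ k : ℕ, 2 * (k : ℤ) + 2 = n + (pparts α).card →
      MvPowerSeries.coeff (zpExp (pparts α)) genusZero =
        ((n.factorial * k.factorial : ℂ)⁻¹) * hurwitz3 k α := by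
    intro k hk
    rw [coeff_zpExp_genusZero (pparts α) (k := k) (by rw [sum_pparts]; exact hk),
      hurwitz3_eq_coeff hn]
    rw [sum_pparts]
  by_cases hex : ∃ k, hurwitz3 k α ≠ 0
  · obtain ⟨k, hk⟩ := hex
    -- The Riemann–Hurwitz bound is the lower bound for μ³(α).
    have hfil : ∀ k, hurwitz3 k α ≠ 0 → (n : ℤ) + (pparts α).card ≤ 2 * k + 2 := by
      intro k hk
      have hk' : cf transSeries n k (Multiset.toFinsupp (pparts α)) ≠ 0 := by
        rw [cf_transSeries, ← hurwitz3_eq_coeff hn]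
        exact mul_ne_zero (inv_ne_zero (mul_ne_zero (Nat.cast_ne_zero.2 n.factorial_ne_zero)
          (Nat.cast_ne_zero.2 k.factorial_ne_zero))) (Nat.cast_ne_zero.2 hk)
      have := fil_transSeries k n k _ le_rfl hk'
      rw [degree_toFinsupp] at this
      omega
    have hk' := hk
    rw [← exists_transFact_iff] at hk'
    obtain ⟨δ, σ, hσ, hδ⟩ := hk'
    have hsign : sign σ = 1 := by
      rw [← hδ.2.1, ← wordProd_ofFn (fun i => (⟨δ i, hδ.1 i⟩ : ThreeCycle (Fin n)))]
      exact sign_wordProd _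
    have heven := even_card_add_card_parts hsign
    rw [hσ, Fintype.card_fin] at heven
    have hcard : (pparts α).card = α.parts.card := Multiset.card_map _ _
    have hpos : 0 < (pparts α).card := by
      rw [Multiset.card_pos]
      intro h
      have := sum_pparts α
      rw [h] at this
      simp at this
      omega
    -- On two points there is no 3-cycle, and the empty word is not transitive.
    have hn2 : n ≠ 2 := by
      rintro rfl
      rcases k with _ | k
      · have h0 : cf transSeries 2 0 (Multiset.toFinsupp (pparts α)) = 0 := by
          rw [cf_transSeries_zero, if_neg (by omega)]
        rw [cf_transSeries, ← hurwitz3_eq_coeff hn] at h0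
        simp [hk] at h0
      · have h3 := (hδ.1 0).card_support
        have := Finset.card_le_univ (δ 0).support
        rw [h3, Fintype.card_fin] at this
        omega
    obtain ⟨r, hr⟩ := heven
    -- Here r ≥ 1 because n and the number of parts are positive, so r − 1 is a true difference. The
    -- number k₀ is the one for which the bound is an equality.
    obtain ⟨k₀, hk₀⟩ : ∃ k₀ : ℕ, 2 * (k₀ : ℤ) + 2 = n + (pparts α).card :=
      ⟨r - 1, by omega⟩
    have hne := coeff_genusZero_ne_zero (pparts α) (by rw [sum_pparts]; exact ⟨r, by omega⟩)
      (Multiset.card_pos.1 hpos) (by rw [sum_pparts]; exact hn2)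
    rw [hcoeff k₀ hk₀] at hne ⊢
    have h0 : hurwitz3 k₀ α ≠ 0 := Nat.cast_ne_zero.1 (right_ne_zero_of_mul hne)
    have hmu : mu3 α = k₀ := by
      rw [mu3, hset]
      refine le_antisymm (Nat.sInf_le h0) (le_csInf ⟨k₀, h0⟩ fun k hk => ?_)
      have := hfil k hk
      omega
    rw [minHurwitz3, hmu, div_eq_inv_mul]
  -- Without factorizations the default value 0 of `mu3` is harmless, because the count vanishes for
  -- every k. The genus zero coefficient vanishes as well, either by this count or by parity.
  · push Not at hex
    rw [minHurwitz3, hex, Nat.cast_zero, zero_div]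
    by_cases h : ∃ k : ℕ, 2 * (k : ℤ) + 2 = n + (pparts α).card
    · obtain ⟨k, hk⟩ := h
      rw [hcoeff k hk, hex, Nat.cast_zero, mul_zero]
    · push Not at h
      rw [genusZero, coeff_symbol_of_ne]
      intro k hk
      rw [totalDeg_zpExp, sum_pparts] at hk
      exact h k (by omega)

theorem z_pow_mul_pPart {n : ℕ} (α : n.Partition) :
    z ^ n * pPart α = MvPowerSeries.monomial (zpExp (pparts α)) (1 : ℂ) := by
  have h1 : ∀ s : Multiset ℕ+, (s.map p).prod =
      MvPowerSeries.monomial (Multiset.toFinsupp (s.map some)) (1 : ℂ) := by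
    intro s
    induction s using Multiset.induction with
    | empty => simp
    | cons a s ih =>
      rw [Multiset.map_cons, Multiset.prod_cons, ih, Multiset.map_cons,
        ← Multiset.singleton_add, map_add, Multiset.toFinsupp_singleton, p, MvPowerSeries.X,
        MvPowerSeries.monomial_mul_monomial, one_mul]
  have h2 : pPart α = ((pparts α).map p).prod := by
    rw [pPart, pparts, Multiset.map_map]; rfl
  rw [h2, h1, z, MvPowerSeries.X_pow_eq, MvPowerSeries.monomial_mul_monomial, one_mul, zpExp,
    sum_pparts]

/-- Distinct pairs (n, α) have distinct monomials, so every coefficient of F₃ has at most one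
contribution, given by `minHurwitz3_div_eq`. Conversely the genus zero series has no monomials other
than those of partitions. -/
theorem F3_eq_genusZero : F3 = genusZero := by
  classical
  ext m
  have hc : ∀ t : (n : ℕ+) × (n : ℕ).Partition, MvPowerSeries.coeff m
      (((minHurwitz3 t.2 : ℂ) / ((t.1 : ℕ).factorial * (mu3 t.2).factorial)) •
        (z ^ (t.1 : ℕ) * pPart t.2)) =
      if m = zpExp (pparts t.2) then MvPowerSeries.coeff m genusZero else 0 := by
    intro t
    rw [MvPowerSeries.coeff_smul, z_pow_mul_pPart, MvPowerSeries.coeff_monomial,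
      minHurwitz3_div_eq _ t.1.pos]
    split_ifs with h
    · rw [h, mul_one]
    · rw [mul_zero]
  change ∑ᶠ t, _ = _
  simp only [hc]
  by_cases h : ∃ t : (n : ℕ+) × (n : ℕ).Partition, m = zpExp (pparts t.2)
  · obtain ⟨t, rfl⟩ := h
    rw [finsum_eq_single _ t, if_pos rfl]
    rintro ⟨n', α'⟩ hne
    rw [if_neg]
    intro heq
    apply hne
    obtain ⟨n, α⟩ := t
    have h1 : α.parts = α'.parts := by
      rw [← map_coe_pparts, ← map_coe_pparts, zpExp_injective heq]
    obtain rfl : n = n' := PNat.eq (by rw [← α.parts_sum, h1, α'.parts_sum])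
    rw [Nat.Partition.ext h1]
  · push Not at h
    rw [finsum_eq_zero_of_forall_eq_zero fun t => if_neg (h t)]
    by_contra h0
    obtain ⟨h1, h2⟩ := exists_of_coeff_genusZero_ne_zero (Ne.symm h0)
    set s := Finsupp.toMultiset m.some
    have h3 : (s.map PNat.val).sum = m none := by
      conv_rhs => rw [h1]
      rw [zpExp_none]
    let α : (m none).Partition := ⟨s.map PNat.val, by
      intro i hi
      obtain ⟨j, _, rfl⟩ := Multiset.mem_map.1 hi
      exact j.pos, h3⟩
    have h4 : pparts α = s := by
      rw [pparts, Multiset.map_map]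
      exact (Multiset.map_congr rfl fun i _ => PNat.coe_toPNat' i).trans (Multiset.map_id s)
    have h5 : m = zpExp (pparts α) := by rw [h4, ← h1]
    exact h ⟨⟨m none, h2⟩, α⟩ h5

/-! ## Locally finite sums -/

section Box

variable {N : ℕ+} {m : Option ℕ+ →₀ ℕ}

theorem coeff_lsum_box (f : ℕ+ × ℕ+ × ℕ+ → Series)
    (hf : ∀ i j k, (N < i ∨ N < j ∨ N < k) → MvPowerSeries.coeff m (f (i, j, k)) = 0) :
    MvPowerSeries.coeff m (lsum f) = ∑ i ∈ Finset.Icc 1 N, ∑ j ∈ Finset.Icc 1 N,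
      ∑ k ∈ Finset.Icc 1 N, MvPowerSeries.coeff m (f (i, j, k)) := by
  change ∑ᶠ t, MvPowerSeries.coeff m (f t) = _
  rw [finsum_eq_sum_of_support_subset (s := Finset.Icc 1 N ×ˢ (Finset.Icc 1 N ×ˢ Finset.Icc 1 N))]
  · simp only [Finset.sum_product]
  · rintro ⟨i, j, k⟩ h
    by_contra h0
    refine h (hf i j k ?_)
    simp only [Finset.coe_product, Set.mem_prod, Finset.mem_coe, Finset.mem_Icc, one_le,
      true_and] at h0
    rw [← not_le, ← not_le, ← not_le]
    tauto

/-- A factor ∂F/∂p_i with i > N is divisible by z^(N+1). This is what makes the infinite sums finite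
in each coefficient. -/
theorem PTerm.coeff_applyTilde_eq_zero (s : PTerm) (hm : m none ≤ N) (i : ℕ+) (hi : i ∈ s.der)
    (hN : N < i) : MvPowerSeries.coeff m (s.applyTilde genusZero) = 0 := by
  have h0 : dp i genusZero ∣ (s.der.map fun k => dp k genusZero).prod :=
    List.dvd_prod (List.mem_map.2 ⟨i, hi, rfl⟩)
  have h1 : (MvPowerSeries.X none : Series) ^ ((N : ℕ) + 1) ∣
      (s.mul.map p).prod * (s.der.map fun k => dp k genusZero).prod :=
    (X_pow_dvd_dp_genusZero N i (PNat.coe_lt_coe _ _ |>.2 hN)).trans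
      (h0.trans (dvd_mul_left _ _))
  rw [PTerm.applyTilde, MvPowerSeries.coeff_smul, MvPowerSeries.X_pow_dvd_iff.1 h1 m (by omega),
    mul_zero]

/-- In each term the indices i, j, k are all distributed among the derivatives, so a large index
forces a large derivative. -/
theorem exists_mem_der_W3Terms {i j k : ℕ+} (h : N < i ∨ N < j ∨ N < k) {s : PTerm}
    (hs : s ∈ W3Terms i j k) : ∃ l ∈ s.der, N < l := by
  have l1 : ∀ a b : ℕ+, N < a → N < a + b := fun a b h => h.trans (PNat.lt_add_right a b)
  have l2 : ∀ a b : ℕ+, N < b → N < a + b := fun a b h => h.trans (PNat.lt_add_left b a)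
  simp only [W3Terms, List.mem_cons, List.not_mem_nil, or_false] at hs
  rcases hs with rfl | rfl | rfl | rfl | rfl | rfl <;>
    simp only [List.mem_cons, List.not_mem_nil, or_false, exists_eq_or_imp, exists_eq_left] <;>
    rcases h with h | h | h <;> grind

theorem coeff_applyTilde_W3Terms_eq_zero (hm : m none ≤ N) {i j k : ℕ+}
    (h : N < i ∨ N < j ∨ N < k) {s : PTerm} (hs : s ∈ W3Terms i j k) :
    MvPowerSeries.coeff m (s.applyTilde genusZero) = 0 := by
  obtain ⟨l, hl, hN⟩ := exists_mem_der_W3Terms h hs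
  exact s.coeff_applyTilde_eq_zero hm l hl hN

end Box

theorem coeff_X_mul_pderiv {κ : Type*} (i : κ) (F : MvPowerSeries κ ℂ) (m : κ →₀ ℕ) :
    MvPowerSeries.coeff m (MvPowerSeries.X i * MvPowerSeries.pderiv ℂ i F) =
      (m i : ℂ) * MvPowerSeries.coeff m F := by
  classical
  rw [MvPowerSeries.X, MvPowerSeries.coeff_monomial_mul]
  split_ifs with h
  · have h1 : 1 ≤ m i := by simpa using h i
    rw [one_mul, MvPowerSeries.coeff_pderiv, tsub_add_cancel_of_le h, mul_comm, Finsupp.tsub_apply,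
      Finsupp.single_eq_same, Nat.cast_sub h1, Nat.cast_one, sub_add_cancel]
  · have h1 : m i = 0 := by
      by_contra h0
      exact h (Finsupp.single_le_iff.2 (by omega))
    rw [h1, Nat.cast_zero, zero_mul]

theorem coeff_lsum_p_mul_dp (F : Series) (m : Option ℕ+ →₀ ℕ) :
    MvPowerSeries.coeff m (lsum fun i : ℕ+ => p i * dp i F) =
      (m.some.degree : ℂ) * MvPowerSeries.coeff m F := by
  have h1 : ∀ i : ℕ+, MvPowerSeries.coeff m (p i * dp i F) =
      (m (some i) : ℂ) * MvPowerSeries.coeff m F := fun i => coeff_X_mul_pderiv _ _ _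
  change ∑ᶠ i : ℕ+, MvPowerSeries.coeff m (p i * dp i F) = _
  simp only [h1]
  rw [finsum_eq_sum_of_support_subset (s := m.some.support), ← Finset.sum_mul,
    Finsupp.degree_apply, Nat.cast_sum]
  · rfl
  · intro i hi
    rw [Finset.mem_coe, Finsupp.mem_support_iff]
    intro h
    exact hi (by simp [← Finsupp.some_apply, h])

theorem coeff_z_mul_dz (F : Series) (m : Option ℕ+ →₀ ℕ) :
    MvPowerSeries.coeff m (z * dz F) = (m none : ℂ) * MvPowerSeries.coeff m F :=
  coeff_X_mul_pderiv _ _ _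

/-- The right-hand side of the genus zero equation. -/
theorem coeff_euler_genusZero (N : ℕ+) (m : Option ℕ+ →₀ ℕ) (hm : m none ≤ N) :
    MvPowerSeries.coeff m ((1 / 2 : ℂ) • (z * dz genusZero +
      lsum (fun i : ℕ+ => p i * dp i genusZero) - 2 * genusZero)) =
    (1 / 3 : ℂ) * ∑ i ∈ Finset.Icc 1 N, ∑ j ∈ Finset.Icc 1 N, ∑ k ∈ Finset.Icc 1 N,
      MvPowerSeries.coeff m ((W3MainTerms i j k).map (fun s => s.applyTilde genusZero)).sum := by
  have h := coeff_genusZero_eq N m hm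
  simp only [map_sum] at h
  rw [← h, MvPowerSeries.coeff_smul, map_sub, map_add, coeff_z_mul_dz, coeff_lsum_p_mul_dp,
    two_mul, map_add, totalDeg]
  push_cast
  ring

/-- The subtracted sum is exactly the sixth term of the operator, so the five main terms remain. -/
theorem coeff_Wtilde3_genusZero (N : ℕ+) (m : Option ℕ+ →₀ ℕ) (hm : m none ≤ N) :
    MvPowerSeries.coeff m (Wtilde3 genusZero -
        (1 / 3 : ℂ) • lsum (fun t : ℕ+ × ℕ+ × ℕ+ => ((t.1 : ℂ) + t.2.1 + t.2.2) •
          (p (t.1 + t.2.1 + t.2.2) * dp (t.1 + t.2.1 + t.2.2) genusZero))) =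
    (1 / 3 : ℂ) * ∑ i ∈ Finset.Icc 1 N, ∑ j ∈ Finset.Icc 1 N, ∑ k ∈ Finset.Icc 1 N,
      MvPowerSeries.coeff m ((W3MainTerms i j k).map (fun s => s.applyTilde genusZero)).sum := by
  have hlast : ∀ i j k : ℕ+, ((i : ℂ) + j + k) • (p (i + j + k) * dp (i + j + k) genusZero) =
      PTerm.applyTilde ⟨(i : ℂ) + j + k, [i + j + k], [i + j + k]⟩ genusZero := by
    intro i j k
    simp [PTerm.applyTilde]
  rw [map_sub, Wtilde3, MvPowerSeries.coeff_smul, MvPowerSeries.coeff_smul,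
    coeff_lsum_box (N := N), coeff_lsum_box (N := N), ← mul_sub]
  · simp only [← Finset.sum_sub_distrib]
    congr 1
    refine Finset.sum_congr rfl fun i _ => Finset.sum_congr rfl fun j _ =>
      Finset.sum_congr rfl fun k _ => ?_
    rw [hlast, W3Terms_eq, List.map_append, List.sum_append, map_add, List.map_singleton,
      List.sum_singleton, add_sub_cancel_right]
  · intro i j k h
    rw [hlast]
    exact coeff_applyTilde_W3Terms_eq_zero hm h (by simp [W3Terms])
  · intro i j k h
    rw [map_list_sum, List.map_map]
    refine List.sum_eq_zero fun c hc => ?_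
    obtain ⟨s, hs, rfl⟩ := List.mem_map.1 hc
    exact coeff_applyTilde_W3Terms_eq_zero hm h hs

/-- The three mixed terms are cyclic relabellings of one expression, so after summation over i, j, k
they combine into the coefficient 3. -/
theorem coeff_written_out (N : ℕ+) (m : Option ℕ+ →₀ ℕ) (hm : m none ≤ N) :
    MvPowerSeries.coeff m (lsum (fun t : ℕ+ × ℕ+ × ℕ+ =>
          ((t.1 : ℂ) + t.2.1 + t.2.2) •
            (p t.1 * p t.2.1 * p t.2.2 * dp (t.1 + t.2.1 + t.2.2) genusZero) +
          ((t.1 : ℂ) * t.2.1 * t.2.2) •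
            (p (t.1 + t.2.1 + t.2.2) * dp t.1 genusZero * dp t.2.1 genusZero *
              dp t.2.2 genusZero) +
          (3 * ((t.1 : ℂ) + t.2.1) * t.2.2) •
            (p t.1 * p (t.2.1 + t.2.2) * dp (t.1 + t.2.1) genusZero * dp t.2.2 genusZero))) =
    ∑ i ∈ Finset.Icc 1 N, ∑ j ∈ Finset.Icc 1 N, ∑ k ∈ Finset.Icc 1 N,
      MvPowerSeries.coeff m ((W3MainTerms i j k).map (fun s => s.applyTilde genusZero)).sum := by
  let M : ℕ+ → ℕ+ → ℕ+ → ℂ := fun i j k => MvPowerSeries.coeff m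
    (PTerm.applyTilde ⟨(k : ℂ) * (i + j), [k + j, i], [k, i + j]⟩ genusZero)
  let P : ℕ+ → ℕ+ → ℕ+ → ℂ := fun i j k => MvPowerSeries.coeff m
    (PTerm.applyTilde ⟨(i : ℂ) + j + k, [i, j, k], [i + j + k]⟩ genusZero)
  let Q : ℕ+ → ℕ+ → ℕ+ → ℂ := fun i j k => MvPowerSeries.coeff m
    (PTerm.applyTilde ⟨(i : ℂ) * j * k, [i + j + k], [i, j, k]⟩ genusZero)
  have hf : ∀ i j k : ℕ+, MvPowerSeries.coeff m (((i : ℂ) + j + k) •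
            (p i * p j * p k * dp (i + j + k) genusZero) +
          ((i : ℂ) * j * k) •
            (p (i + j + k) * dp i genusZero * dp j genusZero * dp k genusZero) +
          (3 * ((i : ℂ) + j) * k) •
            (p i * p (j + k) * dp (i + j) genusZero * dp k genusZero)) =
      P i j k + Q i j k + 3 * M i j k := by
    intro i j k
    simp only [P, Q, M, PTerm.applyTilde, map_add, MvPowerSeries.coeff_smul, List.map_cons,
      List.map_nil, List.prod_cons, List.prod_nil, mul_one]
    rw [show p i * p j * p k * dp (i + j + k) genusZero =
        p i * (p j * p k) * dp (i + j + k) genusZero by ring,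
      show p (i + j + k) * dp i genusZero * dp j genusZero * dp k genusZero =
        p (i + j + k) * (dp i genusZero * (dp j genusZero * dp k genusZero)) by ring,
      show p i * p (j + k) * dp (i + j) genusZero * dp k genusZero =
        p (k + j) * p i * (dp k genusZero * dp (i + j) genusZero) by rw [add_comm k j]; ring]
    ring
  rw [coeff_lsum_box (N := N)]
  · simp only [hf]
    have hmain : ∀ i j k : ℕ+, MvPowerSeries.coeff m
        ((W3MainTerms i j k).map (fun s => s.applyTilde genusZero)).sum =
        Q i j k + M j k i + M k i j + M i j k + P i j k := by
      intro i j k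
      simp only [W3MainTerms, List.map_cons, List.map_nil, List.sum_cons, List.sum_nil, map_add,
        add_zero, P, Q, M]
      rw [add_comm i k, add_comm j i]
      simp only [PTerm.applyTilde, List.map_cons,
        List.map_nil, List.prod_cons, List.prod_nil, mul_one]
      ring_nf
    simp only [hmain, Finset.sum_add_distrib, ← Finset.mul_sum]
    have r1 : ∑ i ∈ Finset.Icc 1 N, ∑ j ∈ Finset.Icc 1 N, ∑ k ∈ Finset.Icc 1 N, M j k i =
        ∑ i ∈ Finset.Icc 1 N, ∑ j ∈ Finset.Icc 1 N, ∑ k ∈ Finset.Icc 1 N, M i j k := by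
      rw [Finset.sum_comm]
      exact Finset.sum_congr rfl fun i _ => Finset.sum_comm
    have r2 : ∑ i ∈ Finset.Icc 1 N, ∑ j ∈ Finset.Icc 1 N, ∑ k ∈ Finset.Icc 1 N, M k i j =
        ∑ i ∈ Finset.Icc 1 N, ∑ j ∈ Finset.Icc 1 N, ∑ k ∈ Finset.Icc 1 N, M i j k := by
      rw [Finset.sum_congr rfl fun i _ => Finset.sum_comm]
      exact Finset.sum_comm
    rw [r1, r2]
    ring
  · intro i j k h
    dsimp only
    rw [hf]
    have e1 : P i j k = 0 := coeff_applyTilde_W3Terms_eq_zero hm h (by simp [W3Terms])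
    have e2 : Q i j k = 0 := coeff_applyTilde_W3Terms_eq_zero hm h (by simp [W3Terms])
    have e3 : M i j k = 0 := coeff_applyTilde_W3Terms_eq_zero hm h (by simp [W3Terms])
    rw [e1, e2, e3]
    ring

end

end ThreeHurwitz

end

theorem theorem5p5 :
    (Wtilde3 F3 -
        (1 / 3 : ℂ) • lsum (fun t : ℕ+ × ℕ+ × ℕ+ =>
          ((t.1 : ℂ) + t.2.1 + t.2.2) • (p (t.1 + t.2.1 + t.2.2) * dp (t.1 + t.2.1 + t.2.2) F3)) =
      (1 / 2 : ℂ) • (z * dz F3 + lsum (fun i : ℕ+ => p i * dp i F3) - 2 * F3)) ∧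
    ((1 / 3 : ℂ) • lsum (fun t : ℕ+ × ℕ+ × ℕ+ =>
          ((t.1 : ℂ) + t.2.1 + t.2.2) •
            (p t.1 * p t.2.1 * p t.2.2 * dp (t.1 + t.2.1 + t.2.2) F3) +
          ((t.1 : ℂ) * t.2.1 * t.2.2) •
            (p (t.1 + t.2.1 + t.2.2) * dp t.1 F3 * dp t.2.1 F3 * dp t.2.2 F3) +
          (3 * ((t.1 : ℂ) + t.2.1) * t.2.2) •
            (p t.1 * p (t.2.1 + t.2.2) * dp (t.1 + t.2.1) F3 * dp t.2.2 F3)) -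
        (1 / 2 : ℂ) • (z * dz F3 + lsum (fun i : ℕ+ => p i * dp i F3) - 2 * F3) = 0) := by
  rw [F3_eq_genusZero]
  refine ⟨?_, ?_⟩
  · ext m
    -- The successor gives a positive cutoff even when z does not occur in the monomial.
    have hm : m none ≤ ((m none).succPNat : ℕ) := by simp
    rw [coeff_euler_genusZero _ m hm, coeff_Wtilde3_genusZero _ m hm]
  · ext m
    have hm : m none ≤ ((m none).succPNat : ℕ) := by simp
    rw [map_sub, map_zero, coeff_euler_genusZero _ m hm, MvPowerSeries.coeff_smul,
      coeff_written_out _ m hm, sub_self]
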